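/- Conventions. For $C^*$-algebras $A$ and $B$ let $M(B)$ be the multiplier algebra of $B$, $Q(B)=M(B)/B$ and $q_B:M(B)\to Q(B)$ the quotient map. An extension of $A$ by $B$ is a $*$-homomorphism $\varphi:A\to Q(B)$. The sum of two extensions is $(\varphi\oplus\psi)(a)=q_B(V_1)\varphi(a)q_B(V_1)^*+q_B(V_2)\psi(a)q_B(V_2)^*$, where $V_1,V_2\in M(B)$ are isometries with $V_1V_1^*+V_2V_2^*=1$; up to unitary equivalence it does not depend on the choice of $V_1,V_2$. An extension $\varphi$ is split if $\varphi=q_B\circ\pi$ for a $*$-homomorphism $\pi:A\to M(B)$, and asymptotically split if there is a Connes–Higson asymptotic homomorphism $\pi_t:A\to M(B)$, $t\in[1,\infty)$ (that is, $t\mapsto\pi_t(a)$ is norm-continuous for every $a\in A$, and the $\pi_t$ are pointwise asymptotically linear, multiplicative and $*$-preserving as $t\to\infty$) such that $q_B\circ\pi_t=\varphi$ for all $t$. Two extensions $\varphi,\varphi'$ are strongly homotopic if there are extensions $\psi_t:A\to Q(B)$, $t\in[0,1]$, with $t\mapsto\psi_t(a)$ norm-continuous for every $a\in A$, $\psi_0=\varphi$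 and $\psi_1=\varphi'$. An extension $\varphi$ is semi-invertible if there is an extension $\varphi'$ of $A$ by $B$ such that $\varphi\oplus\varphi'$ is asymptotically split, and strongly homotopy invertible if there is an extension $\psi$ of $A$ by $B$ such that $\varphi\oplus\psi$ is strongly homotopic to a split extension. $B$ is stable if $B\cong\mathbb K\otimes B$, where $\mathbb K$ is the algebra of compact operators on $\ell^2(\mathbb N)$. Proposition. Let $G$ be a countable discrete group, $H$ a finite group, $k\in\mathbb N=\{0,1,2,\dots\}$, and let $B$ be a separable stable $C^*$-algebra. Then: (1) if all extensions of $C^*_r(G)$ by $B$ are semi-invertible, then all extensions of $C^*_r(\mathbb Z^k\times H\times G)$ by $B$ are semi-invertible; (2) if all extensions of $C^*_r(G)$ by $B$ are strongly homotopy invertible, then all extensions of $C^*_r(\mathbb Z^k\times H\times G)$ by $B$ are strongly homotopy invertible; (3) and (4): the same two implications hold with the reduced group $C^*$-algebras $C^*_r(\cdot)$ replaced by the full group $C^*$-algebras $C^*(\cdot)$ throughout. -/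

import Mathlib

open scoped ENNReal

universe u v w

noncomputable section

namespace CStarExt

/-! ### The generalized Calkin algebra `Q(B) = M(B) / B` -/

section Corona

variable (B : Type w) [NonUnitalCStarAlgebra B]

/-- The multiplier algebra `M(B)` (Mathlib's algebra of double centralizers). -/
abbrev Multiplier : Type w := DoubleCentralizer ℂ B

/-- The canonical copy of `B` inside `M(B)`, as an ideal. -/
def coronaIdeal : Ideal (Multiplier B) where
  carrier := Set.range (DoubleCentralizer.coeHom (𝕜 := ℂ) (A := B))
  add_mem' := by
    rintro _ _ ⟨a, rfl⟩ ⟨b, rfl⟩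
    exact ⟨a + b, map_add _ a b⟩
  zero_mem' := ⟨0, map_zero _⟩
  smul_mem' := by
    rintro m _ ⟨b, rfl⟩
    refine ⟨m.fst b, ?_⟩
    have h : ∀ x y : B, m.fst (x * y) = m.fst x * y := by
      intro x y
      have key : ∀ z : B, z * (m.fst (x * y) - m.fst x * y) = 0 := by
        intro z
        rw [mul_sub, ← m.central z (x * y), ← mul_assoc z, ← m.central z x, mul_assoc, sub_self]
      have := key (star (m.fst (x * y) - m.fst x * y))
      exact sub_eq_zero.mp (CStarRing.star_mul_self_eq_zero_iff _ |>.mp this)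
    refine DoubleCentralizer.ext ℂ B _ _ (Prod.ext ?_ ?_)
    · ext y
      simp [h]
    · ext y
      simp [m.central]

instance coronaIdeal_isTwoSided : (coronaIdeal B).IsTwoSided where
  mul_mem_of_left := by
    rintro _ m ⟨b, rfl⟩
    have hs : star (DoubleCentralizer.coeHom (𝕜 := ℂ) (A := B) b) ∈ coronaIdeal B :=
      ⟨star b, map_star _ b⟩
    obtain ⟨c, hc⟩ := (coronaIdeal B).mul_mem_left (star m) hs
    refine ⟨star c, ?_⟩
    rw [map_star, hc, star_mul, star_star, star_star]

/-- The generalized Calkin algebra `Q(B) = M(B) / B`. -/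
def Corona : Type w := Multiplier B ⧸ coronaIdeal B

instance : Ring (Corona B) := inferInstanceAs (Ring (Multiplier B ⧸ coronaIdeal B))

instance : Algebra ℂ (Corona B) := inferInstanceAs (Algebra ℂ (Multiplier B ⧸ coronaIdeal B))

theorem isClosed_coronaIdeal : IsClosed (coronaIdeal B : Set (Multiplier B)) := by
  have hinj : Function.Injective (DoubleCentralizer.coeHom (𝕜 := ℂ) (A := B)) := by
    rw [injective_iff_map_eq_zero]
    intro b hb
    have h : (DoubleCentralizer.coeHom (𝕜 := ℂ) (A := B) b).fst (star b) = 0 := by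
      rw [hb]
      rfl
    exact (CStarRing.mul_star_self_eq_zero_iff b).mp h
  exact (NonUnitalStarAlgHom.isometry _ hinj).isClosedEmbedding.isClosed_range

theorem corona_norm_mul_le (x y : Multiplier B ⧸ coronaIdeal B) : ‖x * y‖ ≤ ‖x‖ * ‖y‖ := by
  refine le_of_forall_pos_le_add fun ε hε => ?_
  obtain ⟨δ, hδ, hlt⟩ : ∃ δ > 0, (‖x‖ + δ) * (‖y‖ + δ) < ‖x‖ * ‖y‖ + ε := by
    have hc : Filter.Tendsto (fun δ : ℝ => (‖x‖ + δ) * (‖y‖ + δ)) (nhdsWithin 0 (Set.Ioi 0))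
        (nhds (‖x‖ * ‖y‖)) := by
      have : Continuous fun δ : ℝ => (‖x‖ + δ) * (‖y‖ + δ) := by fun_prop
      simpa using (this.tendsto 0).mono_left nhdsWithin_le_nhds
    have h1 := hc.eventually (gt_mem_nhds (lt_add_of_pos_right _ hε))
    obtain ⟨δ, h, h'⟩ := (h1.and self_mem_nhdsWithin).exists
    exact ⟨δ, h', h⟩
  obtain ⟨a, rfl, ha⟩ := Submodule.Quotient.norm_mk_lt x hδ
  obtain ⟨b, rfl, hb⟩ := Submodule.Quotient.norm_mk_lt y hδ
  refine le_trans ?_ hlt.le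
  refine (Submodule.Quotient.norm_mk_le (coronaIdeal B) (a * b)).trans ?_
  exact (norm_mul_le a b).trans
    (mul_le_mul ha.le hb.le (norm_nonneg _) ((norm_nonneg _).trans ha.le))

/-- The norm of `Q(B)` is the quotient norm. -/
instance : NormedRing (Corona B) :=
  letI I : NormedAddCommGroup (Multiplier B ⧸ coronaIdeal B) :=
    Submodule.Quotient.normedAddCommGroup (hS := isClosed_coronaIdeal B) (coronaIdeal B)
  { (inferInstance : Ring (Corona B)) with
    toNorm := I.toNorm
    toMetricSpace := I.toMetricSpace
    dist_eq := I.dist_eq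
    norm_mul_le := corona_norm_mul_le B }

variable {B} in
theorem star_mem_coronaIdeal {m : Multiplier B} (hm : m ∈ coronaIdeal B) :
    star m ∈ coronaIdeal B := by
  obtain ⟨b, rfl⟩ := hm
  exact ⟨star b, map_star _ b⟩

/-- The quotient map, as a ring homomorphism. -/
def coronaMkRingHom : Multiplier B →+* Corona B := Ideal.Quotient.mk (coronaIdeal B)

theorem coronaMkRingHom_surjective : Function.Surjective (coronaMkRingHom B) :=
  Ideal.Quotient.mk_surjective

/-- The involution of `Q(B)` is induced by that of `M(B)`. -/
instance : Star (Corona B) where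
  star := Quotient.map' star (by
    intro a b hab
    rw [Submodule.quotientRel_def] at hab ⊢
    rw [← star_sub]
    exact star_mem_coronaIdeal hab)

theorem star_coronaMkRingHom (m : Multiplier B) :
    star (coronaMkRingHom B m) = coronaMkRingHom B (star m) := rfl

instance : StarRing (Corona B) where
  star_involutive x := by
    obtain ⟨m, rfl⟩ := coronaMkRingHom_surjective B x
    simp only [star_coronaMkRingHom, star_star]
  star_mul x y := by
    obtain ⟨m, rfl⟩ := coronaMkRingHom_surjective B x
    obtain ⟨n, rfl⟩ := coronaMkRingHom_surjective B y
    rw [← map_mul]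
    simp only [star_coronaMkRingHom]
    rw [← map_mul, star_mul]
  star_add x y := by
    obtain ⟨m, rfl⟩ := coronaMkRingHom_surjective B x
    obtain ⟨n, rfl⟩ := coronaMkRingHom_surjective B y
    rw [← map_add]
    simp only [star_coronaMkRingHom]
    rw [← map_add, star_add]

/-- The canonical surjection `q_B : M(B) → Q(B)`. -/
def coronaMk : Multiplier B →⋆ₐ[ℂ] Corona B where
  __ := coronaMkRingHom B
  commutes' _ := rfl
  map_star' _ := rfl

end Corona

/-! ### Stable C*-algebras -/

section Stable

/-- A faithful representation of a C*-algebra on a Hilbert space. -/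
structure FaithfulRep (B : Type w) [NonUnitalCStarAlgebra B] : Type (w + 1) where
  space : Type w
  [normed : NormedAddCommGroup space]
  [inner : InnerProductSpace ℂ space]
  [complete : CompleteSpace space]
  toHom : B →⋆ₙₐ[ℂ] (space →L[ℂ] space)
  injective : Function.Injective toHom

attribute [instance] FaithfulRep.normed FaithfulRep.inner FaithfulRep.complete

variable {B : Type w} [NonUnitalCStarAlgebra B]

/-- The operator `e i j ⊗ T` on `ℓ²(ℕ, 𝓗) = ℓ²(ℕ) ⊗ 𝓗`, where `e i j` are the standard matrix
units of the algebra of compact operators on `ℓ²(ℕ)`. -/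
def matrixUnitTensor {𝓗 : Type w} [NormedAddCommGroup 𝓗] [InnerProductSpace ℂ 𝓗]
    (i j : ℕ) (T : 𝓗 →L[ℂ] 𝓗) :
    lp (fun _ : ℕ => 𝓗) 2 →L[ℂ] lp (fun _ : ℕ => 𝓗) 2 :=
  (lp.singleContinuousLinearMap ℂ (fun _ : ℕ => 𝓗) 2 i).comp
    (T.comp (lp.evalCLM ℂ (fun _ : ℕ => 𝓗) 2 j))

/-- The (spatial) tensor product `𝕂 ⊗ B` with the compact operators on `ℓ²(ℕ)`, where `B` acts
faithfully on a Hilbert space `𝓗`: the C*-algebra of operators on `ℓ²(ℕ) ⊗ 𝓗` generated by the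
elements `e i j ⊗ b`. Up to isomorphism it does not depend on the faithful representation. -/
def stabilization (π : FaithfulRep B) :
    NonUnitalStarSubalgebra ℂ
      (lp (fun _ : ℕ => π.space) 2 →L[ℂ] lp (fun _ : ℕ => π.space) 2) :=
  (NonUnitalStarAlgebra.adjoin ℂ
    {S | ∃ (i j : ℕ) (b : B), S = matrixUnitTensor i j (π.toHom b)}).topologicalClosure

variable (B) in
/-- `B` is stable: `B ≅ 𝕂 ⊗ B` as C*-algebras. -/
def IsStable : Prop :=
  ∃ π : FaithfulRep B, Nonempty (B ≃⋆ₐ[ℂ] stabilization π)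

end Stable

/-! ### Extensions -/

section Extensions

variable (A : Type v) [NonUnitalCStarAlgebra A] (B : Type w) [NonUnitalCStarAlgebra B]

/-- An extension of `A` by `B`, given by its Busby invariant `A → Q(B)`. -/
abbrev Extension : Type (max v w) := A →⋆ₙₐ[ℂ] Corona B

/-- Isometries `V₁, V₂ ∈ M(B)` with `V₁ V₁* + V₂ V₂* = 1`. -/
structure IsometryPair : Type w where
  V₁ : Multiplier B
  V₂ : Multiplier B
  isometry₁ : star V₁ * V₁ = 1
  isometry₂ : star V₂ * V₂ = 1
  sum_eq_one : V₁ * star V₁ + V₂ * star V₂ = 1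

variable {B} in
theorem IsometryPair.orthogonal (V : IsometryPair B) : star V.V₁ * V.V₂ = 0 := by
  have h := congrArg (fun x => star V.V₁ * x * V.V₂) V.sum_eq_one
  have h1 : star V.V₁ * (V.V₁ * star V.V₁ + V.V₂ * star V.V₂) * V.V₂
      = (star V.V₁ * V.V₁) * (star V.V₁ * V.V₂) + (star V.V₁ * V.V₂) * (star V.V₂ * V.V₂) := by
    noncomm_ring
  simp only [h1, V.isometry₁, V.isometry₂, one_mul, mul_one] at h
  simpa using h

variable {B} in
theorem IsometryPair.orthogonal' (V : IsometryPair B) : star V.V₂ * V.V₁ = 0 := by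
  have h := congrArg star V.orthogonal
  simpa using h

variable {A B}

/-- The sum `φ ⊕ ψ` of two extensions, formed with the isometries `V₁, V₂`:
`a ↦ q(V₁) φ(a) q(V₁)* + q(V₂) ψ(a) q(V₂)*`. -/
def extensionSum (V : IsometryPair B) (φ ψ : Extension A B) : Extension A B where
  toFun a := coronaMk B V.V₁ * φ a * star (coronaMk B V.V₁)
    + coronaMk B V.V₂ * ψ a * star (coronaMk B V.V₂)
  map_smul' c a := by
    simp only [map_smul, mul_smul_comm, smul_mul_assoc, smul_add, MonoidHom.id_apply]
  map_zero' := by simp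
  map_add' a b := by
    simp only [map_add, mul_add, add_mul]
    abel
  map_mul' a b := by
    have h11 : star (coronaMk B V.V₁) * coronaMk B V.V₁ = 1 := by
      rw [← map_star, ← map_mul, V.isometry₁, map_one]
    have h22 : star (coronaMk B V.V₂) * coronaMk B V.V₂ = 1 := by
      rw [← map_star, ← map_mul, V.isometry₂, map_one]
    have h12 : star (coronaMk B V.V₁) * coronaMk B V.V₂ = 0 := by
      rw [← map_star, ← map_mul, V.orthogonal, map_zero]
    have h21 : star (coronaMk B V.V₂) * coronaMk B V.V₁ = 0 := by
      rw [← map_star, ← map_mul, V.orthogonal', map_zero]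
    generalize coronaMk B V.V₁ = v at *
    generalize coronaMk B V.V₂ = w at *
    have e : (v * φ a * star v + w * ψ a * star w) * (v * φ b * star v + w * ψ b * star w)
        = v * φ a * (star v * v) * φ b * star v + v * φ a * (star v * w) * ψ b * star w
          + w * ψ a * (star w * v) * φ b * star v + w * ψ a * (star w * w) * ψ b * star w := by
      noncomm_ring
    rw [e, h11, h22, h12, h21]
    simp [mul_assoc]
  map_star' a := by
    simp only [map_star, star_add, star_mul, star_star, mul_assoc]

/-- An extension is split if it lifts to a `*`-homomorphism `A → M(B)`. -/
def IsSplit (φ : Extension A B) : Prop :=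
  ∃ π : A →⋆ₙₐ[ℂ] Multiplier B, ∀ a, coronaMk B (π a) = φ a

/-- An asymptotic homomorphism (in the sense of Connes and Higson) `π t : A → D`, `t ∈ [1, ∞)`. -/
structure IsAsymptoticHom {D : Type w} [NonUnitalCStarAlgebra D]
    (π : Set.Ici (1 : ℝ) → A → D) : Prop where
  continuous : ∀ a, Continuous fun t => π t a
  add : ∀ a b, Filter.Tendsto (fun t => ‖π t (a + b) - (π t a + π t b)‖) Filter.atTop (nhds 0)
  smul : ∀ (c : ℂ) a, Filter.Tendsto (fun t => ‖π t (c • a) - c • π t a‖) Filter.atTop (nhds 0)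
  mul : ∀ a b, Filter.Tendsto (fun t => ‖π t (a * b) - π t a * π t b‖) Filter.atTop (nhds 0)
  star : ∀ a, Filter.Tendsto (fun t => ‖π t (star a) - star (π t a)‖) Filter.atTop (nhds 0)

/-- An extension is asymptotically split if it lifts to an asymptotic homomorphism
`π t : A → M(B)` with `q_B ∘ π t = φ` for all `t`. -/
def IsAsymptoticallySplit (φ : Extension A B) : Prop :=
  ∃ π : Set.Ici (1 : ℝ) → A → Multiplier B,
    IsAsymptoticHom π ∧ ∀ t a, coronaMk B (π t a) = φ a

/-- `φ` is semi-invertible: `φ ⊕ φ'` is asymptotically split for some extension `φ'`. Up to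
unitary equivalence the sum does not depend on the choice of the isometries. -/
def IsSemiInvertible (φ : Extension A B) : Prop :=
  ∃ (V : IsometryPair B) (φ' : Extension A B), IsAsymptoticallySplit (extensionSum V φ φ')

/-- Strong homotopy of extensions: a path of extensions, pointwise norm-continuous. -/
def StronglyHomotopic (φ φ' : Extension A B) : Prop :=
  ∃ ψ : unitInterval → Extension A B,
    (∀ a, Continuous fun t => ψ t a) ∧ ψ 0 = φ ∧ ψ 1 = φ'

/-- `φ` is strongly homotopy invertible: `φ ⊕ ψ` is strongly homotopic to a split extension for
some extension `ψ`. -/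
def IsStronglyHomotopyInvertible (φ : Extension A B) : Prop :=
  ∃ (V : IsometryPair B) (ψ σ : Extension A B),
    IsSplit σ ∧ StronglyHomotopic (extensionSum V φ ψ) σ

variable (A B)

/-- All extensions of `A` by `B` are semi-invertible. -/
def AllSemiInvertible : Prop := ∀ φ : Extension A B, IsSemiInvertible φ

/-- All extensions of `A` by `B` are strongly homotopy invertible. -/
def AllStronglyHomotopyInvertible : Prop :=
  ∀ φ : Extension A B, IsStronglyHomotopyInvertible φ

end Extensions

/-! ### Group C*-algebras of discrete groups -/

section GroupCStar

variable (G : Type u) [Group G]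

/-- A unitary representation of the discrete group `G` on a Hilbert space. -/
structure UnitaryRep : Type (u + 1) where
  space : Type u
  [normed : NormedAddCommGroup space]
  [inner : InnerProductSpace ℂ space]
  [complete : CompleteSpace space]
  toHom : G →* unitary (space →L[ℂ] space)

attribute [instance] UnitaryRep.normed UnitaryRep.inner UnitaryRep.complete

variable {G}

theorem memℓp_translate (g : G) (f : lp (fun _ : G => ℂ) 2) :
    Memℓp (fun h => f (g⁻¹ * h)) 2 := by
  have h2 : 0 < (2 : ℝ≥0∞).toReal := by norm_num
  rw [memℓp_gen_iff h2]
  exact ((memℓp_gen_iff h2).1 (lp.memℓp f)).comp_injective (mul_right_injective g⁻¹)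

variable (G) in
/-- Left translation on `ℓ²(G)`: `(leftTranslation g f) h = f (g⁻¹ * h)`. -/
def leftTranslation : G →* (lp (fun _ : G => ℂ) 2 ≃ₗᵢ[ℂ] lp (fun _ : G => ℂ) 2) where
  toFun g :=
    { toFun := fun f => ⟨fun h => f (g⁻¹ * h), memℓp_translate g f⟩
      invFun := fun f => ⟨fun h => f (g⁻¹⁻¹ * h), memℓp_translate g⁻¹ f⟩
      map_add' := fun _ _ => rfl
      map_smul' := fun _ _ => rfl
      left_inv := fun f => by ext h; simp
      right_inv := fun f => by ext h; simp
      norm_map' := fun f => by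
        have h2 : 0 < (2 : ℝ≥0∞).toReal := by norm_num
        rw [lp.norm_eq_tsum_rpow h2, lp.norm_eq_tsum_rpow h2]
        congr 1
        exact (Equiv.mulLeft g⁻¹).tsum_eq (fun h => ‖f h‖ ^ (2 : ℝ≥0∞).toReal) }
  map_one' := by ext f h; simp
  map_mul' g g' := by
    ext f h
    change f ((g * g')⁻¹ * h) = f (g'⁻¹ * (g⁻¹ * h))
    rw [mul_inv_rev, mul_assoc]

variable (G) in
/-- The left regular representation of `G` on `ℓ²(G)`. -/
def leftRegular : G →* unitary (lp (fun _ : G => ℂ) 2 →L[ℂ] lp (fun _ : G => ℂ) 2) :=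
  (Unitary.linearIsometryEquiv (𝕜 := ℂ) (H := lp (fun _ : G => ℂ) 2)).symm.toMonoidHom.comp
    (leftTranslation G)

variable (G) in
/-- The C*-algebra of operators on `ℓ²(G)` generated by the left regular representation. -/
def reducedSubalgebra :
    NonUnitalStarSubalgebra ℂ (lp (fun _ : G => ℂ) 2 →L[ℂ] lp (fun _ : G => ℂ) 2) :=
  (NonUnitalStarAlgebra.adjoin ℂ
    (Set.range fun g : G =>
      (leftRegular G g : lp (fun _ : G => ℂ) 2 →L[ℂ] lp (fun _ : G => ℂ) 2))).topologicalClosure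

variable (G) in
/-- The reduced group C*-algebra `C*_r(G)`. -/
def ReducedGroupCStar : Type u := reducedSubalgebra G

instance : NonUnitalCStarAlgebra (ReducedGroupCStar G) :=
  NonUnitalStarSubalgebra.nonUnitalCStarAlgebra (reducedSubalgebra G)
    (h_closed := NonUnitalStarSubalgebra.isClosed_topologicalClosure _)

/-- The image of `g` under the universal representation: the family `(ρ(g))_ρ`, over all unitary
representations `ρ` of `G`, in the `ℓ^∞`-product of the algebras of bounded operators. -/
def universalUnitary (g : G) :
    lp (fun ρ : UnitaryRep G => (ρ.space →L[ℂ] ρ.space)) ∞ :=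
  ⟨fun ρ => (ρ.toHom g : ρ.space →L[ℂ] ρ.space), memℓp_infty ⟨1, by
    rintro _ ⟨ρ, rfl⟩
    have h := CStarRing.norm_coe_unitary_mul (ρ.toHom g) (1 : ρ.space →L[ℂ] ρ.space)
    rw [mul_one] at h
    exact h.le.trans ContinuousLinearMap.norm_id_le⟩⟩

variable (G) in
/-- The C*-algebra generated by the universal representation. -/
def fullSubalgebra :
    NonUnitalStarSubalgebra ℂ (lp (fun ρ : UnitaryRep G => (ρ.space →L[ℂ] ρ.space)) ∞) :=
  (NonUnitalStarAlgebra.adjoin ℂ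
    (Set.range (universalUnitary (G := G)))).topologicalClosure

variable (G) in
/-- The full group C*-algebra `C*(G)`: the completion of the group algebra in the norm
`‖x‖ = sup ‖ρ(x)‖` over all unitary representations `ρ`, realized as the closure of the image of
the group algebra under the universal representation. -/
def FullGroupCStar : Type (u + 1) := fullSubalgebra G

instance : NonUnitalCStarAlgebra (FullGroupCStar G) :=
  NonUnitalStarSubalgebra.nonUnitalCStarAlgebra (fullSubalgebra G)
    (h_closed := NonUnitalStarSubalgebra.isClosed_topologicalClosure _)

end GroupCStar

end CStarExt

end

open CStarExt

/-! Both notions of invertibility say that an extension lifts after a direct summand is added. Take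
a C*-algebra L that maps to Q(B) and receives M(B), and call an extension liftable if it factors
through L. If L consists of pairs of a path in Q(B) and a multiplier lifting its end point, the
liftable extensions are those strongly homotopic to a split one (`pathLifting_lifts_iff`). If L
consists of bounded continuous families in M(B) with constant image in Q(B), modulo families
vanishing at infinity, they are the asymptotically split ones (`asympLifting_lifts_iff`).

The argument needs one property of L, the field `lift_unitary` of `LiftingAlgebra`. If a unitary w
of Q(B) commutes with the images of countably many elements of L, then w ⊕ w* lifts to a unitary
commuting with the doubled elements, possibly after an endomorphism θ of L over Q(B). In both cases
the lift is a rotation joining w ⊕ w* to 1. For paths the angle is the time, and θ delays the given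
paths until the rotation is over. For asymptotic families, sine and cosine become s and √(1 - s²),
where s is an asymptotically central approximate unit in B; countability is what makes such an s
available, and θ is the identity.

Let K be ℤ or a finite group, and φ an extension of the algebra of K × G. Its restriction to G
becomes a liftable Φ after adding some ψ, and the unitaries φ(k) ⊕ 1 commute with Φ. These data are
dilated to a liftable extension of the algebra of K × G. For K = ℤ one lifts u ⊕ u*, u being the
unitary of the generator (`dilates_int`). For K finite one uses the regular representation, which
lifts because it consists of multipliers (`dilates_finite`). Commuting data on K and G integrate to
the algebra of K × G because K has Følner sets (`IsProductModel.exists_hom`); this is where C*_r and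
C* are treated alike. So φ is a direct summand of a liftable extension, hence invertible
(`LiftingAlgebra.invertible_of_summand`). The finite group is adjoined first, then one copy of ℤ at
a time. -/

noncomputable section

namespace CStarExt

/-! ### Quotients of C*-algebras by closed ideals -/

section Quotient

variable {M : Type*} [CStarAlgebra M]

/-- A closed self-adjoint two-sided ideal with approximate units. -/
structure IsCStarIdeal (J : Ideal M) : Prop where
  closed : IsClosed (J : Set M)
  star_mem : ∀ {x : M}, x ∈ J → star x ∈ J
  exists_approx : ∀ j ∈ J, ∀ ε > 0, ∃ e ∈ J, ‖1 - e‖ ≤ 1 ∧ ‖j * (1 - e)‖ ≤ ε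

/-- Replacing `x` by `x * (1 - e)` with `e ∈ J` does not change its class. If `y` is a nearly
norm-minimal representative of the class of `star x * x`, then `y - star x * x ∈ J` is nearly
annihilated by `1 - e`, and `‖1 - e‖ ≤ 1` does the rest. -/
theorem IsCStarIdeal.norm_mul_self_le {J : Ideal M} (hJ : IsCStarIdeal J) (x : M) :
    ‖(Submodule.Quotient.mk x : M ⧸ J)‖ * ‖(Submodule.Quotient.mk x : M ⧸ J)‖
      ≤ ‖(Submodule.Quotient.mk (star x * x) : M ⧸ J)‖ := by
  refine le_of_forall_pos_le_add fun ε hε => ?_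
  obtain ⟨y, hy, hlt⟩ := Submodule.Quotient.norm_mk_lt
    (Submodule.Quotient.mk (star x * x) : M ⧸ J) (half_pos hε)
  have hj : y - star x * x ∈ J := (Submodule.Quotient.eq J).1 hy
  obtain ⟨e, heJ, he1, he2⟩ := hJ.exists_approx _ hj _ (half_pos hε)
  have h1 : (Submodule.Quotient.mk x : M ⧸ J) = Submodule.Quotient.mk (x * (1 - e)) := by
    rw [Submodule.Quotient.eq]
    have : x - x * (1 - e) = x * e := by noncomm_ring
    rw [this]
    exact J.mul_mem_left x heJ
  have h2 : ‖(Submodule.Quotient.mk x : M ⧸ J)‖ ≤ ‖x * (1 - e)‖ := by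
    rw [h1]; exact Submodule.Quotient.norm_mk_le _ _
  calc _ ≤ ‖x * (1 - e)‖ * ‖x * (1 - e)‖ := by gcongr
    _ = ‖star (x * (1 - e)) * (x * (1 - e))‖ := (CStarRing.norm_star_mul_self).symm
    _ = ‖star (1 - e) * y * (1 - e) - star (1 - e) * ((y - star x * x) * (1 - e))‖ := by
        rw [star_mul]; congr 1; noncomm_ring
    _ ≤ ‖star (1 - e) * y * (1 - e)‖ + ‖star (1 - e) * ((y - star x * x) * (1 - e))‖ :=
        norm_sub_le _ _
    _ ≤ ‖y‖ + ε / 2 := by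
        have hs : ‖star (1 - e)‖ ≤ 1 := by rwa [norm_star]
        refine add_le_add ?_ ?_
        · calc _ ≤ ‖star (1 - e)‖ * ‖y‖ * ‖1 - e‖ := norm_mul₃_le
            _ ≤ 1 * ‖y‖ * 1 := by gcongr
            _ = ‖y‖ := by ring
        · calc _ ≤ ‖star (1 - e)‖ * ‖(y - star x * x) * (1 - e)‖ := norm_mul_le _ _
            _ ≤ 1 * (ε / 2) := by gcongr
            _ = ε / 2 := one_mul _
    _ ≤ ‖(Submodule.Quotient.mk (star x * x) : M ⧸ J)‖ + ε := by linarith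

theorem quotient_norm_mul_le (J : Ideal M) [J.IsTwoSided] (x y : M ⧸ J) :
    ‖x * y‖ ≤ ‖x‖ * ‖y‖ := by
  refine le_of_forall_pos_le_add fun ε hε => ?_
  obtain ⟨δ, hδ, hlt⟩ : ∃ δ > 0, (‖x‖ + δ) * (‖y‖ + δ) < ‖x‖ * ‖y‖ + ε := by
    have hc : Filter.Tendsto (fun δ : ℝ => (‖x‖ + δ) * (‖y‖ + δ)) (nhdsWithin 0 (Set.Ioi 0))
        (nhds (‖x‖ * ‖y‖)) := by
      have : Continuous fun δ : ℝ => (‖x‖ + δ) * (‖y‖ + δ) := by fun_prop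
      simpa using (this.tendsto 0).mono_left nhdsWithin_le_nhds
    have h1 := hc.eventually (gt_mem_nhds (lt_add_of_pos_right _ hε))
    obtain ⟨δ, h, h'⟩ := (h1.and self_mem_nhdsWithin).exists
    exact ⟨δ, h', h⟩
  obtain ⟨a, rfl, ha⟩ := Submodule.Quotient.norm_mk_lt x hδ
  obtain ⟨b, rfl, hb⟩ := Submodule.Quotient.norm_mk_lt y hδ
  exact (Submodule.Quotient.norm_mk_le J (a * b)).trans ((norm_mul_le a b).trans
    ((mul_le_mul ha.le hb.le (norm_nonneg _) ((norm_nonneg _).trans ha.le)).trans hlt.le))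

/-- The quotient of a C*-algebra by an ideal. -/
def CStarQuotient (J : Ideal M) [J.IsTwoSided] (_hJ : IsCStarIdeal J) : Type _ := M ⧸ J

variable {J : Ideal M} [J.IsTwoSided] {hJ : IsCStarIdeal J}

instance : Ring (CStarQuotient J hJ) := inferInstanceAs (Ring (M ⧸ J))

instance : Algebra ℂ (CStarQuotient J hJ) := inferInstanceAs (Algebra ℂ (M ⧸ J))

instance : NormedRing (CStarQuotient J hJ) :=
  letI I : NormedAddCommGroup (M ⧸ J) :=
    Submodule.Quotient.normedAddCommGroup (hS := hJ.closed) J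
  { (inferInstance : Ring (CStarQuotient J hJ)) with
    toNorm := I.toNorm
    toMetricSpace := I.toMetricSpace
    dist_eq := I.dist_eq
    norm_mul_le := quotient_norm_mul_le J }

instance : Star (CStarQuotient J hJ) where
  star := Quotient.map' star (by
    intro a b hab
    rw [Submodule.quotientRel_def] at hab ⊢
    rw [← star_sub]
    exact hJ.star_mem hab)

variable (hJ) in
/-- The quotient map, as a ring homomorphism. -/
def IsCStarIdeal.mkRingHom : M →+* CStarQuotient J hJ := Ideal.Quotient.mk J

theorem IsCStarIdeal.mkRingHom_surjective : Function.Surjective hJ.mkRingHom :=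
  Ideal.Quotient.mk_surjective

theorem star_mkRingHom (m : M) : star (hJ.mkRingHom m) = hJ.mkRingHom (star m) := rfl

instance : StarRing (CStarQuotient J hJ) where
  star_involutive x := by
    obtain ⟨m, rfl⟩ := hJ.mkRingHom_surjective x
    simp only [star_mkRingHom, star_star]
  star_mul x y := by
    obtain ⟨m, rfl⟩ := hJ.mkRingHom_surjective x
    obtain ⟨n, rfl⟩ := hJ.mkRingHom_surjective y
    simp only [← map_mul, star_mkRingHom, star_mul]
  star_add x y := by
    obtain ⟨m, rfl⟩ := hJ.mkRingHom_surjective x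
    obtain ⟨n, rfl⟩ := hJ.mkRingHom_surjective y
    simp only [← map_add, star_mkRingHom, star_add]

variable (hJ) in
/-- The quotient map. -/
def IsCStarIdeal.quot : M →⋆ₐ[ℂ] CStarQuotient J hJ where
  __ := hJ.mkRingHom
  commutes' _ := rfl
  map_star' _ := rfl

theorem IsCStarIdeal.quot_surjective : Function.Surjective hJ.quot :=
  Ideal.Quotient.mk_surjective

theorem IsCStarIdeal.quot_eq_mk {x y : M} : hJ.quot x = hJ.quot y ↔ x - y ∈ J :=
  Ideal.Quotient.eq

instance : CompleteSpace (CStarQuotient J hJ) :=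
  inferInstanceAs (CompleteSpace (M ⧸ J))

instance : CStarRing (CStarQuotient J hJ) where
  norm_mul_self_le x := by
    obtain ⟨m, rfl⟩ := hJ.quot_surjective x
    exact hJ.norm_mul_self_le m

instance : StarModule ℂ (CStarQuotient J hJ) where
  star_smul c x := by
    obtain ⟨m, rfl⟩ := hJ.quot_surjective x
    rw [← map_smul, ← map_star, star_smul, map_smul, map_star]

instance : NormedAlgebra ℂ (CStarQuotient J hJ) where
  norm_smul_le c x := by
    let I : NormedAddCommGroup (M ⧸ J) :=
      Submodule.Quotient.normedAddCommGroup (hS := hJ.closed) J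
    exact norm_smul_le c (show M ⧸ J from x)

instance : CStarAlgebra (CStarQuotient J hJ) where

/-- Homomorphisms vanishing on the ideal factor through the quotient. -/
def IsCStarIdeal.lift {D : Type*} [CStarAlgebra D] (hJ : IsCStarIdeal J) (f : M →⋆ₐ[ℂ] D)
    (hf : ∀ x ∈ J, f x = 0) : CStarQuotient J hJ →⋆ₐ[ℂ] D where
  __ := (Ideal.Quotient.liftₐ J f.toAlgHom hf : M ⧸ J →ₐ[ℂ] D)
  map_star' x := by
    obtain ⟨m, rfl⟩ := hJ.quot_surjective x
    exact map_star f m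

end Quotient

/-! ### Q(B) as a C*-algebra -/

section CoronaCStar

variable (B : Type w) [NonUnitalCStarAlgebra B]

/-- The canonical embedding of `B` in `M(B)`. -/
abbrev toMult : B →⋆ₙₐ[ℂ] Multiplier B := DoubleCentralizer.coeHom (𝕜 := ℂ) (A := B)

theorem toMult_injective : Function.Injective (toMult B) := by
  rw [injective_iff_map_eq_zero]
  intro b hb
  have h : (toMult B b).fst (star b) = 0 := by
    rw [hb]
    rfl
  exact (CStarRing.mul_star_self_eq_zero_iff b).mp h

theorem norm_toMult (b : B) : ‖toMult B b‖ = ‖b‖ :=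
  NonUnitalStarAlgHom.norm_map _ (toMult_injective B) b

theorem isCStarIdeal_coronaIdeal : IsCStarIdeal (coronaIdeal B) where
  closed := isClosed_coronaIdeal B
  star_mem := star_mem_coronaIdeal
  exists_approx := by
    rintro _ ⟨b, rfl⟩ ε hε
    let _ := CStarAlgebra.spectralOrder B
    let _ := CStarAlgebra.spectralOrderedRing B
    let _ := CStarAlgebra.spectralOrder (Multiplier B)
    let _ := CStarAlgebra.spectralOrderedRing (Multiplier B)
    have hl := CStarAlgebra.increasingApproximateUnit B
    have h1 := (Metric.tendsto_nhds.1 (hl.tendsto_mul_left b)) ε hε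
    obtain ⟨e, h0, hn, h⟩ :=
      (hl.eventually_nonneg.and (hl.eventually_norm.and h1)).exists
    refine ⟨toMult B e, ⟨e, rfl⟩, ?_, ?_⟩
    · have h0' : 0 ≤ toMult B e := map_nonneg (toMult B) h0
      have hle : toMult B e ≤ 1 := by
        rw [← CStarAlgebra.norm_le_one_iff_of_nonneg _ h0', norm_toMult]; exact hn
      rw [CStarAlgebra.norm_le_one_iff_of_nonneg _ (sub_nonneg.2 hle)]
      exact sub_le_self _ h0'
    · change ‖toMult B b * (1 - toMult B e)‖ ≤ ε
      rw [mul_sub, mul_one, ← map_mul, ← map_sub, norm_toMult, ← dist_eq_norm, dist_comm]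
      exact h.le

instance : CompleteSpace (Corona B) :=
  inferInstanceAs (CompleteSpace (Multiplier B ⧸ coronaIdeal B))

instance : CStarRing (Corona B) where
  norm_mul_self_le x := by
    obtain ⟨m, rfl⟩ := coronaMkRingHom_surjective B x
    exact (isCStarIdeal_coronaIdeal B).norm_mul_self_le m

theorem coronaMk_surjective : Function.Surjective (coronaMk B) :=
  Ideal.Quotient.mk_surjective

theorem coronaMk_eq_zero {x : Multiplier B} : coronaMk B x = 0 ↔ ∃ b, toMult B b = x :=
  Ideal.Quotient.eq_zero_iff_mem (I := coronaIdeal B)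

instance : StarModule ℂ (Corona B) where
  star_smul c x := by
    obtain ⟨m, rfl⟩ := coronaMk_surjective B x
    rw [← map_smul, ← map_star, star_smul, map_smul, map_star]

instance : NormedAlgebra ℂ (Corona B) where
  norm_smul_le c x := by
    let I : NormedAddCommGroup (Multiplier B ⧸ coronaIdeal B) :=
      Submodule.Quotient.normedAddCommGroup (hS := isClosed_coronaIdeal B) (coronaIdeal B)
    exact norm_smul_le c (show Multiplier B ⧸ coronaIdeal B from x)

instance : CStarAlgebra (Corona B) where

end CoronaCStar

theorem continuous_starHom {A D : Type*} [NonUnitalCStarAlgebra A] [NonUnitalCStarAlgebra D]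
    (Θ : A →⋆ₙₐ[ℂ] D) : Continuous Θ :=
  (NonUnitalStarAlgHom.instContinuousLinearMapClassComplex.map_continuous Θ)

/-! ### C*-algebras generated by a group -/

section GroupModel

/-- A C*-algebra generated by a representation of a group by partial unitaries. -/
structure GroupModel (G : Type*) [Group G] (A : Type*) [NonUnitalCStarAlgebra A] where
  ι : G → A
  map_mul : ∀ g h, ι (g * h) = ι g * ι h
  map_star : ∀ g, star (ι g) = ι g⁻¹
  dense : DenseRange (Finsupp.linearCombination ℂ ι)

namespace GroupModel

variable {G : Type*} [Group G] {A : Type*} [NonUnitalCStarAlgebra A] (m : GroupModel G A)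

/-- The image of a formal linear combination of group elements. -/
def eval : (G →₀ ℂ) →ₗ[ℂ] A := Finsupp.linearCombination ℂ m.ι

theorem eval_single (g : G) (c : ℂ) : m.eval (Finsupp.single g c) = c • m.ι g := by
  simp [eval]

theorem induction {p : A → Prop} (hc : IsClosed {a | p a}) (hι : ∀ g, p (m.ι g)) (h0 : p 0)
    (hadd : ∀ a b, p a → p b → p (a + b)) (hsmul : ∀ (c : ℂ) a, p a → p (c • a)) (a : A) :
    p a := by
  refine m.dense.induction_on (p := p) a hc fun f => ?_
  induction f using Finsupp.induction_linear with
  | zero => simpa using h0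
  | add f g hf hg => rw [map_add]; exact hadd _ _ hf hg
  | single g c => simpa using hsmul c _ (hι g)

theorem commute_of_forall {D : Type*} [NonUnitalCStarAlgebra D] (Θ : A →⋆ₙₐ[ℂ] D) (d : D)
    (h : ∀ g, Commute d (Θ (m.ι g))) (a : A) : Commute d (Θ a) := by
  refine m.induction (p := fun a => Commute d (Θ a)) ?_ h (by simp) ?_ ?_ a
  · have := continuous_starHom Θ
    exact isClosed_eq (by fun_prop) (by fun_prop)
  · intro a b ha hb; rw [map_add]; exact ha.add_right hb
  · intro c a ha; rw [map_smul]; exact ha.smul_right c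

/-- The norm bound makes `β` well defined and contractive on the dense span of the group elements,
so it extends by continuity. Multiplicativity passes from group elements to the closure in one
variable at a time. -/
theorem exists_hom {D : Type*} [NonUnitalCStarAlgebra D] (β : G → D)
    (hmul : ∀ g h, β (g * h) = β g * β h) (hstar : ∀ g, star (β g) = β g⁻¹)
    (hle : ∀ f, ‖Finsupp.linearCombination ℂ β f‖ ≤ ‖m.eval f‖) :
    ∃ Θ : A →⋆ₙₐ[ℂ] D, ∀ g, Θ (m.ι g) = β g := by
  let L : A →L[ℂ] D := (Finsupp.linearCombination ℂ β).extendOfNorm m.eval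
  have hL : ∀ f, L (m.eval f) = Finsupp.linearCombination ℂ β f :=
    LinearMap.extendOfNorm_eq m.dense ⟨1, fun f => by simpa using hle f⟩
  have hι : ∀ g, L (m.ι g) = β g := by
    intro g
    have := hL (Finsupp.single g 1)
    simpa [eval_single] using this
  have hm : ∀ a b, L (a * b) = L a * L b := by
    intro a b
    refine m.induction (p := fun a => L (a * b) = L a * L b) ?_ ?_ (by simp) ?_ ?_ a
    · exact isClosed_eq (by fun_prop) (by fun_prop)
    · intro g
      refine m.induction (p := fun b => L (m.ι g * b) = L (m.ι g) * L b) ?_ ?_ (by simp) ?_ ?_ b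
      · exact isClosed_eq (by fun_prop) (by fun_prop)
      · intro h
        rw [← m.map_mul, hι, hι, hι, hmul]
      · intro a b ha hb; simp [mul_add, ha, hb]
      · intro c a ha; rw [mul_smul_comm, map_smul, map_smul, mul_smul_comm, ha]
    · intro a b ha hb; simp [add_mul, ha, hb]
    · intro c a ha; rw [smul_mul_assoc, map_smul, map_smul, smul_mul_assoc, ha]
  have hs : ∀ a, L (star a) = star (L a) := by
    intro a
    refine m.induction (p := fun a => L (star a) = star (L a)) ?_ ?_ (by simp) ?_ ?_ a
    · exact isClosed_eq (by fun_prop) (by fun_prop)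
    · intro g; rw [m.map_star, hι, hι, hstar]
    · intro a b ha hb; simp [ha, hb]
    · intro c a ha; simp [ha]
  exact ⟨{ toFun := L, map_smul' := by simp, map_zero' := by simp, map_add' := by simp,
           map_mul' := hm, map_star' := hs }, hι⟩

/-- Transport of a model along an isomorphism of groups. -/
def comp {G' : Type*} [Group G'] (e : G' ≃* G) : GroupModel G' A where
  ι g := m.ι (e g)
  map_mul g h := by rw [_root_.map_mul, m.map_mul]
  map_star g := by rw [m.map_star, map_inv]
  dense := by
    have h : (Finsupp.linearCombination ℂ fun g => m.ι (e g))
        = (Finsupp.linearCombination ℂ m.ι).comp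
          (Finsupp.domLCongr e.toEquiv : (G' →₀ ℂ) ≃ₗ[ℂ] (G →₀ ℂ)).toLinearMap := by
      ext; simp
    rw [h, LinearMap.coe_comp]
    change Dense (Set.range _)
    rw [Set.range_comp, LinearEquiv.coe_coe, (LinearEquiv.surjective _).range_eq, Set.image_univ]
    exact m.dense

end GroupModel

end GroupModel

/-! ### Følner sets -/

section Folner

/-- Groups with approximately invariant finite subsets. -/
class IsFolner (K : Type*) [Group K] : Prop where
  exists_finset : ∀ [DecidableEq K] (S : Finset K) (ε : ℝ), 0 < ε → ∃ F : Finset K, F.Nonempty ∧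
    ∀ s ∈ S, |((F.filter fun l => s * l ∈ F).card : ℝ) / F.card - 1| ≤ ε

instance (K : Type*) [Group K] [Finite K] : IsFolner K where
  exists_finset S ε hε := by
    have := Fintype.ofFinite K
    refine ⟨Finset.univ, Finset.univ_nonempty, fun s _ => ?_⟩
    have : (Fintype.card K : ℝ) ≠ 0 := by exact_mod_cast Fintype.card_ne_zero
    simp [this, hε.le]

/-- Translating the interval [0, N) by `s` loses at most |s| of its points. The lift puts ℤ in the
universe of `G`, so that ℓ²(K, H) is again the space of a `UnitaryRep` in that universe. -/
instance : IsFolner (ULift.{u} (Multiplicative ℤ)) where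
  exists_finset S ε hε := by
    obtain ⟨C, hC⟩ : ∃ C : ℕ, ∀ s ∈ S, (s.down.toAdd).natAbs ≤ C :=
      ⟨S.sup fun s => (s.down.toAdd).natAbs, fun s hs =>
        Finset.le_sup (f := fun s => (s.down.toAdd).natAbs) hs⟩
    -- At most `C` of the `N` points are lost, a proportion below `ε`.
    obtain ⟨N, hN⟩ := exists_nat_gt ((C : ℝ) / ε)
    have hN0 : (0 : ℝ) < N := lt_of_le_of_lt (by positivity) hN
    let j : ℤ ↪ ULift.{u} (Multiplicative ℤ) :=
      ⟨fun x => ULift.up (Multiplicative.ofAdd x), fun x y h => by simpa using h⟩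
    have hcard : ((Finset.Ico (0 : ℤ) N).map j).card = N := by simp
    refine ⟨(Finset.Ico (0 : ℤ) N).map j, ?_, fun s hs => ?_⟩
    · rw [← Finset.card_pos, hcard]; exact_mod_cast hN0
    · set F := (Finset.Ico (0 : ℤ) N).map j with hF
      have hup : (F.filter fun l => s * l ∈ F).card ≤ N :=
        (Finset.card_filter_le _ _).trans hcard.le
      have hlow : N ≤ (F.filter fun l => s * l ∈ F).card + C := by
        have hsub : (Finset.Ico (max 0 (-s.down.toAdd)) (min N (N - s.down.toAdd))).map j
            ⊆ F.filter fun l => s * l ∈ F := by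
          intro l hl
          simp only [Finset.mem_map, Finset.mem_Ico] at hl
          obtain ⟨x, hx, rfl⟩ := hl
          simp only [hF, Finset.mem_filter, Finset.mem_map, Finset.mem_Ico]
          refine ⟨⟨x, by omega, rfl⟩, s.down.toAdd + x, by omega, ?_⟩
          rfl
        have h1 := Finset.card_le_card hsub
        rw [Finset.card_map, Int.card_Ico] at h1
        have h2 := hC s hs
        omega
      have hup' : ((F.filter fun l => s * l ∈ F).card : ℝ) ≤ N := by exact_mod_cast hup
      have hlow' : (N : ℝ) ≤ (F.filter fun l => s * l ∈ F).card + C := by exact_mod_cast hlow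
      rw [div_lt_iff₀ hε] at hN
      rw [hcard, abs_le]
      constructor
      · rw [neg_le_sub_iff_le_add, ← sub_le_iff_le_add, le_div_iff₀ hN0]
        nlinarith
      · have : ((F.filter fun l => s * l ∈ F).card : ℝ) / N ≤ 1 := by
          rw [div_le_one hN0]; exact hup'
        linarith

end Folner

attribute [local instance] CStarAlgebra.spectralOrder CStarAlgebra.spectralOrderedRing

/-! ### Matrices over a C*-algebra -/

section Matrix

open CStarModule
open scoped CStarAlgebra

/-- This is Cauchy–Schwarz in the Hilbert module of rows over `D`: the sum is the inner product of
the row `b` with the row `a` multiplied by `X`. -/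
theorem norm_sum_mul_mul_star_le {D : Type*} [NonUnitalCStarAlgebra D] {n : Type*} [Fintype n]
    (X : CStarMatrix n n D) (a b : n → D) :
    ‖∑ i, ∑ j, a i * X i j * star (b j)‖
      ≤ ‖X‖ * √‖∑ i, a i * star (a i)‖ * √‖∑ i, b i * star (b i)‖ := by
  let a' : WithCStarModule D (n → D) := (WithCStarModule.equiv D (n → D)).symm a
  let b' : WithCStarModule D (n → D) := (WithCStarModule.equiv D (n → D)).symm b
  have h : ∑ i, ∑ j, a i * X i j * star (b j) = inner D b' (CStarMatrix.toCLM X a') := by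
    rw [WithCStarModule.pi_inner, CStarMatrix.toCLM_apply_eq_sum, Finset.sum_comm]
    refine Finset.sum_congr rfl fun j _ => ?_
    change _ = (∑ i, a i * X i j) * star (b j)
    rw [Finset.sum_mul]
  rw [h]
  have ha : ‖a'‖ = √‖∑ i, a i * star (a i)‖ := WithCStarModule.pi_norm _
  have hb : ‖b'‖ = √‖∑ i, b i * star (b i)‖ := WithCStarModule.pi_norm _
  rw [← ha, ← hb]
  calc _ ≤ ‖b'‖ * ‖CStarMatrix.toCLM X a'‖ := norm_inner_le (A := D) (WithCStarModule D (n → D))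
    _ ≤ ‖b'‖ * (‖X‖ * ‖a'‖) := by
        gcongr
        exact (CStarMatrix.toCLM X).le_opNorm a'
    _ = _ := by ring

end Matrix

/-! ### Integrating commuting representations of K and G -/

section UniversalProperty

variable {K G A E : Type*} [Group K] [Group G] [NonUnitalCStarAlgebra A] [NonUnitalCStarAlgebra E]

open scoped Classical in
/-- The `k`-th Fourier coefficient of a formal linear combination of elements of `K × G`. -/
def GroupModel.slice (m : GroupModel G A) (k : K) : (K × G →₀ ℂ) →ₗ[ℂ] A :=
  Finsupp.linearCombination ℂ fun p : K × G => if p.1 = k then m.ι p.2 else 0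

/-- Compatibility of a model for `K × G` with a model for `G`. -/
structure IsProductModel (m : GroupModel G A) (n : GroupModel (K × G) E) : Prop where
  compress : ∀ (F : Finset K) (f : K × G →₀ ℂ),
    ‖(CStarMatrix.ofMatrix fun k l : F => m.slice (k.1 * l.1⁻¹) f : CStarMatrix F F A)‖
      ≤ ‖n.eval f‖
  restrict : ∃ j : A →⋆ₙₐ[ℂ] E, ∀ g, j (m.ι g) = n.ι (1, g)

variable {m : GroupModel G A} {n : GroupModel (K × G) E}

/-- Since `U` commutes with `Φ`, the sum is ∑ U(k) Φ(X k l) U(l)*, where X is the matrix of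
`IsProductModel.compress`, of norm at most `‖n.eval f‖`. The row of unitaries over `F` has norm at
most the square root of `F.card`, and it occurs twice. -/
theorem norm_unitary_mul_sum_le {D : Type*} [CStarAlgebra D] (hmn : IsProductModel m n)
    (Φ : A →⋆ₙₐ[ℂ] D) (U : K →* unitary D) (hU : ∀ k a, Commute (U k : D) (Φ a))
    (F : Finset K) (f : K × G →₀ ℂ) :
    ‖∑ k ∈ F, ∑ l ∈ F, (U (k * l⁻¹) : D) * Φ (m.slice (k * l⁻¹) f)‖ ≤ F.card * ‖n.eval f‖ := by
  set X : CStarMatrix F F A := CStarMatrix.ofMatrix fun k l : F => m.slice (k.1 * l.1⁻¹) f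
  have hX : ‖CStarMatrix.mapₙₐ Φ X‖ ≤ ‖n.eval f‖ :=
    (NonUnitalStarAlgHom.norm_apply_le (CStarMatrix.mapₙₐ (n := F) Φ) X).trans (hmn.compress F f)
  have h := norm_sum_mul_mul_star_le (CStarMatrix.mapₙₐ Φ X) (fun k : F => (U k : D))
    (fun k : F => (U k : D))
  have hone : ‖∑ k : F, (U k : D) * star (U k : D)‖ ≤ F.card := by
    refine (norm_sum_le _ _).trans ?_
    have : ∀ k ∈ (Finset.univ : Finset F), ‖(U k : D) * star (U k : D)‖ ≤ 1 := fun k _ => by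
      rw [Unitary.mul_star_self_of_mem (U k).2]
      nontriviality D
      exact CStarRing.norm_one.le
    simpa using Finset.sum_le_card_nsmul _ _ _ this
  have hsum : ∑ k ∈ F, ∑ l ∈ F, (U (k * l⁻¹) : D) * Φ (m.slice (k * l⁻¹) f)
      = ∑ k : F, ∑ l : F, (U k : D) * CStarMatrix.mapₙₐ Φ X k l * star (U l : D) := by
    rw [← Finset.sum_coe_sort F]
    refine Finset.sum_congr rfl fun k _ => ?_
    rw [← Finset.sum_coe_sort F]
    refine Finset.sum_congr rfl fun l _ => ?_
    change _ = (U k : D) * Φ (m.slice (k.1 * l.1⁻¹) f) * star (U l : D)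
    have : star (U l : D) = (U (l.1⁻¹) : D) := by rw [map_inv]; rfl
    rw [this, mul_assoc, ← (hU _ _).eq, ← mul_assoc, map_mul]
    rfl
  rw [hsum]
  refine h.trans ?_
  rw [mul_assoc, Real.mul_self_sqrt (norm_nonneg _), mul_comm]
  gcongr

theorem linearCombination_eq_sum_slice {K : Type*} {D : Type*} [CStarAlgebra D] (Φ : A →⋆ₙₐ[ℂ] D) (U : K → D)
    (f : K × G →₀ ℂ) (S : Finset K) (hS : ∀ p ∈ f.support, p.1 ∈ S) :
    Finsupp.linearCombination ℂ (fun p : K × G => U p.1 * Φ (m.ι p.2)) f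
      = ∑ s ∈ S, U s * Φ (m.slice s f) := by
  simp only [GroupModel.slice, Finsupp.linearCombination_apply, Finsupp.sum, map_sum,
    Finset.mul_sum]
  rw [Finset.sum_comm]
  refine Finset.sum_congr rfl fun p hp => ?_
  rw [Finset.sum_eq_single p.1]
  · simp
  · intro s _ hs
    rw [if_neg (Ne.symm hs)]; simp
  · intro h; exact absurd (hS p hp) h

/-- Amenability enters here. In the double sum of `norm_unitary_mul_sum_le` the Fourier term of `s`
occurs once for each `l ∈ F` with `s * l ∈ F`. For a Følner set this is nearly `F.card` times, so
division by `F.card` recovers the whole sum up to a small error. -/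
theorem IsProductModel.norm_linearCombination_le [IsFolner K] {D : Type*} [CStarAlgebra D]
    (hmn : IsProductModel m n) (Φ : A →⋆ₙₐ[ℂ] D) (U : K →* unitary D)
    (hU : ∀ k a, Commute (U k : D) (Φ a)) (f : K × G →₀ ℂ) :
    ‖Finsupp.linearCombination ℂ (fun p : K × G => (U p.1 : D) * Φ (m.ι p.2)) f‖
      ≤ ‖n.eval f‖ := by
  classical
  set S : Finset K := f.support.image Prod.fst
  set y : K → D := fun k => (U k : D) * Φ (m.slice k f) with hy
  have hS : ∀ p ∈ f.support, p.1 ∈ S := fun p hp => Finset.mem_image_of_mem _ hp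
  have hyS : ∀ k, k ∉ S → y k = 0 := by
    intro k hk
    have : m.slice k f = 0 := by
      simp only [GroupModel.slice, Finsupp.linearCombination_apply, Finsupp.sum]
      refine Finset.sum_eq_zero fun p hp => ?_
      rw [if_neg, smul_zero]
      rintro rfl
      exact hk (hS p hp)
    simp [hy, this]
  rw [linearCombination_eq_sum_slice Φ (fun k => (U k : D)) f S hS]
  refine le_of_forall_pos_le_add fun ε hε => ?_
  set C : ℝ := ∑ s ∈ S, ‖y s‖
  have hC : 0 ≤ C := Finset.sum_nonneg fun _ _ => norm_nonneg _
  -- The total error is at most this tolerance times `C`; the `+ 1` keeps the denominator positive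
  -- when `C = 0`.
  obtain ⟨F, hF, hFS⟩ := IsFolner.exists_finset S (ε / (C + 1)) (by positivity)
  have hF0 : (0 : ℝ) < F.card := by exact_mod_cast hF.card_pos
  -- For fixed `l`, substitute `s = k * l⁻¹`; then each `s` is counted over the admissible `l`.
  have h1 : ∑ k ∈ F, ∑ l ∈ F, y (k * l⁻¹)
      = ∑ s ∈ S, ((F.filter fun l => s * l ∈ F).card : ℝ) • y s := by
    rw [Finset.sum_comm]
    have : ∀ l ∈ F, ∑ k ∈ F, y (k * l⁻¹) = ∑ s ∈ S, if s * l ∈ F then y s else 0 := by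
      intro l _
      rw [← Finset.sum_filter]
      have e1 : ∑ k ∈ F, y (k * l⁻¹) = ∑ k ∈ F.filter (fun k => k * l⁻¹ ∈ S), y (k * l⁻¹) := by
        rw [Finset.sum_filter_of_ne]
        intro k _ hk
        by_contra h
        exact hk (hyS _ h)
      rw [e1]
      refine Finset.sum_nbij' (fun k => k * l⁻¹) (fun s => s * l) ?_ ?_ ?_ ?_ ?_ <;>
        simp +contextual
    rw [Finset.sum_congr rfl this, Finset.sum_comm]
    refine Finset.sum_congr rfl fun s _ => ?_
    rw [← Finset.sum_filter, Finset.sum_const, Nat.cast_smul_eq_nsmul]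
  have h2 := norm_unitary_mul_sum_le hmn Φ U hU F f
  change ‖∑ k ∈ F, ∑ l ∈ F, y (k * l⁻¹)‖ ≤ _ at h2
  rw [h1] at h2
  have h3 : ∑ s ∈ S, y s = (F.card : ℝ)⁻¹ •
      ∑ s ∈ S, ((F.filter fun l => s * l ∈ F).card : ℝ) • y s
      - ∑ s ∈ S, (((F.filter fun l => s * l ∈ F).card : ℝ) / F.card - 1) • y s := by
    rw [Finset.smul_sum, ← Finset.sum_sub_distrib]
    refine Finset.sum_congr rfl fun s _ => ?_
    rw [smul_smul, ← sub_smul]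
    rw [show (F.card : ℝ)⁻¹ * ((F.filter fun l => s * l ∈ F).card : ℝ)
      - (((F.filter fun l => s * l ∈ F).card : ℝ) / F.card - 1) = 1 by ring, one_smul]
  change ‖∑ s ∈ S, y s‖ ≤ _
  rw [h3]
  refine (norm_sub_le _ _).trans (add_le_add ?_ ?_)
  · rw [norm_smul, norm_inv, Real.norm_of_nonneg hF0.le, inv_mul_le_iff₀ hF0]
    exact h2
  · refine (norm_sum_le _ _).trans ?_
    calc _ ≤ ∑ s ∈ S, (ε / (C + 1)) * ‖y s‖ := by
          refine Finset.sum_le_sum fun s hs => ?_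
          rw [norm_smul, Real.norm_eq_abs]
          gcongr
          exact hFS s hs
      _ = ε * (C / (C + 1)) := by rw [← Finset.mul_sum]; ring
      _ ≤ ε * 1 := by
          gcongr
          rw [div_le_one (by positivity)]
          linarith
      _ = ε := mul_one _

/-- A homomorphism on the algebra of `G` and a commuting unitary representation of `K` combine to
a homomorphism on the algebra of `K × G`. -/
theorem IsProductModel.exists_hom [IsFolner K] {D : Type*} [CStarAlgebra D]
    (hmn : IsProductModel m n) (Φ : A →⋆ₙₐ[ℂ] D) (U : K →* unitary D)
    (hU : ∀ k a, Commute (U k : D) (Φ a)) :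
    ∃ Θ : E →⋆ₙₐ[ℂ] D, ∀ k g, Θ (n.ι (k, g)) = (U k : D) * Φ (m.ι g) := by
  have hmul : ∀ p q : K × G, (U (p * q).1 : D) * Φ (m.ι (p * q).2)
      = ((U p.1 : D) * Φ (m.ι p.2)) * ((U q.1 : D) * Φ (m.ι q.2)) := by
    rintro ⟨k, g⟩ ⟨l, h⟩
    simp only [Prod.mk_mul_mk, map_mul, m.map_mul, Submonoid.coe_mul]
    rw [mul_assoc, mul_assoc, ← mul_assoc _ (Φ (m.ι g)), (hU l _).eq]
    simp only [mul_assoc]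
  have hstar : ∀ p : K × G, star ((U p.1 : D) * Φ (m.ι p.2))
      = (U p⁻¹.1 : D) * Φ (m.ι p⁻¹.2) := by
    rintro ⟨k, g⟩
    have : star (U k : D) = (U k⁻¹ : D) := by rw [map_inv]; rfl
    simp only [star_mul, ← map_star, m.map_star, Prod.fst_inv, Prod.snd_inv]
    rw [this, (hU _ _).eq]
  obtain ⟨Θ, hΘ⟩ := n.exists_hom (fun p : K × G => (U p.1 : D) * Φ (m.ι p.2)) hmul hstar
    (hmn.norm_linearCombination_le Φ U hU)
  exact ⟨Θ, fun k g => hΘ (k, g)⟩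

end UniversalProperty

/-! ### Density of the group algebra -/

section GeneratedModel

variable {G : Type*} [Group G] {D : Type*} [NonUnitalCStarAlgebra D]

/-- The image of the group is closed under products and adjoints, so its linear span is already a
star subalgebra. -/
theorem adjoin_range_le_span (β : G → D) (hmul : ∀ g h, β (g * h) = β g * β h)
    (hstar : ∀ g, star (β g) = β g⁻¹) {x : D}
    (hx : x ∈ NonUnitalStarAlgebra.adjoin ℂ (Set.range β)) :
    x ∈ Submodule.span ℂ (Set.range β) := by
  have hm : ∀ a ∈ Submodule.span ℂ (Set.range β), ∀ b ∈ Submodule.span ℂ (Set.range β),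
      a * b ∈ Submodule.span ℂ (Set.range β) := by
    intro a ha b hb
    induction ha using Submodule.span_induction with
    | zero => simp
    | add x y _ _ hx hy => rw [add_mul]; exact add_mem hx hy
    | smul c x _ hx => rw [smul_mul_assoc]; exact Submodule.smul_mem _ c hx
    | mem x hx =>
      obtain ⟨g, rfl⟩ := hx
      induction hb using Submodule.span_induction with
      | zero => simp
      | add x y _ _ hx hy => rw [mul_add]; exact add_mem hx hy
      | smul c x _ hx => rw [mul_smul_comm]; exact Submodule.smul_mem _ c hx
      | mem x hx =>
        obtain ⟨h, rfl⟩ := hx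
        exact Submodule.subset_span ⟨g * h, hmul g h⟩
  have hs : ∀ a ∈ Submodule.span ℂ (Set.range β), star a ∈ Submodule.span ℂ (Set.range β) := by
    intro a ha
    induction ha using Submodule.span_induction with
    | zero => simp
    | add x y _ _ hx hy => rw [star_add]; exact add_mem hx hy
    | smul c x _ hx => rw [star_smul]; exact Submodule.smul_mem _ _ hx
    | mem x hx =>
      obtain ⟨g, rfl⟩ := hx
      exact Submodule.subset_span ⟨g⁻¹, (hstar g).symm⟩
  induction hx using NonUnitalStarAlgebra.adjoin_induction with
  | mem x hx => exact Submodule.subset_span hx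
  | add x y _ _ hx hy => exact add_mem hx hy
  | zero => exact zero_mem _
  | mul x y _ _ hx hy => exact hm x hx y hy
  | smul c x _ hx => exact Submodule.smul_mem _ c hx
  | star x _ hx => exact hs x hx

theorem denseRange_linearCombination_adjoin (β : G → D) (hmul : ∀ g h, β (g * h) = β g * β h)
    (hstar : ∀ g, star (β g) = β g⁻¹)
    (ι : G → (NonUnitalStarAlgebra.adjoin ℂ (Set.range β)).topologicalClosure)
    (hι : ∀ g, (ι g : D) = β g) : DenseRange (Finsupp.linearCombination ℂ ι) := by
  intro x
  rw [closure_subtype]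
  have h : Subtype.val '' Set.range (Finsupp.linearCombination ℂ ι)
      = (Submodule.span ℂ (Set.range β) : Set D) := by
    rw [← Finsupp.range_linearCombination, ← Set.range_comp]
    change Set.range _ = Set.range _
    congr 1
    ext f
    simp only [Function.comp_apply, Finsupp.linearCombination_apply, Finsupp.sum]
    rw [AddSubmonoidClass.coe_finsetSum]
    refine Finset.sum_congr rfl fun g _ => ?_
    rw [← hι]; rfl
  rw [h]
  exact closure_mono (fun y hy => adjoin_range_le_span β hmul hstar hy) x.2

end GeneratedModel

/-! ### The reduced and full group C*-algebras as models -/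

section Models

variable (G : Type u) [Group G]

theorem subset_topologicalClosure_adjoin {D : Type*} [NonUnitalCStarAlgebra D] {s : Set D} {x : D}
    (hx : x ∈ s) : x ∈ (NonUnitalStarAlgebra.adjoin ℂ s).topologicalClosure :=
  subset_closure (NonUnitalStarAlgebra.subset_adjoin ℂ s hx)

theorem coe_leftRegular_mul (g h : G) :
    (leftRegular G (g * h) : lp (fun _ : G => ℂ) 2 →L[ℂ] lp (fun _ : G => ℂ) 2)
      = leftRegular G g * leftRegular G h :=
  congrArg Subtype.val (map_mul (leftRegular G) g h)

theorem star_coe_leftRegular (g : G) :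
    star (leftRegular G g : lp (fun _ : G => ℂ) 2 →L[ℂ] lp (fun _ : G => ℂ) 2)
      = leftRegular G g⁻¹ :=
  congrArg Subtype.val (map_inv (leftRegular G) g).symm

/-- The canonical unitaries of the reduced group C*-algebra. -/
def reducedModel : GroupModel G (ReducedGroupCStar G) where
  ι g := ⟨leftRegular G g, subset_topologicalClosure_adjoin ⟨g, rfl⟩⟩
  map_mul g h := Subtype.ext (coe_leftRegular_mul G g h)
  map_star g := Subtype.ext (star_coe_leftRegular G g)
  dense := denseRange_linearCombination_adjoin
    (fun g => (leftRegular G g : lp (fun _ : G => ℂ) 2 →L[ℂ] lp (fun _ : G => ℂ) 2))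
    (coe_leftRegular_mul G) (star_coe_leftRegular G)
    (fun g => ⟨leftRegular G g, subset_topologicalClosure_adjoin ⟨g, rfl⟩⟩) fun _ => rfl

variable {G}

theorem universalUnitary_mul (g h : G) :
    universalUnitary (g * h) = universalUnitary g * universalUnitary h := by
  ext1; funext ρ
  exact congrArg Subtype.val (map_mul ρ.toHom g h)

theorem star_universalUnitary (g : G) :
    star (universalUnitary g) = universalUnitary g⁻¹ := by
  ext1; funext ρ
  exact congrArg Subtype.val (map_inv ρ.toHom g).symm

variable (G)

/-- The canonical unitaries of the full group C*-algebra. -/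
def fullModel : GroupModel G (FullGroupCStar G) where
  ι g := ⟨universalUnitary g, subset_topologicalClosure_adjoin ⟨g, rfl⟩⟩
  map_mul g h := Subtype.ext (universalUnitary_mul g h)
  map_star g := Subtype.ext (star_universalUnitary g)
  dense := denseRange_linearCombination_adjoin universalUnitary universalUnitary_mul
    star_universalUnitary
    (fun g => ⟨universalUnitary g, subset_topologicalClosure_adjoin ⟨g, rfl⟩⟩) fun _ => rfl

/-- The inclusion of `C*_r(G)` in the bounded operators on `ℓ²(G)`. -/
def reducedInclusion :
    ReducedGroupCStar G →⋆ₙₐ[ℂ] (lp (fun _ : G => ℂ) 2 →L[ℂ] lp (fun _ : G => ℂ) 2) :=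
  NonUnitalStarSubalgebraClass.subtype (reducedSubalgebra G)

variable {G} in
/-- The representation of `C*(G)` given by a unitary representation of `G`. -/
def fullProjection (ρ : UnitaryRep G) :
    FullGroupCStar G →⋆ₙₐ[ℂ] (ρ.space →L[ℂ] ρ.space) where
  toFun x := (x.1 : ∀ ρ : UnitaryRep G, ρ.space →L[ℂ] ρ.space) ρ
  map_smul' _ _ := rfl
  map_zero' := rfl
  map_add' _ _ := rfl
  map_mul' _ _ := rfl
  map_star' _ := rfl

end Models

/-! ### Compressions to orthogonal copies of a Hilbert space -/

section Compression

/-- A jointly faithful family of representations determines the norm. -/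
theorem norm_le_of_jointly_injective {C : Type*} [NonUnitalCStarAlgebra C] {R : Type*}
    {D : R → Type*} [∀ r, NonUnitalCStarAlgebra (D r)] (π : ∀ r, C →⋆ₙₐ[ℂ] D r)
    (hπ : ∀ x, (∀ r, π r x = 0) → x = 0) {x : C} {c : ℝ} (hc : 0 ≤ c)
    (h : ∀ r, ‖π r x‖ ≤ c) : ‖x‖ ≤ c := by
  let Ψ : C →⋆ₙₐ[ℂ] lp D ∞ :=
    { toFun x := ⟨fun r => π r x, memℓp_infty ⟨‖x‖, by
        rintro _ ⟨r, rfl⟩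
        exact NonUnitalStarAlgHom.norm_apply_le (π r) x⟩⟩
      map_smul' c x := by ext1; funext r; exact map_smul (π r) c x
      map_zero' := by ext1; funext r; exact map_zero (π r)
      map_add' x y := by ext1; funext r; exact map_add (π r) x y
      map_mul' x y := by ext1; funext r; exact map_mul (π r) x y
      map_star' x := by ext1; funext r; exact map_star (π r) x }
  have hΨ : Function.Injective Ψ := by
    rw [injective_iff_map_eq_zero]
    intro x hx
    exact hπ x fun r => congrFun (congrArg Subtype.val hx) r
  rw [← NonUnitalStarAlgHom.norm_map Ψ hΨ x]
  exact lp.norm_le_of_forall_le hc h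

attribute [local instance] CStarAlgebra.spectralOrder CStarAlgebra.spectralOrderedRing

variable {H L : Type*} [NormedAddCommGroup H] [InnerProductSpace ℂ H] [CompleteSpace H]
  [NormedAddCommGroup L] [InnerProductSpace ℂ L] [CompleteSpace L]

open ContinuousLinearMap in
-- The `J k` assemble to an isometry from the direct sum of copies of `H` into `L`, and the matrix
-- is the compression of `T` by it. In Hilbert module terms, a row `v` corresponds to the operator ∑
-- v k ∘ (J k)*, which has the same norm, and the pairing of rows through the matrix becomes a
-- product of operators through `T`.
theorem norm_compression_le {F : Type*} [Fintype F] [DecidableEq F] (J : F → H →L[ℂ] L)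
    (hJ : ∀ k l, adjoint (J k) ∘L J l = if k = l then 1 else 0) (T : L →L[ℂ] L) :
    ‖(CStarMatrix.ofMatrix fun k l : F => adjoint (J k) ∘L T ∘L J l :
      CStarMatrix F F (H →L[ℂ] H))‖ ≤ ‖T‖ := by
  have hnorm : ∀ v : WithCStarModule (H →L[ℂ] H) (F → H →L[ℂ] H),
      ‖∑ k, v k ∘L adjoint (J k)‖ = ‖v‖ := by
    intro v
    have h1 : (∑ k, v k ∘L adjoint (J k)) ∘L adjoint (∑ k, v k ∘L adjoint (J k))
        = ∑ k, v k * star (v k) := by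
      simp only [map_sum, adjoint_comp, adjoint_adjoint]
      ext x
      simp only [ContinuousLinearMap.comp_apply, _root_.sum_apply, map_sum]
      have : ∀ k l y, adjoint (J k) (J l y) = if k = l then y else 0 := by
        intro k l y
        have := congrArg (fun S => S y) (hJ k l)
        rw [ContinuousLinearMap.comp_apply] at this
        rw [this]; split_ifs <;> simp
      simp only [this]
      refine Finset.sum_congr rfl fun k _ => ?_
      rw [Finset.sum_eq_single k]
      · rw [if_pos rfl]; rfl
      · intro l _ hl
        rw [if_neg hl]
        exact ContinuousLinearMap.map_zero _
      · simp
    have h2 : ‖∑ k, v k ∘L adjoint (J k)‖ * ‖∑ k, v k ∘L adjoint (J k)‖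
        = ‖∑ k, v k * star (v k)‖ := by
      have := norm_adjoint_comp_self (adjoint (∑ k, v k ∘L adjoint (J k)))
      rw [adjoint_adjoint, h1, LinearIsometryEquiv.norm_map] at this
      exact this.symm
    have h3 : ‖v‖ ^ 2 = ‖∑ k, v k * star (v k)‖ := WithCStarModule.pi_norm_sq v
    rw [← h2, sq] at h3
    exact (mul_self_inj (norm_nonneg _) (norm_nonneg _)).1 h3.symm
  have key := CStarMatrix.norm_le_of_forall_inner_le
    (M := (CStarMatrix.ofMatrix fun k l : F => adjoint (J k) ∘L T ∘L J l :
      CStarMatrix F F (H →L[ℂ] H))) (C := ‖T‖₊) ?_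
  · exact key
  · intro v w
    have : inner (H →L[ℂ] H) w (CStarMatrix.toCLM
        (CStarMatrix.ofMatrix fun k l : F => adjoint (J k) ∘L T ∘L J l) v)
        = (∑ k, v k ∘L adjoint (J k)) ∘L T ∘L adjoint (∑ k, w k ∘L adjoint (J k)) := by
      rw [WithCStarModule.pi_inner, CStarMatrix.toCLM_apply_eq_sum]
      simp only [map_sum, adjoint_comp, adjoint_adjoint]
      change ∑ l, (∑ k, v k * (adjoint (J k) ∘L T ∘L J l)) * star (w l) = _
      ext x
      simp only [ContinuousLinearMap.comp_apply, _root_.sum_apply, map_sum,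
        mul_apply_eq_comp, star_eq_adjoint]
    rw [this]
    calc _ ≤ ‖∑ k, v k ∘L adjoint (J k)‖ * (‖T‖ * ‖adjoint (∑ k, w k ∘L adjoint (J k))‖) :=
          (opNorm_comp_le _ _).trans (by gcongr; exact opNorm_comp_le _ _)
      _ = ‖T‖ * ‖v‖ * ‖w‖ := by
          rw [LinearIsometryEquiv.norm_map, hnorm, hnorm]; ring
      _ = _ := rfl

open ContinuousLinearMap in
-- The element `(k, g)` carries the copy `J l` of `H` to the copy `J (k * l)`, acting by `g`. Hence
-- the `(k, l)` corner of the image of `f` sees only the Fourier coefficient at `k * l⁻¹`, and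
-- `norm_compression_le` applies in each representation of a faithful family.
theorem GroupModel.compress_of_family {K G A E : Type*} [Group K] [Group G]
    [NonUnitalCStarAlgebra A] [NonUnitalCStarAlgebra E] (m : GroupModel G A)
    (n : GroupModel (K × G) E) {R : Type*} {H L : R → Type*}
    [∀ r, NormedAddCommGroup (H r)] [∀ r, InnerProductSpace ℂ (H r)] [∀ r, CompleteSpace (H r)]
    [∀ r, NormedAddCommGroup (L r)] [∀ r, InnerProductSpace ℂ (L r)] [∀ r, CompleteSpace (L r)]
    (π : ∀ r, A →⋆ₙₐ[ℂ] (H r →L[ℂ] H r)) (hπ : ∀ x, (∀ r, π r x = 0) → x = 0)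
    (σ : ∀ r, E →⋆ₙₐ[ℂ] (L r →L[ℂ] L r)) (J : ∀ r, K → H r →L[ℂ] L r)
    (hJ : ∀ r k, adjoint (J r k) ∘L J r k = 1)
    (hJ0 : ∀ r k l, k ≠ l → adjoint (J r k) ∘L J r l = 0)
    (hσ : ∀ r k g l, σ r (n.ι (k, g)) ∘L J r l = J r (k * l) ∘L π r (m.ι g))
    (F : Finset K) (f : K × G →₀ ℂ) :
    ‖(CStarMatrix.ofMatrix fun k l : F => m.slice (k.1 * l.1⁻¹) f : CStarMatrix F F A)‖
      ≤ ‖n.eval f‖ := by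
  classical
  refine norm_le_of_jointly_injective (fun r => CStarMatrix.mapₙₐ (n := F) (π r)) ?_
    (norm_nonneg _) fun r => ?_
  · intro X hX
    ext k l
    exact hπ _ fun r => congrFun (congrFun (hX r) k) l
  · have h : CStarMatrix.mapₙₐ (π r)
        (CStarMatrix.ofMatrix fun k l : F => m.slice (k.1 * l.1⁻¹) f : CStarMatrix F F A)
        = CStarMatrix.ofMatrix fun k l : F => adjoint (J r k) ∘L σ r (n.eval f) ∘L J r l := by
      ext1 k l
      change π r (m.slice (k.1 * l.1⁻¹) f) = adjoint (J r k) ∘L σ r (n.eval f) ∘L J r l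
      induction f using Finsupp.induction_linear with
      | zero => simp
      | add f g hf hg =>
        simp only [map_add, hf, hg, ContinuousLinearMap.add_comp, ContinuousLinearMap.comp_add]
      | single p c =>
        obtain ⟨k', g⟩ := p
        rw [GroupModel.eval_single, map_smul, ContinuousLinearMap.smul_comp, hσ,
          ContinuousLinearMap.comp_smul, ← ContinuousLinearMap.comp_assoc]
        simp only [GroupModel.slice, Finsupp.linearCombination_single, map_smul]
        by_cases hk : k' = k.1 * l.1⁻¹
        · have : k' * l.1 = k := by rw [hk]; group
          rw [if_pos hk, this, hJ]; rfl
        · have : k.1 ≠ k' * l.1 := fun h => hk (by rw [h]; group)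
          rw [if_neg hk, hJ0 r _ _ this]; simp
    rw [h]
    refine (norm_compression_le (fun k : F => J r k) ?_ _).trans
      (NonUnitalStarAlgHom.norm_apply_le (σ r) _)
    intro k l
    split_ifs with hkl
    · rw [hkl, hJ]
    · exact hJ0 r _ _ fun h => hkl (Subtype.ext h)

end Compression

/-! ### Extension by zero between ℓ²-spaces -/

section ExtendByZero

variable {X Y : Type*} {i : X → Y} (hi : Function.Injective i)

theorem lp_norm_sq {ι : Type*} {E : ι → Type*} [∀ i, NormedAddCommGroup (E i)] (f : lp E 2) :
    ‖f‖ ^ 2 = ∑' i, ‖f i‖ ^ 2 := by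
  simpa using lp.norm_rpow_eq_tsum (p := 2) (by norm_num) f

theorem lp_summable_sq {ι : Type*} {E : ι → Type*} [∀ i, NormedAddCommGroup (E i)] (f : lp E 2) :
    Summable fun i => ‖f i‖ ^ 2 := by
  simpa using (lp.memℓp f).summable (by norm_num)

theorem memℓp_two_of_summable {ι : Type*} {E : ι → Type*} [∀ i, NormedAddCommGroup (E i)]
    {f : ∀ i, E i} (h : Summable fun i => ‖f i‖ ^ 2) : Memℓp f 2 :=
  memℓp_gen (by simpa using h)

theorem extend_zero_support (f : X → ℂ) :
    ∀ y ∉ Set.range i, ‖Function.extend i f 0 y‖ ^ 2 = 0 := by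
  intro y hy
  rw [Function.extend_apply' _ _ _ (fun ⟨x, hx⟩ => hy ⟨x, hx⟩)]
  simp

/-- Extension by zero `ℓ²(X) → ℓ²(Y)` along an injection. -/
def lpExtend : lp (fun _ : X => ℂ) 2 →ₗᵢ[ℂ] lp (fun _ : Y => ℂ) 2 where
  toFun f := ⟨Function.extend i f 0, memℓp_two_of_summable (by
    rw [← hi.summable_iff (extend_zero_support _)]
    simpa [Function.comp_def, hi.extend_apply] using lp_summable_sq f)⟩
  map_add' f g := by
    ext y
    change Function.extend i (⇑f + ⇑g) 0 y = Function.extend i f 0 y + Function.extend i g 0 y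
    by_cases hy : ∃ x, i x = y
    · obtain ⟨x, rfl⟩ := hy
      simp [hi.extend_apply]
    · simp [Function.extend_apply' _ _ _ hy]
  map_smul' c f := by
    ext y
    change Function.extend i (c • ⇑f) 0 y = c * Function.extend i f 0 y
    by_cases hy : ∃ x, i x = y
    · obtain ⟨x, rfl⟩ := hy
      simp [hi.extend_apply]
    · simp [Function.extend_apply' _ _ _ hy]
  norm_map' f := by
    rw [← sq_eq_sq₀ (norm_nonneg _) (norm_nonneg _), lp_norm_sq, lp_norm_sq]
    change ∑' y, ‖Function.extend i f 0 y‖ ^ 2 = _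
    rw [← hi.tsum_eq (Function.support_subset_iff'.2 (extend_zero_support _))]
    simp [hi.extend_apply]

theorem lpExtend_apply (f : lp (fun _ : X => ℂ) 2) (x : X) : lpExtend hi f (i x) = f x :=
  hi.extend_apply _ _ _

theorem lpExtend_apply' (f : lp (fun _ : X => ℂ) 2) {y : Y} (hy : ¬ ∃ x, i x = y) :
    lpExtend hi f y = 0 :=
  Function.extend_apply' _ _ _ hy

/-- Restriction `ℓ²(Y) → ℓ²(X)` along an injection. -/
def lpRestrict (f : lp (fun _ : Y => ℂ) 2) : lp (fun _ : X => ℂ) 2 :=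
  ⟨fun x => f (i x), memℓp_two_of_summable ((lp_summable_sq f).comp_injective hi)⟩

end ExtendByZero

/-! ### Products of groups: the reduced case -/

section Reduced

variable {K G G' : Type*} [Group K] [Group G] [Group G'] (e : K × G ≃* G')

/-- The inclusion of the cosets of `G` in `K × G`. -/
def cosetEmb (k : K) (g : G) : G' := e (k, g)

theorem cosetEmb_injective (k : K) : Function.Injective (cosetEmb e k) := fun g h hgh => by
  simpa [cosetEmb] using hgh

theorem norm_sq_eq_tsum_restrict (f : lp (fun _ : G' => ℂ) 2) :
    HasSum (fun k : K => ‖lpRestrict (cosetEmb_injective e k) f‖ ^ 2) (‖f‖ ^ 2) := by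
  have h1 : Summable fun p : K × G => ‖f (e p)‖ ^ 2 :=
    (lp_summable_sq f).comp_injective e.injective
  have h2 : ‖f‖ ^ 2 = ∑' p : K × G, ‖f (e p)‖ ^ 2 := by
    rw [lp_norm_sq, ← e.toEquiv.tsum_eq]; rfl
  rw [h2]
  have h3 : (fun k : K => ‖lpRestrict (cosetEmb_injective e k) f‖ ^ 2)
      = fun k => ∑' g, ‖f (e (k, g))‖ ^ 2 := funext fun k => lp_norm_sq _
  rw [h3]
  exact h1.hasSum.prod_fiberwise fun k => (h1.prod_factor k).hasSum

/-- ℓ²(K × G) is the orthogonal sum of the ℓ²-spaces of the cosets {k} × G, and `G` acts on each of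
them by its own left regular representation. The bound holds coset by coset. -/
theorem norm_reduced_restrict_le (f : G →₀ ℂ) :
    ‖Finsupp.linearCombination ℂ (fun g => (reducedModel G').ι (e (1, g))) f‖
      ≤ ‖(reducedModel G).eval f‖ := by
  set T := reducedInclusion G' (Finsupp.linearCombination ℂ
    (fun g => (reducedModel G').ι (e (1, g))) f) with hT
  set S := reducedInclusion G ((reducedModel G).eval f) with hS
  change ‖T‖ ≤ ‖S‖
  have hTS : ∀ k x, lpRestrict (cosetEmb_injective e k) (T x)
      = S (lpRestrict (cosetEmb_injective e k) x) := by
    intro k x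
    rw [hT, hS]
    clear hT hS
    induction f using Finsupp.induction_linear with
    | zero => 
      simp only [map_zero]; rfl
    | add f g hf hg =>
      simp only [map_add, add_apply] at hf hg ⊢
      rw [← hf, ← hg]; rfl
    | single g c =>
      rw [Finsupp.linearCombination_single, GroupModel.eval_single, map_smul, map_smul]
      ext h
      change c * x ((e (1, g))⁻¹ * e (k, h)) = c * x (e (k, g⁻¹ * h))
      rw [← map_inv, ← map_mul]
      simp
  refine ContinuousLinearMap.opNorm_le_bound _ (norm_nonneg _) fun x => ?_
  rw [← sq_le_sq₀ (norm_nonneg _) (by positivity), mul_pow]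
  refine hasSum_le (fun k => ?_) (norm_sq_eq_tsum_restrict e (T x))
    ((norm_sq_eq_tsum_restrict e x).mul_left (‖S‖ ^ 2))
  rw [hTS, ← mul_pow]
  gcongr
  exact S.le_opNorm _

open ContinuousLinearMap in
-- The regular representation of `G` is faithful by construction, so one representation suffices; `J
-- k` is extension by zero from the coset of `k`.
theorem isProductModel_reduced :
    IsProductModel (reducedModel G) ((reducedModel G').comp e) where
  compress := by
    let J : K → (lp (fun _ : G => ℂ) 2 →L[ℂ] lp (fun _ : G' => ℂ) 2) := fun k =>
      (lpExtend (cosetEmb_injective e k)).toContinuousLinearMap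
    refine GroupModel.compress_of_family (R := Unit) (H := fun _ => lp (fun _ : G => ℂ) 2)
      (L := fun _ => lp (fun _ : G' => ℂ) 2) (reducedModel G) ((reducedModel G').comp e)
      (fun _ => reducedInclusion G)
      (fun x hx => Subtype.ext (hx ())) (fun _ => reducedInclusion G')
      (fun _ => J) (fun _ k => ?_) (fun _ k l hkl => ?_) (fun _ k g l => ?_)
    · exact (norm_map_iff_adjoint_comp_self _).1 (lpExtend (cosetEmb_injective e k)).norm_map
    · ext1 x
      refine ext_inner_left ℂ fun y => ?_
      rw [comp_apply, adjoint_inner_right, lp.inner_eq_tsum, zero_apply, inner_zero_right]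
      refine (tsum_congr fun z => ?_).trans tsum_zero
      obtain ⟨⟨k', g⟩, rfl⟩ := e.surjective z
      by_cases hk : k' = k
      · have : lpExtend (cosetEmb_injective e l) x (e (k', g)) = 0 := by
          refine lpExtend_apply' _ _ ?_
          rintro ⟨g', hg'⟩
          have := congrArg Prod.fst (e.injective hg')
          exact hkl (hk.symm.trans this.symm)
        change inner ℂ _ (lpExtend (cosetEmb_injective e l) x (e (k', g))) = 0
        rw [this, inner_zero_right]
      · have : lpExtend (cosetEmb_injective e k) y (e (k', g)) = 0 := by
          refine lpExtend_apply' _ _ ?_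
          rintro ⟨g', hg'⟩
          have := congrArg Prod.fst (e.injective hg')
          exact hk this.symm
        change inner ℂ (lpExtend (cosetEmb_injective e k) y (e (k', g))) _ = 0
        rw [this, inner_zero_left]
    · ext x z
      obtain ⟨⟨k', h⟩, rfl⟩ := e.surjective z
      change lpExtend (cosetEmb_injective e l) x ((e (k, g))⁻¹ * e (k', h))
        = lpExtend (cosetEmb_injective e (k * l))
          ((leftRegular G g : lp (fun _ : G => ℂ) 2 →L[ℂ] lp (fun _ : G => ℂ) 2) x) (e (k', h))
      rw [← map_inv, ← map_mul, Prod.inv_mk, Prod.mk_mul_mk]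
      by_cases hk : k' = k * l
      · subst hk
        rw [inv_mul_cancel_left]
        exact (lpExtend_apply (cosetEmb_injective e l) x (g⁻¹ * h)).trans
          (lpExtend_apply (cosetEmb_injective e (k * l))
            ((leftRegular G g : lp (fun _ : G => ℂ) 2 →L[ℂ] lp (fun _ : G => ℂ) 2) x) h).symm
      · rw [lpExtend_apply', lpExtend_apply']
        · rintro ⟨g', hg'⟩
          exact hk (congrArg Prod.fst (e.injective hg')).symm
        · rintro ⟨g', hg'⟩
          have := congrArg Prod.fst (e.injective hg')
          exact hk (by rw [show l = k⁻¹ * k' from this]; group)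
  restrict := (reducedModel G).exists_hom (fun g => (reducedModel G').ι (e (1, g)))
    (fun g h => by rw [← (reducedModel G').map_mul, ← map_mul]; simp)
    (fun g => by rw [(reducedModel G').map_star, ← map_inv]; simp)
    (norm_reduced_restrict_le e)

end Reduced

/-! ### Products of groups: the full case -/

section Full

variable {K G G' : Type u} [Group K] [Group G] [Group G'] (e : K × G ≃* G')

/-- The representation `λ_K ⊗ ρ` of `K × G` on `ℓ²(K, H)`. -/
def regularTensor {H : Type*} [NormedAddCommGroup H] [InnerProductSpace ℂ H]
    (ρ : G →* (H ≃ₗᵢ[ℂ] H)) :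
    K × G →* (lp (fun _ : K => H) 2 ≃ₗᵢ[ℂ] lp (fun _ : K => H) 2) where
  toFun p :=
    { toFun := fun f => ⟨fun k => ρ p.2 (f (p.1⁻¹ * k)), memℓp_two_of_summable (by
        simpa [Function.comp_def] using (lp_summable_sq f).comp_injective (mul_right_injective p.1⁻¹))⟩
      invFun := fun f => ⟨fun k => ρ p.2⁻¹ (f (p.1⁻¹⁻¹ * k)), memℓp_two_of_summable (by
        simpa [Function.comp_def] using (lp_summable_sq f).comp_injective (mul_right_injective p.1⁻¹⁻¹))⟩
      map_add' := fun f g => by ext k; exact map_add (ρ p.2) _ _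
      map_smul' := fun c f => by ext k; exact map_smul (ρ p.2) _ _
      left_inv := fun f => by
        ext k
        change ρ p.2⁻¹ (ρ p.2 (f (p.1⁻¹ * (p.1⁻¹⁻¹ * k)))) = f k
        refine (congrArg (fun z => ρ p.2⁻¹ (ρ p.2 (f z))) (mul_inv_cancel_left p.1⁻¹ k)).trans ?_
        rw [map_inv]
        exact (ρ p.2).symm_apply_apply _
      right_inv := fun f => by
        ext k
        change ρ p.2 (ρ p.2⁻¹ (f (p.1⁻¹⁻¹ * (p.1⁻¹ * k)))) = f k
        refine (congrArg (fun z => ρ p.2 (ρ p.2⁻¹ (f z))) (inv_mul_cancel_left p.1⁻¹ k)).trans ?_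
        rw [map_inv]
        exact (ρ p.2).apply_symm_apply _
      norm_map' := fun f => by
        rw [← sq_eq_sq₀ (norm_nonneg _) (norm_nonneg _), lp_norm_sq, lp_norm_sq]
        refine (tsum_congr fun k => ?_).trans
          ((Equiv.mulLeft p.1⁻¹).tsum_eq (fun h => ‖f h‖ ^ 2))
        change ‖ρ p.2 (f (p.1⁻¹ * k))‖ ^ 2 = _
        rw [LinearIsometryEquiv.norm_map]; rfl }
  map_one' := by
    ext f k
    change ρ 1 (f (1⁻¹ * k)) = f k
    simp
  map_mul' p q := by
    ext f k
    change ρ (p.2 * q.2) (f ((p.1 * q.1)⁻¹ * k)) = ρ p.2 (ρ q.2 (f (q.1⁻¹ * (p.1⁻¹ * k))))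
    rw [map_mul, mul_inv_rev, mul_assoc]
    rfl

/-- The unitary representation `λ_K ⊗ ρ` of `G' ≅ K × G`. -/
def UnitaryRep.induced (ρ : UnitaryRep G) : UnitaryRep G' where
  space := lp (fun _ : K => ρ.space) 2
  toHom := (Unitary.linearIsometryEquiv (𝕜 := ℂ)
    (H := lp (fun _ : K => ρ.space) 2)).symm.toMonoidHom.comp
      ((regularTensor ((Unitary.linearIsometryEquiv (𝕜 := ℂ)
        (H := ρ.space)).toMonoidHom.comp ρ.toHom)).comp e.symm.toMonoidHom)

/-- The restriction of a unitary representation of `G' ≅ K × G` to `G`. -/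
def UnitaryRep.restrict (ρ : UnitaryRep G') : UnitaryRep G where
  space := ρ.space
  toHom := ρ.toHom.comp (e.toMonoidHom.comp (MonoidHom.inr K G))

theorem UnitaryRep.induced_apply (ρ : UnitaryRep G) (p : K × G) (f : lp (fun _ : K => ρ.space) 2)
    (k : K) :
    (show lp (fun _ : K => ρ.space) 2 from
      ((ρ.induced e).toHom (e p) : (ρ.induced e).space →L[ℂ] (ρ.induced e).space) f) k = (ρ.toHom p.2 : ρ.space →L[ℂ] ρ.space) (f (p.1⁻¹ * k)) := by
  change (ρ.toHom (e.symm (e p)).2 : ρ.space →L[ℂ] ρ.space) (f ((e.symm (e p)).1⁻¹ * k)) = _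
  rw [e.symm_apply_apply]

/-- Every representation of `K × G` restricts to one of `G`, so it is among those defining the norm
of the algebra of `G`. -/
theorem norm_full_restrict_le (f : G →₀ ℂ) :
    ‖Finsupp.linearCombination ℂ (fun g => (fullModel G').ι (e (1, g))) f‖
      ≤ ‖(fullModel G).eval f‖ := by
  refine norm_le_of_jointly_injective (fun ρ : UnitaryRep G' => fullProjection ρ)
    (fun x hx => Subtype.ext (by ext1; funext ρ; exact hx ρ)) (norm_nonneg _) fun ρ => ?_
  have h : fullProjection ρ (Finsupp.linearCombination ℂ (fun g => (fullModel G').ι (e (1, g))) f)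
      = fullProjection (ρ.restrict e) ((fullModel G).eval f) := by
    induction f using Finsupp.induction_linear with
    | zero => simp only [map_zero]; rfl
    | add f g hf hg => simp only [map_add, hf, hg]; rfl
    | single g c =>
      rw [Finsupp.linearCombination_single, GroupModel.eval_single, map_smul, map_smul]
      rfl
  rw [h]
  exact NonUnitalStarAlgHom.norm_apply_le (fullProjection (ρ.restrict e)) _

open ContinuousLinearMap in
-- For each representation ρ of `G` on H, the representation λ_K ⊗ ρ on ℓ²(K, H) occurs in the
-- universal one of `K × G`. The map `J k` is the inclusion of the `k`-th coordinate, and the family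
-- of all ρ is jointly faithful.
theorem isProductModel_full : IsProductModel (fullModel G) ((fullModel G').comp e) where
  compress := by
    classical
    refine GroupModel.compress_of_family (R := UnitaryRep G) (H := fun ρ => ρ.space)
      (L := fun ρ => lp (fun _ : K => ρ.space) 2) (fullModel G) ((fullModel G').comp e)
      (fun ρ => fullProjection ρ)
      (fun x hx => Subtype.ext (by ext1; funext ρ; exact hx ρ))
      (fun ρ => fullProjection (ρ.induced e))
      (fun ρ k => lp.singleContinuousLinearMap ℂ (fun _ : K => ρ.space) 2 k)
      (fun ρ k => ?_) (fun ρ k l hkl => ?_) (fun ρ k g l => ?_)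
    · ext1 x
      refine ext_inner_left ℂ fun y => ?_
      rw [comp_apply, adjoint_inner_right]
      simp [lp.inner_single_left]
    · ext1 x
      refine ext_inner_left ℂ fun y => ?_
      rw [comp_apply, adjoint_inner_right]
      simp [lp.inner_single_left, hkl]
    · ext x k'
      refine (UnitaryRep.induced_apply e ρ (k, g) _ k').trans ?_
      change (ρ.toHom g : ρ.space →L[ℂ] ρ.space) ((lp.single 2 l x : lp (fun _ : K => ρ.space) 2)
        (k⁻¹ * k')) = (lp.single 2 (k * l) ((ρ.toHom g : ρ.space →L[ℂ] ρ.space) x) :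
          lp (fun _ : K => ρ.space) 2) k'
      by_cases hk : k' = k * l
      · subst hk
        rw [inv_mul_cancel_left]
        simp
      · have : k⁻¹ * k' ≠ l := fun h => hk (by rw [← h]; group)
        simp [hk, this]
  restrict := (fullModel G).exists_hom (fun g => (fullModel G').ι (e (1, g)))
    (fun g h => by rw [← (fullModel G').map_mul, ← map_mul]; simp)
    (fun g => by rw [(fullModel G').map_star, ← map_inv]; simp)
    (norm_full_restrict_le e)

end Full

/-! ### Diagonal sums along orthogonal isometries -/

section FamSum

variable {D : Type*} [CStarAlgebra D] {ι : Type*}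

/-- A family of isometries with pairwise orthogonal ranges. -/
def IsOrthoFamily [DecidableEq ι] (S : ι → D) : Prop :=
  ∀ i j, star (S i) * S j = if i = j then 1 else 0

theorem IsOrthoFamily.map [DecidableEq ι] {S : ι → D} {D' : Type*} [CStarAlgebra D']
    (f : D →⋆ₐ[ℂ] D') (hS : IsOrthoFamily S) : IsOrthoFamily fun i => f (S i) := by
  intro i j
  rw [← map_star, ← map_mul, hS]
  split_ifs <;> simp

variable [Fintype ι]

/-- The "diagonal matrix" with entries `x i` with respect to a family of isometries. -/
def famSum (S x : ι → D) : D := ∑ i, S i * x i * star (S i)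

variable {S : ι → D}

theorem star_famSum (x : ι → D) : star (famSum S x) = famSum S fun i => star (x i) := by
  simp [famSum, mul_assoc]

theorem famSum_one (h1 : ∑ i, S i * star (S i) = 1) : famSum S (fun _ => 1) = 1 := by
  simpa [famSum] using h1

theorem map_famSum {D' : Type*} [CStarAlgebra D'] (f : D →⋆ₐ[ℂ] D') (x : ι → D) :
    f (famSum S x) = famSum (fun i => f (S i)) fun i => f (x i) := by
  simp [famSum, map_star]

variable [DecidableEq ι]

theorem famSum_mul_apply (hS : IsOrthoFamily S) (x : ι → D) (j : ι) :
    famSum S x * S j = S j * x j := by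
  rw [famSum, Finset.sum_mul, Finset.sum_eq_single j]
  · rw [mul_assoc, hS, if_pos rfl, mul_one]
  · intro i _ hi
    rw [mul_assoc, hS, if_neg hi, mul_zero]
  · simp

theorem famSum_mul (hS : IsOrthoFamily S) (x y : ι → D) :
    famSum S x * famSum S y = famSum S fun i => x i * y i := by
  conv_lhs => rw [famSum.eq_1 S y]
  rw [Finset.mul_sum]
  refine Finset.sum_congr rfl fun i _ => ?_
  rw [← mul_assoc, ← mul_assoc, famSum_mul_apply hS, mul_assoc (S i)]

theorem famSum_mem_unitary (hS : IsOrthoFamily S) (h1 : ∑ i, S i * star (S i) = 1) {x : ι → D}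
    (hx : ∀ i, x i ∈ unitary D) : famSum S x ∈ unitary D := by
  rw [Unitary.mem_iff, star_famSum, famSum_mul hS, famSum_mul hS]
  simp only [Unitary.star_mul_self_of_mem (hx _), Unitary.mul_star_self_of_mem (hx _)]
  exact ⟨famSum_one h1, famSum_one h1⟩

/-- The diagonal sum of a family of homomorphisms. -/
def famHom {A : Type*} [NonUnitalCStarAlgebra A] (hS : IsOrthoFamily S)
    (Φ : ι → A →⋆ₙₐ[ℂ] D) : A →⋆ₙₐ[ℂ] D where
  toFun a := famSum S fun i => Φ i a
  map_smul' c a := by simp [famSum, Finset.smul_sum]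
  map_zero' := by simp [famSum]
  map_add' a b := by simp [famSum, mul_add, add_mul, Finset.sum_add_distrib]
  map_mul' a b := by simp [famSum_mul hS]
  map_star' a := by simp [star_famSum, map_star]

theorem famHom_apply {A : Type*} [NonUnitalCStarAlgebra A] (hS : IsOrthoFamily S)
    (Φ : ι → A →⋆ₙₐ[ℂ] D) (a : A) : famHom hS Φ a = famSum S fun i => Φ i a := rfl

/-- Conjugation of a homomorphism by a unitary. -/
def conjHom {A : Type*} [NonUnitalCStarAlgebra A] (W : D) (hW : W ∈ unitary D)
    (Φ : A →⋆ₙₐ[ℂ] D) : A →⋆ₙₐ[ℂ] D where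
  toFun a := W * Φ a * star W
  map_smul' c a := by simp
  map_zero' := by simp
  map_add' a b := by simp [mul_add, add_mul]
  map_mul' a b := by
    have h : W * Φ a * star W * (W * Φ b * star W) = W * Φ a * (star W * W) * Φ b * star W := by
      noncomm_ring
    rw [h, Unitary.star_mul_self_of_mem hW, mul_one]
    simp only [map_mul, mul_assoc]
  map_star' a := by simp [map_star, mul_assoc]

end FamSum

/-! ### Finite families of isometries in M(B) -/

section IsometryFamilies

variable {B : Type w} [NonUnitalCStarAlgebra B]

/-- The two isometries of a pair, as a family. -/
def IsometryPair.fam (V : IsometryPair B) : Fin 2 → Multiplier B := ![V.V₁, V.V₂]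

theorem IsometryPair.isOrthoFamily (V : IsometryPair B) : IsOrthoFamily V.fam := by
  intro i j
  fin_cases i <;> fin_cases j <;>
    simp [IsometryPair.fam, V.isometry₁, V.isometry₂, V.orthogonal, V.orthogonal']

theorem IsometryPair.sum_fam (V : IsometryPair B) : ∑ i, V.fam i * star (V.fam i) = 1 := by
  simp [IsometryPair.fam, V.sum_eq_one]

/-- A decomposition of 1 into n + 1 pieces is pushed into the range of `V.V₂`, and `V.V₁` supplies
one piece more. -/
theorem IsometryPair.exists_family (V : IsometryPair B) (ι : Type*) [Fintype ι] [DecidableEq ι]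
    [Nonempty ι] : ∃ S : ι → Multiplier B, IsOrthoFamily S ∧ ∑ i, S i * star (S i) = 1 := by
  have key : ∀ n : ℕ, ∃ S : Fin (n + 1) → Multiplier B,
      IsOrthoFamily S ∧ ∑ i, S i * star (S i) = 1 := by
    intro n
    induction n with
    | zero => exact ⟨fun _ => 1, fun i j => by
        simp [Subsingleton.elim (α := Fin 1) i j], by simp⟩
    | succ n ih =>
      obtain ⟨S, hS, h1⟩ := ih
      refine ⟨Fin.cons V.V₁ fun i => V.V₂ * S i, fun i j => ?_, ?_⟩
      · refine Fin.cases ?_ (fun i => ?_) i <;> refine Fin.cases ?_ (fun j => ?_) j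
        · simp [V.isometry₁]
        · simp [← mul_assoc, V.orthogonal, (Fin.succ_ne_zero j).symm]
        · simp [mul_assoc, V.orthogonal']
        · have := hS i j
          simp only [Fin.cons_succ, star_mul, Fin.succ_inj]
          rw [mul_assoc, ← mul_assoc _ V.V₂, V.isometry₂, one_mul, this]
      · rw [Fin.sum_univ_succ]
        simp only [Fin.cons_zero, Fin.cons_succ, star_mul]
        have : ∀ i, V.V₂ * S i * (star (S i) * star V.V₂)
            = V.V₂ * (S i * star (S i)) * star V.V₂ := fun i => by noncomm_ring
        simp only [this, ← Finset.sum_mul, ← Finset.mul_sum, h1, mul_one]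
        exact V.sum_eq_one
  obtain ⟨n, hn⟩ : ∃ n, Fintype.card ι = n + 1 :=
    Nat.exists_eq_succ_of_ne_zero Fintype.card_ne_zero
  obtain ⟨S, hS, h1⟩ := key n
  let e : ι ≃ Fin (n + 1) := Fintype.equivFinOfCardEq hn
  refine ⟨fun i => S (e i), fun i j => ?_, ?_⟩
  · rw [hS]; simp
  · rw [← h1]; exact e.sum_comp fun i => S i * star (S i)

end IsometryFamilies

/-! ### Lifting algebras and summands of liftable extensions -/

section LiftingAlgebra

variable (B : Type w) [NonUnitalCStarAlgebra B]

/-- A C*-algebra over `Q(B)`, containing `M(B)`, in which unitaries of the form `w ⊕ w*` lift. -/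
structure LiftingAlgebra where
  carrier : Type w
  [cstar : CStarAlgebra carrier]
  p : carrier →⋆ₐ[ℂ] Corona B
  c : Multiplier B →⋆ₐ[ℂ] carrier
  p_c : ∀ x, p (c x) = coronaMk B x
  lift_unitary : ∀ (V : IsometryPair B) (X : Set carrier), X.Countable → ∀ w ∈ unitary (Corona B),
    (∀ x ∈ X, Commute w (p x)) → ∃ (θ : carrier →⋆ₐ[ℂ] carrier), ∃ W ∈ unitary carrier,
      (∀ x, p (θ x) = p x) ∧ p W = famSum (fun i => coronaMk B (V.fam i)) ![w, star w] ∧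
      ∀ x ∈ X, Commute W (famSum (fun i => c (V.fam i)) fun _ => θ x)

attribute [instance] LiftingAlgebra.cstar

variable {B}
variable {A : Type*} [NonUnitalCStarAlgebra A] (L : LiftingAlgebra B)

/-- The extension lifts to a homomorphism into the lifting algebra. -/
def LiftingAlgebra.Lifts (φ : Extension A B) : Prop :=
  ∃ Φ : A →⋆ₙₐ[ℂ] L.carrier, ∀ a, L.p (Φ a) = φ a

/-- The extension has a direct complement such that the sum lifts. -/
def LiftingAlgebra.Invertible (φ : Extension A B) : Prop :=
  ∃ (V : IsometryPair B) (ψ : Extension A B), L.Lifts (extensionSum V φ ψ)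

variable {L}

theorem extensionSum_apply (V : IsometryPair B) (φ ψ : Extension A B) (a : A) :
    extensionSum V φ ψ a = famSum (fun i => coronaMk B (V.fam i)) ![φ a, ψ a] := by
  simp [famSum, IsometryPair.fam, extensionSum]

/-- A direct summand of a liftable extension is invertible. -/
theorem LiftingAlgebra.invertible_of_summand (V : IsometryPair B) {φ T : Extension A B}
    (hT : L.Lifts T) (S : Multiplier B) (hS : star S * S = 1)
    (h : ∀ a, T a * coronaMk B S = coronaMk B S * φ a) : L.Invertible φ := by
  obtain ⟨Φ, hΦ⟩ := hT
  obtain ⟨v₁, v₂, h11, h22, h12⟩ := V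
  have o12 : star v₁ * v₂ = 0 := IsometryPair.orthogonal ⟨v₁, v₂, h11, h22, h12⟩
  have o21 : star v₂ * v₁ = 0 := IsometryPair.orthogonal' ⟨v₁, v₂, h11, h22, h12⟩
  set R : Multiplier B := v₁ * S with hR
  -- An isometry onto the complement of the range of `R`. It fixes the part of the range of `v₁`
  -- orthogonal to that of `R`, and makes room inside the range of `v₂`: the vector `v₁ S x` goes to
  -- `v₂ v₁ x`, and `v₂ x` goes to `v₂ v₂ x`.
  set W : Multiplier B := v₁ * (1 - S * star S) * star v₁ + v₂ * v₁ * star S * star v₁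
    + v₂ * v₂ * star v₂ with hW
  have hRR : star R * R = 1 := by
    rw [hR, star_mul, mul_assoc, ← mul_assoc (star v₁), h11, one_mul, hS]
  have hPS : (1 - S * star S) * S = 0 := by rw [sub_mul, mul_assoc, hS]; simp
  have hSP : star S * (1 - S * star S) = 0 := by rw [mul_sub, ← mul_assoc, hS]; simp
  have hWs : star W = v₁ * (1 - S * star S) * star v₁ + v₁ * S * star v₁ * star v₂
      + v₂ * star v₂ * star v₂ := by
    simp only [hW, star_add, star_mul, star_sub, star_star, star_one]
    noncomm_ring
  have hWW' : W * star W = 1 - R * star R := by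
    rw [hWs, hW, hR]
    have e : (v₁ * (1 - S * star S) * star v₁ + v₂ * v₁ * star S * star v₁
        + v₂ * v₂ * star v₂) * (v₁ * (1 - S * star S) * star v₁ + v₁ * S * star v₁ * star v₂
        + v₂ * star v₂ * star v₂)
      = v₁ * (1 - S * star S) * (star v₁ * v₁) * (1 - S * star S) * star v₁
        + v₁ * (1 - S * star S) * (star v₁ * v₁) * S * star v₁ * star v₂
        + v₁ * (1 - S * star S) * (star v₁ * v₂) * star v₂ * star v₂
        + v₂ * v₁ * star S * (star v₁ * v₁) * (1 - S * star S) * star v₁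
        + v₂ * v₁ * star S * (star v₁ * v₁) * S * star v₁ * star v₂
        + v₂ * v₁ * star S * (star v₁ * v₂) * star v₂ * star v₂
        + v₂ * v₂ * (star v₂ * v₁) * (1 - S * star S) * star v₁
        + v₂ * v₂ * (star v₂ * v₁) * S * star v₁ * star v₂
        + v₂ * v₂ * (star v₂ * v₂) * star v₂ * star v₂ := by noncomm_ring
    rw [e, h11, h22, o12, o21]
    simp only [mul_one, mul_zero, zero_mul, add_zero]
    have e1 : v₁ * (1 - S * star S) * (1 - S * star S)
        = v₁ * (1 - S * star S) - v₁ * ((1 - S * star S) * S) * star S := by noncomm_ring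
    rw [e1, hPS, mul_assoc v₁ (1 - S * star S) S, hPS,
      mul_assoc (v₂ * v₁) (star S) (1 - S * star S), hSP, mul_assoc (v₂ * v₁) (star S) S, hS]
    simp only [mul_one, mul_zero, zero_mul, add_zero, sub_zero, star_mul]
    have e2 : v₁ * (1 - S * star S) * star v₁ + v₂ * v₁ * star v₁ * star v₂
        + v₂ * v₂ * star v₂ * star v₂
        = v₁ * star v₁ - v₁ * S * (star S * star v₁)
          + v₂ * (v₁ * star v₁ + v₂ * star v₂) * star v₂ := by noncomm_ring
    rw [e2, h12, mul_one, ← h12]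
    abel
  have hWW : star W * W = 1 := by
    rw [hWs, hW]
    have e : (v₁ * (1 - S * star S) * star v₁ + v₁ * S * star v₁ * star v₂
        + v₂ * star v₂ * star v₂) * (v₁ * (1 - S * star S) * star v₁ + v₂ * v₁ * star S * star v₁
        + v₂ * v₂ * star v₂)
      = v₁ * (1 - S * star S) * (star v₁ * v₁) * (1 - S * star S) * star v₁
        + v₁ * (1 - S * star S) * (star v₁ * v₂) * v₁ * star S * star v₁
        + v₁ * (1 - S * star S) * (star v₁ * v₂) * v₂ * star v₂
        + v₁ * S * star v₁ * (star v₂ * v₁) * (1 - S * star S) * star v₁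
        + v₁ * S * star v₁ * (star v₂ * v₂) * v₁ * star S * star v₁
        + v₁ * S * star v₁ * (star v₂ * v₂) * v₂ * star v₂
        + v₂ * star v₂ * (star v₂ * v₁) * (1 - S * star S) * star v₁
        + v₂ * star v₂ * (star v₂ * v₂) * v₁ * star S * star v₁
        + v₂ * star v₂ * (star v₂ * v₂) * v₂ * star v₂ := by noncomm_ring
    rw [e, h11, h22, o12, o21]
    simp only [mul_one, mul_zero, zero_mul, add_zero]
    have e1 : v₁ * (1 - S * star S) * (1 - S * star S)
        = v₁ * (1 - S * star S) - v₁ * ((1 - S * star S) * S) * star S := by noncomm_ring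
    rw [e1, hPS, mul_assoc (v₁ * S) (star v₁) v₁, h11, mul_assoc (v₁ * S) (star v₁) v₂, o12,
      mul_assoc v₂ (star v₂) v₁, o21, mul_assoc v₂ (star v₂) v₂, h22]
    simp only [mul_one, mul_zero, zero_mul, add_zero, sub_zero]
    have e2 : v₁ * (1 - S * star S) * star v₁ + (v₁ * S * star S * star v₁ + v₂ * star v₂)
        = v₁ * star v₁ + v₂ * star v₂ := by noncomm_ring
    exact Eq.trans (by abel) (e2.trans h12)
  set r := coronaMk B R
  set w := coronaMk B W
  have hww : star w * w = 1 := by rw [← map_star, ← map_mul, hWW, map_one]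
  have hww' : w * star w = 1 - r * star r := by
    rw [← map_star, ← map_mul, hWW', map_sub, map_one, map_mul, map_star]
  have hv₁ : star (coronaMk B v₁) * coronaMk B v₁ = 1 := by
    rw [← map_star, ← map_mul, h11, map_one]
  -- `T` is moved into the corner of `v₁`. This extension still lifts, and it turns out to be the
  -- sum of `φ` and its compression `ψ` to the complement.
  let T' : A → Corona B := fun a => coronaMk B v₁ * T a * star (coronaMk B v₁)
  have hmul : ∀ a b, T' (a * b) = T' a * T' b := by
    intro a b
    have : T' a * T' b = coronaMk B v₁ * T a * (star (coronaMk B v₁) * coronaMk B v₁) * T b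
      * star (coronaMk B v₁) := by simp only [T']; noncomm_ring
    rw [this, hv₁, mul_one]
    simp only [T', map_mul]
    noncomm_ring
  have hstar : ∀ a, T' (star a) = star (T' a) := by
    intro a; simp [T', map_star, mul_assoc]
  have hTr : ∀ a, T' a * r = r * φ a := by
    intro a
    have : T' a * r = coronaMk B v₁ * T a * (star (coronaMk B v₁) * coronaMk B v₁)
        * coronaMk B S := by
      simp only [T', r, hR, map_mul]; noncomm_ring
    rw [this, hv₁, mul_one, mul_assoc, h, ← mul_assoc, ← map_mul]
  have hrT : ∀ a, star r * T' a = φ a * star r := by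
    intro a
    have := congrArg star (hTr (star a))
    simpa [hstar, map_star] using this
  have hcomm : ∀ a, T' a * (w * star w) = w * star w * T' a := by
    intro a
    rw [hww', mul_sub, sub_mul, mul_one, one_mul, ← mul_assoc, hTr, mul_assoc r, mul_assoc r, hrT]
  -- The compression to the range of `w` is multiplicative because `T'` commutes with the projection
  -- `w * star w`.
  let ψ : Extension A B :=
    { toFun a := star w * T' a * w
      map_smul' c a := by simp [T']
      map_zero' := by simp [T']
      map_add' a b := by simp [T', mul_add, add_mul]
      map_mul' a b := by
        have e1 : star w * T' a * w * (star w * T' b * w)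
          = star w * (T' a * (w * star w)) * T' b * w := by noncomm_ring
        have e2 : star w * (w * star w * T' a) * T' b * w
          = (star w * w) * star w * (T' a * T' b) * w := by noncomm_ring
        rw [e1, hcomm, e2, hww, one_mul, hmul]
      map_star' a := by rw [hstar]; simp [mul_assoc] }
  have hL : star (L.c v₁) * L.c v₁ = 1 := by rw [← map_star, ← map_mul, h11, map_one]
  refine ⟨⟨R, W, hRR, hWW, by rw [hWW']; abel⟩, ψ, ?_⟩
  have hO : IsOrthoFamily fun _ : Unit => L.c v₁ := fun _ _ => by simp [hL]
  refine ⟨famHom hO fun _ => Φ, fun a => ?_⟩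
  rw [famHom_apply, map_famSum]
  simp only [L.p_c, hΦ]
  change ∑ _ : Unit, coronaMk B v₁ * T a * star (coronaMk B v₁)
    = r * φ a * star r + w * (star w * T' a * w) * star w
  have e3 : w * (star w * T' a * w) * star w = w * star w * (T' a * (w * star w)) := by
    noncomm_ring
  have e4 : w * star w * (w * star w) = w * (star w * w) * star w := by noncomm_ring
  rw [e3, hcomm, ← mul_assoc, e4, hww, mul_one, hww', ← hTr, sub_mul, one_mul, mul_assoc r, hrT,
    mul_assoc, ← mul_assoc r, ← hTr]
  simp [T', mul_assoc]

end LiftingAlgebra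

/-! ### Dilations for ℤ and for finite groups -/

section Step

variable {B : Type w} [NonUnitalCStarAlgebra B] {L : LiftingAlgebra B}
variable {K G A E : Type*} [Group K] [Group G] [NonUnitalCStarAlgebra A] [NonUnitalCStarAlgebra E]
  {m : GroupModel G A} {n : GroupModel (K × G) E}

theorem famHom_comp_lift {ι : Type*} [Fintype ι] [DecidableEq ι] {S : ι → Multiplier B}
    (hS : IsOrthoFamily S) (Φ : A →⋆ₙₐ[ℂ] L.carrier) (a : A) :
    L.p (famHom (hS.map L.c) (fun _ => Φ) a) = famSum (fun i => coronaMk B (S i))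
      fun _ => L.p (Φ a) := by
  rw [famHom_apply, map_famSum]
  simp only [L.p_c]

/-- `w ⊕ w*` compressed to the first summand. -/
theorem famSum_unitary_mul_V₁ (V : IsometryPair B) (w : Corona B) :
    famSum (fun i => coronaMk B (V.fam i)) ![w, star w] * coronaMk B V.V₁
      = coronaMk B V.V₁ * w :=
  famSum_mul_apply (V.isOrthoFamily.map (coronaMk B)) ![w, star w] 0

theorem famSum_const_mul_V₁ (V : IsometryPair B) (x : Corona B) :
    famSum (fun i => coronaMk B (V.fam i)) (fun _ => x) * coronaMk B V.V₁
      = coronaMk B V.V₁ * x :=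
  famSum_mul_apply (V.isOrthoFamily.map (coronaMk B)) (fun _ => x) 0

/-- The group `K` admits dilations of extensions twisted by commuting unitaries. -/
def Dilates (K : Type*) [Group K] {G A E : Type*} [Group G] [NonUnitalCStarAlgebra A]
    [NonUnitalCStarAlgebra E] (m : GroupModel G A) (n : GroupModel (K × G) E)
    (L : LiftingAlgebra B) : Prop :=
  ∀ (_ : IsometryPair B) (Φ : Extension A B), L.Lifts Φ → ∀ U : K →* unitary (Corona B),
    (∀ k a, Commute (U k : Corona B) (Φ a)) → ∃ T : Extension E B, L.Lifts T ∧
      ∃ S : Multiplier B, star S * S = 1 ∧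
        ∀ k g, T (n.ι (k, g)) * coronaMk B S = coronaMk B S * ((U k : Corona B) * Φ (m.ι g))

/-- If `u` is the image under `U` of the generator, then `u ⊕ u*` lifts to a unitary commuting with
a lift of `Φ ⊕ Φ`. As ℤ is free, its powers form a representation with no relation to verify, and
the first summand is the desired twist of `Φ` by `U`. Commutation is needed only on the countably
many group elements. -/
theorem dilates_int [Countable G] {n : GroupModel (ULift.{u} (Multiplicative ℤ) × G) E}
    (hmn : IsProductModel m n) : Dilates (ULift.{u} (Multiplicative ℤ)) m n L := by
  rintro V Φ ⟨Ψ, hΨ⟩ U hU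
  set z : ULift.{u} (Multiplicative ℤ) := ULift.up (Multiplicative.ofAdd 1) with hz
  obtain ⟨θ, W, hW, hθ, hpW, hcomm⟩ := L.lift_unitary V (Set.range fun g => Ψ (m.ι g))
    (Set.countable_range _) (U z) (U z).2 (by
      rintro _ ⟨g, rfl⟩
      rw [hΨ]
      exact hU _ _)
  let W' : ULift.{u} (Multiplicative ℤ) →* unitary L.carrier :=
    (zpowersHom (unitary L.carrier) ⟨W, hW⟩).comp MulEquiv.ulift.toMonoidHom
  have hW' : ∀ k, W' k = (⟨W, hW⟩ : unitary L.carrier) ^ (k.down.toAdd) := fun k => rfl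
  let Φ' : A →⋆ₙₐ[ℂ] L.carrier := famHom (V.isOrthoFamily.map L.c)
    fun _ => (θ : L.carrier →⋆ₙₐ[ℂ] L.carrier).comp Ψ
  have hWΦ : ∀ a, Commute W (Φ' a) :=
    m.commute_of_forall Φ' W fun g => hcomm _ ⟨g, rfl⟩
  have hWΦ' : ∀ k a, Commute (W' k : L.carrier) (Φ' a) := by
    intro k a
    have : ((Unitary.toUnits (W' k) : L.carrierˣ) : L.carrier) = W' k := rfl
    rw [← this, hW', map_zpow]
    exact Commute.units_zpow_left (u := Unitary.toUnits (⟨W, hW⟩ : unitary L.carrier)) (hWΦ a) _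
  obtain ⟨T, hT⟩ := hmn.exists_hom Φ' W' hWΦ'
  refine ⟨(L.p : L.carrier →⋆ₙₐ[ℂ] Corona B).comp T, ⟨T, fun a => rfl⟩, V.V₁, V.isometry₁,
    fun k g => ?_⟩
  change L.p (T (n.ι (k, g))) * _ = _
  have h1 : L.p (W' k : L.carrier) * coronaMk B V.V₁ = coronaMk B V.V₁ * (U k : Corona B) := by
    have hk : k = z ^ (k.down.toAdd) := by
      apply ULift.ext
      change k.down = (Multiplicative.ofAdd (1 : ℤ)) ^ (k.down.toAdd)
      rw [← ofAdd_zsmul]; simp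
    -- The intertwining relation for the generator passes to all integral powers, negative ones
    -- included.
    have hs : SemiconjBy (coronaMk B V.V₁)
        ((Unitary.toUnits (U z) : (Corona B)ˣ) : Corona B)
        ((Units.map (L.p : L.carrier →* Corona B)
          (Unitary.toUnits (⟨W, hW⟩ : unitary L.carrier)) : (Corona B)ˣ) : Corona B) := by
      change coronaMk B V.V₁ * (U z : Corona B) = L.p W * coronaMk B V.V₁
      rw [hpW, famSum_unitary_mul_V₁]
    have := hs.units_zpow_right (k.down.toAdd)
    rw [← map_zpow, ← map_zpow, ← map_zpow, ← map_zpow, ← hk] at this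
    exact this.symm
  rw [hT, map_mul, mul_assoc]
  have h2 : L.p (Φ' (m.ι g)) * coronaMk B V.V₁ = coronaMk B V.V₁ * Φ (m.ι g) := by
    rw [famHom_comp_lift V.isOrthoFamily, ← hΨ]
    change famSum _ (fun _ => L.p (θ (Ψ (m.ι g)))) * _ = _
    rw [hθ, famSum_const_mul_V₁]
  rw [h2, ← mul_assoc, h1, mul_assoc]

/-- Separate lifts of the unitaries `U k` need not respect the relations of `K`. Instead `Φ` is
repeated `Fintype.card K` times, and `K` permutes the copies by multipliers, which lift. Conjugation
by w = ⊕ U(k) turns this permutation representation λ into λ ⊗ U, and the λ-invariant vector ∑ S(k)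
cuts out `U`. -/
theorem dilates_finite [Finite K] (hmn : IsProductModel m n) : Dilates K m n L := by
  classical
  have := Fintype.ofFinite K
  rintro V Φ ⟨Ψ, hΨ⟩ U hU
  obtain ⟨S, hS, hS1⟩ := V.exists_family K
  set s : K → Corona B := fun k => coronaMk B (S k) with hs
  have hsO : IsOrthoFamily s := hS.map (coronaMk B)
  let lam : K → Multiplier B := fun h => ∑ k, S (h * k) * star (S k)
  have lam_mul_S : ∀ h k, lam h * S k = S (h * k) := by
    intro h k
    simp only [lam]
    rw [Finset.sum_mul, Finset.sum_eq_single k]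
    · rw [mul_assoc, hS, if_pos rfl, mul_one]
    · intro i _ hi
      rw [mul_assoc, hS, if_neg hi, mul_zero]
    · simp
  have ext_S : ∀ x y : Multiplier B, (∀ k, x * S k = y * S k) → x = y := by
    intro x y h
    rw [← mul_one x, ← mul_one y, ← hS1, Finset.mul_sum, Finset.mul_sum]
    exact Finset.sum_congr rfl fun k _ => by rw [← mul_assoc, h, mul_assoc]
  have lam_mul : ∀ g h, lam (g * h) = lam g * lam h := fun g h => ext_S _ _ fun k => by
    rw [mul_assoc, lam_mul_S, lam_mul_S, lam_mul_S, mul_assoc]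
  have lam_one : lam 1 = 1 := ext_S _ _ fun k => by rw [lam_mul_S]; simp
  have lam_star : ∀ h, star (lam h) = lam h⁻¹ := by
    intro h
    simp only [lam, star_sum, star_mul, star_star]
    rw [← Equiv.sum_comp (Equiv.mulLeft h) fun k => S (h⁻¹ * k) * star (S k)]
    simp
  let Λ : K →* unitary L.carrier :=
    { toFun h := ⟨L.c (lam h), by
        rw [Unitary.mem_iff, ← map_star, ← map_mul, ← map_mul, lam_star, ← lam_mul, ← lam_mul]
        simp [lam_one]⟩
      map_one' := Subtype.ext (by simp [lam_one])
      map_mul' g h := Subtype.ext (by simp [lam_mul]) }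
  let Φ' : A →⋆ₙₐ[ℂ] L.carrier := famHom (hS.map L.c) fun _ => Ψ
  have hΛ : ∀ h a, Commute (Λ h : L.carrier) (Φ' a) := by
    intro h a
    change L.c (lam h) * famSum (fun k => L.c (S k)) (fun _ => Ψ a)
      = famSum (fun k => L.c (S k)) (fun _ => Ψ a) * L.c (lam h)
    have e1 : L.c (lam h) * famSum (fun k => L.c (S k)) (fun _ => Ψ a)
        = ∑ k, L.c (S (h * k)) * Ψ a * star (L.c (S k)) := by
      rw [famSum, Finset.mul_sum]
      refine Finset.sum_congr rfl fun k _ => ?_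
      rw [← lam_mul_S, map_mul]; noncomm_ring
    have e2 : famSum (fun k => L.c (S k)) (fun _ => Ψ a) * L.c (lam h)
        = ∑ k, L.c (S (h * k)) * Ψ a * star (L.c (S k)) := by
      simp only [lam]
      rw [map_sum, Finset.mul_sum]
      refine Finset.sum_congr rfl fun k _ => ?_
      rw [map_mul, ← mul_assoc, famSum_mul_apply (hS.map L.c), map_star]
    rw [e1, e2]
  obtain ⟨Θ, hΘ⟩ := hmn.exists_hom Φ' Λ hΛ
  set w : Corona B := famSum s fun k => (U k : Corona B) with hw
  have hwu : w ∈ unitary (Corona B) := famSum_mem_unitary hsO (by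
    have := congrArg (coronaMk B) hS1
    simpa [map_sum, map_star] using this) fun k => (U k).2
  -- Conjugation requires only that `w ⊕ w*` lifts to a unitary. No commutation is asked for, so the
  -- set of elements is empty.
  obtain ⟨θ, W, hW, -, hpW, -⟩ := L.lift_unitary V ∅ Set.countable_empty w hwu (by simp)
  let Θ' : E →⋆ₙₐ[ℂ] L.carrier := conjHom W hW (famHom (V.isOrthoFamily.map L.c) fun _ => Θ)
  have hn0 : (Fintype.card K : ℝ) ≠ 0 := by exact_mod_cast Fintype.card_ne_zero
  -- The sum of the `S k` satisfies `star R * R = Fintype.card K`, so this factor makes it an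
  -- isometry.
  set r : ℝ := (√(Fintype.card K : ℝ))⁻¹ with hr
  have hr2 : r * r * Fintype.card K = 1 := by
    rw [hr, ← mul_inv, Real.mul_self_sqrt (by positivity), inv_mul_cancel₀ hn0]
  set R : Multiplier B := ∑ k, S k with hR
  have hRR : star R * R = (Fintype.card K : ℝ) • 1 := by
    rw [hR, star_sum, Finset.sum_mul]
    have : ∀ i, star (S i) * ∑ j, S j = 1 := by
      intro i
      rw [Finset.mul_sum]
      simp [hS i]
    simp only [this, Finset.sum_const, Finset.card_univ, Nat.cast_smul_eq_nsmul]
  refine ⟨(L.p : L.carrier →⋆ₙₐ[ℂ] Corona B).comp Θ', ⟨Θ', fun a => rfl⟩,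
    V.V₁ * ((r : ℂ) • R), ?_, fun h g => ?_⟩
  · have : star (V.V₁ * ((r : ℂ) • R)) * (V.V₁ * ((r : ℂ) • R))
        = ((r : ℂ) * (r : ℂ)) • (star R * (star V.V₁ * V.V₁) * R) := by
      simp only [star_mul, star_smul, smul_mul_assoc, mul_smul_comm, smul_smul, mul_assoc]
      simp
    rw [this, V.isometry₁, mul_one, hRR]
    rw [← Complex.coe_smul, smul_smul]
    have h3 : (r : ℂ) * r * ((Fintype.card K : ℝ) : ℂ) = 1 := by exact_mod_cast hr2
    rw [h3, one_smul]
  · have hstarw : star w = famSum s fun k => star (U k : Corona B) := star_famSum _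
    have e1 : star w * coronaMk B R = ∑ k, s k * star (U k : Corona B) := by
      rw [hstarw, hR, map_sum, Finset.mul_sum]
      exact Finset.sum_congr rfl fun k _ => famSum_mul_apply hsO _ k
    have e2 : L.p (Θ (n.ι (h, g))) = coronaMk B (lam h) * famSum s fun _ => Φ (m.ι g) := by
      rw [hΘ, map_mul, famHom_comp_lift hS, hΨ]
      change L.p (L.c (lam h)) * _ = _
      rw [L.p_c]
    have e3 : w * (L.p (Θ (n.ι (h, g))) * (star w * coronaMk B R))
        = coronaMk B R * ((U h : Corona B) * Φ (m.ι g)) := by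
      rw [e1, e2, Finset.mul_sum, Finset.mul_sum]
      have : ∀ k, w * (coronaMk B (lam h) * famSum s (fun _ => Φ (m.ι g))
          * (s k * star (U k : Corona B)))
          = s (h * k) * ((U h : Corona B) * Φ (m.ι g)) := by
        intro k
        rw [← mul_assoc (_ * _) (s k), mul_assoc _ _ (s k), famSum_mul_apply hsO,
          ← mul_assoc (coronaMk B (lam h)), hs, ← map_mul, lam_mul_S]
        have e4 : w * (s (h * k) * Φ (m.ι g) * star (U k : Corona B))
          = w * s (h * k) * Φ (m.ι g) * star (U k : Corona B) := by noncomm_ring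
        have e5 : w * s (h * k) = s (h * k) * (U (h * k) : Corona B) := famSum_mul_apply hsO _ _
        refine e4.trans ?_
        rw [e5, map_mul, mul_assoc _ _ (Φ (m.ι g)), Submonoid.coe_mul]
        have e6 : (U k : Corona B) * Φ (m.ι g) * star (U k : Corona B) = Φ (m.ι g) := by
          rw [(hU k _).eq, mul_assoc, Unitary.mul_star_self_of_mem (U k).2, mul_one]
        calc _ = s (h * k) * ((U h : Corona B) * ((U k : Corona B) * Φ (m.ι g)
              * star (U k : Corona B))) := by noncomm_ring
          _ = _ := by rw [e6]
      simp only [this]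
      rw [← Finset.sum_mul, hR, map_sum]
      congr 1
      exact Equiv.sum_comp (Equiv.mulLeft h) s
    have e7 : L.p (Θ' (n.ι (h, g))) * coronaMk B V.V₁
        = coronaMk B V.V₁ * (w * L.p (Θ (n.ι (h, g))) * star w) := by
      change L.p (W * famHom (V.isOrthoFamily.map L.c) (fun _ => Θ) (n.ι (h, g)) * star W) * _ = _
      have hv : (fun i => star ((![w, star w] : Fin 2 → Corona B) i))
          = ![star w, star (star w)] := by
        ext i; fin_cases i <;> rfl
      have hstarW : star (famSum (fun i => coronaMk B (V.fam i)) ![w, star w])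
          = famSum (fun i => coronaMk B (V.fam i)) ![star w, star (star w)] := by
        rw [← hv]; exact star_famSum _
      rw [map_mul, map_mul, map_star, famHom_comp_lift V.isOrthoFamily, hpW, hstarW, mul_assoc]
      rw [famSum_unitary_mul_V₁, mul_assoc, ← mul_assoc _ (coronaMk B V.V₁),
        famSum_const_mul_V₁, mul_assoc (coronaMk B V.V₁), ← mul_assoc _ (coronaMk B V.V₁),
        famSum_unitary_mul_V₁]
      noncomm_ring
    change L.p (Θ' (n.ι (h, g))) * _ = _
    rw [map_mul, map_smul, mul_smul_comm, mul_smul_comm, smul_mul_assoc, ← mul_assoc, e7]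
    congr 1
    rw [mul_assoc, mul_assoc _ _ (coronaMk B R), mul_assoc w, e3, mul_assoc]

/-- If all extensions of the algebra of `G` are invertible, so are those of the algebra of
`K × G`. -/
theorem Dilates.invertible (hK : Dilates K m n L) (hmn : IsProductModel m n)
    (hA : ∀ φ : Extension A B, L.Invertible φ) (φ : Extension E B) : L.Invertible φ := by
  obtain ⟨j, hj⟩ := hmn.restrict
  obtain ⟨V, ψ, hL⟩ := hA (φ.comp j)
  set Φ := extensionSum V (φ.comp j) ψ with hΦ
  set v := fun i => coronaMk B (V.fam i) with hv
  have hvO : IsOrthoFamily v := V.isOrthoFamily.map (coronaMk B)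
  have hv1 : ∑ i, v i * star (v i) = 1 := by
    have := congrArg (coronaMk B) V.sum_fam
    simpa [map_sum, map_star] using this
  set q : K → Corona B := fun k => φ (n.ι (k, 1)) with hq
  have q_mul : ∀ k l, q (k * l) = q k * q l := fun k l => by
    simp [hq, ← map_mul, ← n.map_mul]
  have q_star : ∀ k, star (q k) = q k⁻¹ := fun k => by
    simp [hq, ← map_star, n.map_star]
  -- `φ` need not be unital: `q k` is a unitary only in the corner of the projection `q 1`, and is
  -- completed by the identity outside it.
  let U₀ : K → Corona B := fun k => q k + (1 - q 1)
  have U₀_mul : ∀ k l, U₀ (k * l) = U₀ k * U₀ l := by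
    intro k l
    have e : U₀ k * U₀ l = q k * q l + q k - q k * q 1 + q l - q 1 * q l
      + (1 - q 1 - q 1 + q 1 * q 1) := by simp only [U₀]; noncomm_ring
    rw [e, ← q_mul, ← q_mul, ← q_mul, ← q_mul, mul_one, one_mul, one_mul]
    simp only [U₀]; abel
  have U₀_star : ∀ k, star (U₀ k) = U₀ k⁻¹ := by
    intro k
    simp [U₀, q_star]
  have U₀_one : U₀ 1 = 1 := by simp [U₀]
  have hU₀ : ∀ k, U₀ k ∈ unitary (Corona B) := by
    intro k
    rw [Unitary.mem_iff, U₀_star, ← U₀_mul, ← U₀_mul]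
    simp [U₀_one]
  have hvec : ∀ k, ∀ i, (![U₀ k, 1] : Fin 2 → Corona B) i ∈ unitary (Corona B) := by
    intro k i
    fin_cases i
    · exact hU₀ k
    · exact one_mem _
  -- On the added summand `ψ` the group `K` acts trivially, so the unitaries commute with the whole
  -- of `Φ`.
  let U : K →* unitary (Corona B) :=
    { toFun k := ⟨famSum v ![U₀ k, 1], famSum_mem_unitary hvO hv1 (hvec k)⟩
      map_one' := Subtype.ext (by
        change famSum v ![U₀ 1, 1] = 1
        rw [U₀_one]
        refine Eq.trans ?_ (famSum_one hv1)
        congr 1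
        ext i; fin_cases i <;> rfl)
      map_mul' k l := Subtype.ext (by
        change famSum v ![U₀ (k * l), 1] = famSum v ![U₀ k, 1] * famSum v ![U₀ l, 1]
        rw [famSum_mul hvO, U₀_mul]
        congr 1
        ext i; fin_cases i <;> simp) }
  have hφ : ∀ k g, U₀ k * φ (n.ι (1, g)) = φ (n.ι (k, g)) := by
    intro k g
    simp only [U₀, hq]
    rw [add_mul, sub_mul, ← map_mul, ← map_mul, ← n.map_mul, ← n.map_mul]
    simp
  have hφ' : ∀ k g, φ (n.ι (1, g)) * U₀ k = φ (n.ι (k, g)) := by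
    intro k g
    simp only [U₀, hq]
    rw [mul_add, mul_sub, ← map_mul, ← map_mul, ← n.map_mul, ← n.map_mul]
    simp
  have hΦι : ∀ g, Φ (m.ι g) = famSum v ![φ (n.ι (1, g)), ψ (m.ι g)] := by
    intro g
    rw [hΦ, extensionSum_apply, ← hj]; rfl
  have hU : ∀ k a, Commute (U k : Corona B) (Φ a) := by
    intro k
    refine m.commute_of_forall Φ _ fun g => ?_
    change famSum v ![U₀ k, 1] * Φ (m.ι g) = Φ (m.ι g) * famSum v ![U₀ k, 1]
    rw [hΦι, famSum_mul hvO, famSum_mul hvO]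
    congr 1
    ext i; fin_cases i <;> simp [hφ, hφ']
  obtain ⟨T, hT, S, hS, hTS⟩ := hK V Φ hL U hU
  -- `φ` sits inside `T` in two stages: as the first summand of the twisted `Φ`, and then through
  -- the dilating isometry `S`.
  refine L.invertible_of_summand V hT (S * V.V₁) ?_ ?_
  · rw [star_mul, mul_assoc, ← mul_assoc (star S), hS, one_mul, V.isometry₁]
  · intro a
    refine n.induction (p := fun a => T a * coronaMk B (S * V.V₁) = coronaMk B (S * V.V₁) * φ a)
      ?_ ?_ (by simp) ?_ ?_ a
    · have h1 := continuous_starHom T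
      have h2 := continuous_starHom φ
      exact isClosed_eq (by fun_prop) (by fun_prop)
    · rintro ⟨k, g⟩
      have key : (U k : Corona B) * Φ (m.ι g) * coronaMk B V.V₁
          = coronaMk B V.V₁ * φ (n.ι (k, g)) := by
        change famSum v ![U₀ k, 1] * Φ (m.ι g) * v 0 = _
        rw [hΦι, famSum_mul hvO, famSum_mul_apply hvO]
        simp [hφ, hv, IsometryPair.fam]
      rw [map_mul, ← mul_assoc, hTS, mul_assoc, key, ← mul_assoc]
    · intro a b ha hb; simp only [map_add, add_mul, mul_add, ha, hb]
    · intro c a ha; simp only [map_smul, smul_mul_assoc, mul_smul_comm, ha]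

end Step

/-! ### Quasicentral approximate units -/

section Quasicentral

attribute [local instance] CStarAlgebra.spectralOrder CStarAlgebra.spectralOrderedRing

open Filter Topology

/-- Row contractions with entries `e` and `1 - e`. -/
theorem norm_mul_add_one_sub_mul_le {D : Type*} [CStarAlgebra D] {e : D} (h0 : 0 ≤ e)
    (h1 : e ≤ 1) (a b : D) :
    ‖e * b + (1 - e) * a‖ ≤ √(‖b‖ ^ 2 + ‖a‖ ^ 2) := by
  have hs : star e = e := (IsSelfAdjoint.of_nonneg h0).star_eq
  set s : D := 1 - e
  have hs' : star s = s := by simp [s, hs]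
  have key : star (e * b + s * a) * (e * b + s * a) ≤ star b * b + star a * a := by
    have hc : e * s = s * e := by simp [s, mul_sub, sub_mul]
    have hes : 0 ≤ e * s := by
      have hcomm : Commute e s := hc
      exact hcomm.mul_nonneg h0 (sub_nonneg.2 h1)
    have e1 : star b * b + star a * a - star (e * b + s * a) * (e * b + s * a)
        = star (b - a) * (e * s) * (b - a) + star b * s * b + star a * e * a := by
      simp only [star_add, star_mul, hs, hs', star_sub]
      have : s * e = e * s := hc.symm
      simp only [s]
      noncomm_ring
    rw [← sub_nonneg, e1]
    exact add_nonneg (add_nonneg (star_left_conjugate_nonneg hes _)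
      (star_left_conjugate_nonneg (sub_nonneg.2 h1) _)) (star_left_conjugate_nonneg h0 _)
  refine Real.le_sqrt_of_sq_le ?_
  calc _ = ‖star (e * b + s * a) * (e * b + s * a)‖ := by rw [CStarRing.norm_star_mul_self, sq]
    _ ≤ ‖star b * b + star a * a‖ :=
        CStarAlgebra.norm_le_norm_of_nonneg_of_le (star_mul_self_nonneg _) key
    _ ≤ ‖star b * b‖ + ‖star a * a‖ := norm_add_le _ _
    _ = _ := by rw [CStarRing.norm_star_mul_self, CStarRing.norm_star_mul_self, sq, sq]

variable {B : Type w} [NonUnitalCStarAlgebra B]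

theorem toMult_nonneg {e : B} (h0 : 0 ≤ e) : 0 ≤ toMult B e := map_nonneg (toMult B) h0

theorem toMult_le_one {e : B} (h0 : 0 ≤ e) (h1 : ‖e‖ ≤ 1) : toMult B e ≤ 1 := by
  rw [← CStarAlgebra.norm_le_one_iff_of_nonneg _ (toMult_nonneg h0), norm_toMult]
  exact h1

/-- Let `f` almost attain its norm at `b`, hence also at `e * b` for late `e`. Adding `τ • (a - e *
a)` increases the norm bound only to second order in `τ`, by `norm_mul_add_one_sub_mul_le`, whereas
`f` changes to first order; so `f (a - e * a)` is small. Uniformity in `a` matters, since `a` will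
later depend on `e`. -/
theorem eventually_apply_sub_mul_le (f : StrongDual ℝ B) {ε : ℝ} (hε : 0 < ε) :
    ∀ᶠ e in CStarAlgebra.approximateUnit B, ∀ a : B, ‖a‖ ≤ 1 → f (a - e * a) ≤ ε := by
  have hl := CStarAlgebra.increasingApproximateUnit B
  -- The final error is `‖f‖ * τ ^ 2 / 2 + 2 * δ`, and each of its two terms is at most `ε * τ / 2`.
  set τ : ℝ := ε / (‖f‖ + 1) with hτ
  have hf : 0 ≤ ‖f‖ := norm_nonneg f
  have hτ0 : 0 < τ := by positivity
  set δ : ℝ := ε * τ / 4 with hδ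
  have hδ0 : 0 < δ := by positivity
  obtain ⟨b, hb1, hb⟩ : ∃ b : B, ‖b‖ ≤ 1 ∧ ‖f‖ - δ ≤ f b := by
    rcases hf.eq_or_lt with h0 | h0
    · exact ⟨0, by simp, by rw [← h0, map_zero]; linarith⟩
    · obtain ⟨b, hb1, hb⟩ := f.exists_lt_apply_of_lt_opNorm (sub_lt_self ‖f‖ hδ0)
      rw [Real.norm_eq_abs, lt_abs] at hb
      rcases hb with hb | hb
      · exact ⟨b, hb1.le, hb.le⟩
      · exact ⟨-b, by rw [norm_neg]; exact hb1.le, by rw [map_neg]; exact hb.le⟩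
  have hlim : Tendsto (fun e => f (e * b)) (CStarAlgebra.approximateUnit B) (𝓝 (f b)) :=
    (f.continuous.tendsto b).comp (hl.tendsto_mul_right b)
  filter_upwards [hlim.eventually (lt_mem_nhds (sub_lt_self (f b) hδ0)), hl.eventually_nonneg,
    hl.eventually_norm] with e he h0 h1 a ha
  have h2 : ‖e * b + τ • (a - e * a)‖ ≤ 1 + τ ^ 2 / 2 := by
    have h := norm_mul_add_one_sub_mul_le (toMult_nonneg h0) (toMult_le_one h0 h1)
      (toMult B (τ • a)) (toMult B b)
    have e1 : toMult B e * toMult B b + (1 - toMult B e) * toMult B (τ • a)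
        = toMult B (e * b + τ • (a - e * a)) := by
      rw [sub_mul, one_mul, ← map_mul, ← map_mul, ← map_sub, ← map_add, mul_smul_comm, smul_sub]
    rw [e1, norm_toMult, norm_toMult, norm_toMult, norm_smul, Real.norm_of_nonneg hτ0.le] at h
    refine h.trans ?_
    rw [Real.sqrt_le_left (by positivity)]
    have hb2 : ‖b‖ ^ 2 ≤ 1 := pow_le_one₀ (norm_nonneg _) hb1
    have ha2 : (τ * ‖a‖) ^ 2 ≤ τ ^ 2 := by
      gcongr
      exact mul_le_of_le_one_right hτ0.le ha
    nlinarith [sq_nonneg (τ ^ 2)]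
  have h3 : f (e * b) + τ * f (a - e * a) ≤ ‖f‖ * (1 + τ ^ 2 / 2) := by
    have : f (e * b + τ • (a - e * a)) = f (e * b) + τ * f (a - e * a) := by
      rw [map_add, map_smul, smul_eq_mul]
    rw [← this]
    exact (le_abs_self _).trans ((f.le_opNorm _).trans (by gcongr))
  have h4 : τ * f (a - e * a) ≤ τ * ε := by
    have h5 : τ * f (a - e * a) ≤ ‖f‖ * τ ^ 2 / 2 + 2 * δ := by linarith
    have h6 : ‖f‖ * τ ≤ ε := by
      rw [hτ, mul_div_assoc', div_le_iff₀ (by positivity)]; nlinarith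
    have h7 : ‖f‖ * τ ^ 2 ≤ ε * τ := by rw [sq, ← mul_assoc]; gcongr
    rw [hδ] at h5
    linarith
  exact le_of_mul_le_mul_left h4 hτ0

theorem toMult_fst (x : Multiplier B) (b : B) : toMult B (x.fst b) = x * toMult B b := by
  have h : ∀ y z : B, x.fst (y * z) = x.fst y * z := by
    intro y z
    have key : ∀ c : B, c * (x.fst (y * z) - x.fst y * z) = 0 := by
      intro c
      rw [mul_sub, ← x.central c (y * z), ← mul_assoc c, ← x.central c y, mul_assoc, sub_self]
    exact sub_eq_zero.mp (CStarRing.star_mul_self_eq_zero_iff _ |>.mp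
      (key (star (x.fst (y * z) - x.fst y * z))))
  refine DoubleCentralizer.ext ℂ B _ _ (Prod.ext ?_ ?_)
  · ext y
    simp [h]
  · ext y
    simp [x.central]

theorem toMult_snd (x : Multiplier B) (b : B) : toMult B (x.snd b) = toMult B b * x := by
  have h := congrArg star (toMult_fst (star x) (star b))
  rw [DoubleCentralizer.star_fst, star_star, star_mul, star_star, map_star, star_star,
    map_star, star_star] at h
  exact h

/-- The commutator with a multiplier. -/
def commutatorCLM (x : Multiplier B) : B →L[ℂ] B := x.snd - x.fst

theorem toMult_commutatorCLM (x : Multiplier B) (b : B) :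
    toMult B (commutatorCLM x b) = toMult B b * x - x * toMult B b := by
  rw [← toMult_fst, ← toMult_snd, ← map_sub]
  rfl

/-- Write e x - x e = (e x - e x e) - (x e - e x e). Both brackets are small under `f` by the
uniform estimate, the second with a = x e and the first, after taking adjoints, with a = (e x)*. -/
theorem eventually_apply_commutator_le (f : StrongDual ℝ B) (x : Multiplier B) {ε : ℝ}
    (hε : 0 < ε) :
    ∀ᶠ e in CStarAlgebra.approximateUnit B, f (commutatorCLM x e) ≤ ε := by
  have hl := CStarAlgebra.increasingApproximateUnit B
  set c : ℝ := ‖x‖ + 1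
  have hc : 0 < c := by positivity
  let g : StrongDual ℝ B := f.comp ((starL' ℝ : B ≃L[ℝ] B) : B →L[ℝ] B)
  filter_upwards [eventually_apply_sub_mul_le (-(c • f)) (half_pos hε),
    eventually_apply_sub_mul_le (c • g) (half_pos hε), hl.eventually_nonneg,
    hl.eventually_norm] with e h1 h2 h0 hn
  have hs : star e = e := (IsSelfAdjoint.of_nonneg h0).star_eq
  have hxe : ‖x.fst e‖ ≤ c := by
    rw [← norm_toMult, toMult_fst]
    refine (norm_mul_le _ _).trans ?_
    rw [norm_toMult]
    nlinarith [norm_nonneg x]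
  have hex : ‖star (x.snd e)‖ ≤ c := by
    rw [norm_star, ← norm_toMult, toMult_snd]
    refine (norm_mul_le _ _).trans ?_
    rw [norm_toMult]
    nlinarith [norm_nonneg x]
  have h3 := h1 (c⁻¹ • x.fst e) (by
    rw [norm_smul, norm_inv, Real.norm_of_nonneg hc.le, inv_mul_le_iff₀ hc, mul_one]; exact hxe)
  have h4 := h2 (c⁻¹ • star (x.snd e)) (by
    rw [norm_smul, norm_inv, Real.norm_of_nonneg hc.le, inv_mul_le_iff₀ hc, mul_one]; exact hex)
  have e3 : (-(c • f)) (c⁻¹ • x.fst e - e * c⁻¹ • x.fst e) = - f (x.fst e - e * x.fst e) := by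
    rw [mul_smul_comm, ← smul_sub, neg_apply, smul_apply,
      map_smul, smul_smul, mul_inv_cancel₀ hc.ne', one_smul]
  have e4 : (c • g) (c⁻¹ • star (x.snd e) - e * c⁻¹ • star (x.snd e))
      = f (x.snd e - x.snd e * e) := by
    rw [mul_smul_comm, ← smul_sub, smul_apply,
      map_smul, smul_smul, mul_inv_cancel₀ hc.ne', one_smul]
    change f (star (star (x.snd e) - e * star (x.snd e))) = _
    rw [star_sub, star_mul, star_star, hs]
  rw [e3] at h3
  rw [e4] at h4
  have e5 : commutatorCLM x e = (x.snd e - x.snd e * e) - (x.fst e - e * x.fst e) := by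
    change x.snd e - x.fst e = _
    rw [x.central]
    abel
  rw [e5, map_sub]
  linarith

/-- Quasicentral approximate units. -/
theorem exists_quasicentral (X : Finset (Multiplier B)) (Y : Finset B) {ε : ℝ} (hε : 0 < ε) :
    ∃ e : B, 0 ≤ e ∧ ‖e‖ ≤ 1 ∧ (∀ y ∈ Y, ‖e * y - y‖ ≤ ε) ∧
      ∀ x ∈ X, ‖toMult B e * x - x * toMult B e‖ < ε := by
  have hl := CStarAlgebra.increasingApproximateUnit B
  classical
  let C : Set B := {e | 0 ≤ e ∧ ‖e‖ ≤ 1 ∧ ∀ y ∈ Y, ‖e * y - y‖ ≤ ε}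
  have hC : Convex ℝ C := by
    intro a ha b hb s t hs ht hst
    refine ⟨add_nonneg (smul_nonneg hs ha.1) (smul_nonneg ht hb.1), ?_, fun y hy => ?_⟩
    · exact mem_closedBall_zero_iff.1 (convex_closedBall (0 : B) 1
        (mem_closedBall_zero_iff.2 ha.2.1) (mem_closedBall_zero_iff.2 hb.2.1) hs ht hst)
    · have h := convex_closedBall y ε (x := a * y) (y := b * y)
        (mem_closedBall_iff_norm.2 (ha.2.2 y hy)) (mem_closedBall_iff_norm.2 (hb.2.2 y hy))
        hs ht hst
      rw [mem_closedBall_iff_norm] at h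
      simpa only [add_mul, smul_mul_assoc] using h
  have hev : ∀ᶠ e in CStarAlgebra.approximateUnit B, e ∈ C := by
    have hY : ∀ᶠ e in CStarAlgebra.approximateUnit B, ∀ y ∈ Y, ‖e * y - y‖ ≤ ε := by
      rw [Filter.eventually_all_finset]
      intro y _
      filter_upwards [Metric.tendsto_nhds.1 (hl.tendsto_mul_right y) ε hε] with e he
      rw [← dist_eq_norm]
      exact he.le
    filter_upwards [hl.eventually_nonneg, hl.eventually_norm, hY] with e h0 h1 h2
    exact ⟨h0, h1, h2⟩
  let T : B →L[ℝ] (X → B) := ContinuousLinearMap.pi fun x => (commutatorCLM x.1).restrictScalars ℝ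
  -- The admissible `e` form a convex set, so if their commutator tuples stayed away from 0, a
  -- functional would be bounded below on them by some `u > 0`. Along the approximate unit it is
  -- eventually at most `u`, a contradiction.
  have hcl : (0 : X → B) ∈ closure (T '' C) := by
    by_contra h
    obtain ⟨f, u, hf0, hf⟩ := geometric_hahn_banach_point_closed
      (hC.linear_image (T : B →ₗ[ℝ] (X → B))).closure isClosed_closure h
    rw [map_zero] at hf0
    have hsum : ∀ᶠ e in CStarAlgebra.approximateUnit B, f (T e) ≤ u := by
      have hx : ∀ x : X, ∀ᶠ e in CStarAlgebra.approximateUnit B,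
          f (Pi.single x (T e x)) ≤ u / (X.card + 1) := fun x =>
        eventually_apply_commutator_le
          (f.comp (ContinuousLinearMap.single ℝ (fun _ : X => B) x)) x.1 (by positivity)
      filter_upwards [Filter.eventually_all.2 hx] with e he
      calc f (T e) = ∑ x, f (Pi.single x (T e x)) := by
            rw [← map_sum, Finset.univ_sum_single]
        _ ≤ ∑ _x : X, u / (X.card + 1) := Finset.sum_le_sum fun x _ => he x
        _ = X.card * (u / (X.card + 1)) := by simp
        _ ≤ u := by
            rw [mul_div_assoc', div_le_iff₀ (by positivity)]
            nlinarith
    obtain ⟨e, he, heC⟩ := (hsum.and hev).exists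
    exact absurd (hf _ (subset_closure ⟨e, heC, rfl⟩)) (not_lt.2 he)
  obtain ⟨_, ⟨e, heC, rfl⟩, he⟩ := Metric.mem_closure_iff.1 hcl ε hε
  refine ⟨e, heC.1, heC.2.1, heC.2.2, fun x hx => ?_⟩
  rw [dist_zero_left, pi_norm_lt_iff hε] at he
  rw [← toMult_commutatorCLM, norm_toMult]
  exact he ⟨x, hx⟩

end Quasicentral

/-! ### Matrices along orthogonal isometries -/

section FamMat

variable {D : Type*} [CStarAlgebra D] {ι : Type*} [Fintype ι] {S : ι → D}

/-- The element with matrix entries `X i j` with respect to a family of isometries. -/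
def famMat (S : ι → D) (X : Matrix ι ι D) : D := ∑ i, ∑ j, S i * X i j * star (S j)

theorem star_famMat (X : Matrix ι ι D) : star (famMat S X) = famMat S (star X) := by
  rw [famMat, famMat, Finset.sum_comm]
  simp [Matrix.star_apply, mul_assoc]

theorem map_famMat {D' : Type*} [CStarAlgebra D'] (f : D →⋆ₐ[ℂ] D') (X : Matrix ι ι D) :
    f (famMat S X) = famMat (fun i => f (S i)) (X.map f) := by
  simp [famMat, map_star]

variable [DecidableEq ι]

theorem famMat_diagonal (x : ι → D) : famMat S (Matrix.diagonal x) = famSum S x := by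
  refine Finset.sum_congr rfl fun i _ => ?_
  rw [Finset.sum_eq_single i (fun j _ hj => by simp [Matrix.diagonal_apply_ne _ hj.symm]) (by simp)]
  simp

theorem famMat_mul (hS : IsOrthoFamily S) (X Y : Matrix ι ι D) :
    famMat S X * famMat S Y = famMat S (X * Y) := by
  have h : ∀ i, (∑ j, S i * X i j * star (S j)) * famMat S Y
      = ∑ k, ∑ j, S i * (X i j * Y j k) * star (S k) := by
    intro i
    rw [Finset.sum_comm, Finset.sum_mul]
    refine Finset.sum_congr rfl fun j _ => ?_
    rw [famMat, Finset.mul_sum, Finset.sum_eq_single j, Finset.mul_sum]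
    · refine Finset.sum_congr rfl fun k _ => ?_
      have e : S i * X i j * star (S j) * (S j * Y j k * star (S k))
        = S i * X i j * (star (S j) * S j) * Y j k * star (S k) := by noncomm_ring
      rw [e, hS, if_pos rfl, mul_one]
      noncomm_ring
    · intro l _ hl
      rw [Finset.mul_sum]
      refine Finset.sum_eq_zero fun k _ => ?_
      have e : S i * X i j * star (S j) * (S l * Y l k * star (S k))
        = S i * X i j * (star (S j) * S l) * Y l k * star (S k) := by noncomm_ring
      rw [e, hS, if_neg hl.symm]
      simp
    · simp
  rw [famMat, Finset.sum_mul]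
  refine Finset.sum_congr rfl fun i _ => ?_
  rw [h]
  refine Finset.sum_congr rfl fun k _ => ?_
  rw [Matrix.mul_apply, Finset.mul_sum, Finset.sum_mul]

theorem famMat_one (h1 : ∑ i, S i * star (S i) = 1) : famMat S 1 = 1 := by
  rw [← Matrix.diagonal_one, famMat_diagonal]
  exact famSum_one h1

theorem famMat_mem_unitary (hS : IsOrthoFamily S) (h1 : ∑ i, S i * star (S i) = 1)
    {X : Matrix ι ι D} (hX : star X * X = 1) (hX' : X * star X = 1) :
    famMat S X ∈ unitary D := by
  rw [Unitary.mem_iff, star_famMat, famMat_mul hS, famMat_mul hS, hX, hX', famMat_one h1]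
  exact ⟨rfl, rfl⟩

theorem commute_famMat (hS : IsOrthoFamily S) {X : Matrix ι ι D} {z : D}
    (hz : ∀ i j, Commute (X i j) z) : Commute (famMat S X) (famSum S fun _ => z) := by
  rw [← famMat_diagonal, Commute, SemiconjBy, famMat_mul hS, famMat_mul hS]
  congr 1
  ext i j
  simpa using! hz i j

end FamMat

/-! ### The rotation from x ⊕ x* to 1 -/

section Rotation

variable {D : Type*} [CStarAlgebra D] {x s c : D}

/-- The rotation formula joining `x ⊕ x*` (at `s = 0`, `c = 1`) to `1` (at `s = 1`, `c = 0`). -/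
def rotation (x s c : D) : Matrix (Fin 2) (Fin 2) D :=
  !![s * s + c * c * x, s * c * (x - 1); s * c * (1 - star x), s * s + c * c * star x]

theorem star_rotation (hs : star s = s) (hc : star c = c) (hsc : c * s = s * c)
    (hsx : x * s = s * x) (hcx : x * c = c * x) (hsy : star x * s = s * star x)
    (hcy : star x * c = c * star x) :
    star (rotation x s c)
      = !![s * s + c * c * star x, s * c * (1 - x); s * c * (star x - 1), s * s + c * c * x] := by
  have e : ∀ z, z * s = s * z → z * c = c * z → z * (s * c) = s * c * z := fun z h1 h2 => by
    rw [← mul_assoc, h1, mul_assoc, h2, ← mul_assoc]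
  have e' : ∀ z, z * c = c * z → z * (c * c) = c * c * z := fun z h2 => by
    rw [← mul_assoc, h2, mul_assoc, h2, ← mul_assoc]
  ext i j
  fin_cases i <;> fin_cases j <;>
    simp [rotation, Matrix.star_apply, hs, hc, mul_sub, hsc, e _ hsx hcx, e _ hsy hcy,
      e' _ hcx, e' _ hcy]

/-- For unitary `x` the matrix is diag(1, x*) ρ diag(x, 1) ρ*, with ρ the rotation of entries `c`
and `s`. The entries are written so that in both products every `star x * x` or `x * star x` carries
a factor `c`; hence `x` need only be unitary where `c` does not vanish. -/
theorem star_mul_self_rotation (hs : star s = s) (hc : star c = c) (hsc : c * s = s * c)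
    (hsx : x * s = s * x) (hcx : x * c = c * x) (h1 : s * s + c * c = 1)
    (hu : c * (star x * x) = c) (hu' : c * (x * star x) = c) :
    star (rotation x s c) * rotation x s c = 1 ∧ rotation x s c * star (rotation x s c) = 1 := by
  have hsy : star x * s = s * star x := by simpa [hs] using (congrArg star hsx).symm
  have hcy : star x * c = c * star x := by simpa [hc] using (congrArg star hcx).symm
  have hsc' : ∀ z, c * (s * z) = s * (c * z) := fun z => by rw [← mul_assoc, hsc, mul_assoc]
  have hsx' : ∀ z, x * (s * z) = s * (x * z) := fun z => by rw [← mul_assoc, hsx, mul_assoc]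
  have hcx' : ∀ z, x * (c * z) = c * (x * z) := fun z => by rw [← mul_assoc, hcx, mul_assoc]
  have hsy' : ∀ z, star x * (s * z) = s * (star x * z) := fun z => by
    rw [← mul_assoc, hsy, mul_assoc]
  have hcy' : ∀ z, star x * (c * z) = c * (star x * z) := fun z => by
    rw [← mul_assoc, hcy, mul_assoc]
  have hcc : c * c = 1 - s * s := eq_sub_of_add_eq' h1
  have hcc' : ∀ z, c * (c * z) = z - s * (s * z) := fun z => by
    rw [← mul_assoc, hcc, sub_mul, one_mul, mul_assoc]
  rw [star_rotation hs hc hsc hsx hcx hsy hcy]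
  constructor <;> ext i j <;> fin_cases i <;> fin_cases j <;>
    simp only [rotation, Matrix.mul_apply, Fin.sum_univ_two, mul_add, add_mul, mul_sub, sub_mul,
      hsc, hcy, hcx, hsy, hsx, hsx', hcx', hsy', hcy', mul_assoc, hsc', hu, hu', mul_one,
      Matrix.of_apply, Matrix.cons_val', Matrix.cons_val_zero, Matrix.cons_val_one,
      Matrix.cons_val_fin_one, Fin.zero_eta, Fin.mk_one, Matrix.one_apply_eq, ne_eq,
      Matrix.one_apply_ne, zero_ne_one, one_ne_zero, not_false_eq_true, Fin.isValue] <;>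
    simp only [hcc, hcc', mul_sub, mul_one] <;> abel

/-- Each occurrence of `x` in the entries is multiplied by `c`, so commutation after multiplication
by `c` is enough. -/
theorem commute_rotation {z : D} (hs : Commute s z) (hc : Commute c z)
    (hx : c * (x * z) = c * (z * x)) (hy : c * (star x * z) = c * (z * star x)) (i j : Fin 2) :
    Commute (rotation x s c i j) z := by
  have hxc : Commute (c * x) z := by
    rw [Commute, SemiconjBy, mul_assoc, hx, ← mul_assoc, hc.eq, mul_assoc]
  have hyc : Commute (c * star x) z := by
    rw [Commute, SemiconjBy, mul_assoc, hy, ← mul_assoc, hc.eq, mul_assoc]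
  have h00 : Commute (s * s + c * c * x) z := by
    rw [mul_assoc c]
    exact (hs.mul_left hs).add_left (hc.mul_left hxc)
  have h01 : Commute (s * c * (x - 1)) z := by
    rw [mul_assoc, mul_sub, mul_one]
    exact hs.mul_left (hxc.sub_left hc)
  have h10 : Commute (s * c * (1 - star x)) z := by
    rw [mul_assoc, mul_sub, mul_one]
    exact hs.mul_left (hc.sub_left hyc)
  have h11 : Commute (s * s + c * c * star x) z := by
    rw [mul_assoc c]
    exact (hs.mul_left hs).add_left (hc.mul_left hyc)
  fin_cases i <;> fin_cases j
  exacts [h00, h01, h10, h11]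

theorem rotation_zero_one : rotation x 0 1 = Matrix.diagonal ![x, star x] := by
  ext i j
  fin_cases i <;> fin_cases j <;> simp [rotation]

theorem rotation_one_zero : rotation x 1 0 = 1 := by
  ext i j
  fin_cases i <;> fin_cases j <;> simp [rotation]

theorem map_rotation {D' : Type*} [CStarAlgebra D'] (f : D →⋆ₐ[ℂ] D') :
    (rotation x s c).map f = rotation (f x) (f s) (f c) := by
  ext i j
  fin_cases i <;> fin_cases j <;> simp [rotation, map_star]

end Rotation

/-! ### The lifting algebra of paths -/

section StrongHomotopy

variable (B : Type w) [NonUnitalCStarAlgebra B]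

/-- Evaluation of a path. -/
def evalPath (D : Type*) [CStarAlgebra D] (t : unitInterval) : C(unitInterval, D) →⋆ₐ[ℂ] D where
  toFun f := f t
  map_one' := rfl
  map_mul' _ _ := rfl
  map_zero' := rfl
  map_add' _ _ := rfl
  commutes' _ := rfl
  map_star' _ := rfl

/-- Constant paths. -/
def constPath (D : Type*) [CStarAlgebra D] : D →⋆ₐ[ℂ] C(unitInterval, D) where
  toFun := ContinuousMap.const _
  map_one' := rfl
  map_mul' _ _ := rfl
  map_zero' := rfl
  map_add' _ _ := rfl
  commutes' _ := rfl
  map_star' _ := rfl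

/-- Pairs of a path in `Q(B)` and a lift of its end point. -/
def pathAlgebra : StarSubalgebra ℂ (C(unitInterval, Corona B) × Multiplier B) :=
  StarAlgHom.equalizer ((evalPath (Corona B) 1).comp (StarAlgHom.fst ℂ _ _))
    ((coronaMk B).comp (StarAlgHom.snd ℂ _ _))

variable {B}

theorem mem_pathAlgebra {x : C(unitInterval, Corona B) × Multiplier B} :
    x ∈ pathAlgebra B ↔ x.1 1 = coronaMk B x.2 := Iff.rfl

instance : IsClosed (pathAlgebra B : Set (C(unitInterval, Corona B) × Multiplier B)) :=
  isClosed_eq ((continuous_eval_const (1 : unitInterval)).comp continuous_fst)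
    ((continuous_starHom (coronaMk B : Multiplier B →⋆ₙₐ[ℂ] Corona B)).comp continuous_snd)

/-- Constant on the first half of the interval, then the identity at double speed. -/
def secondHalf : C(unitInterval, unitInterval) :=
  ⟨fun t => Set.projIcc 0 1 zero_le_one (2 * (t : ℝ) - 1), by fun_prop⟩

theorem secondHalf_of_le {t : unitInterval} (ht : (t : ℝ) ≤ 1 / 2) : secondHalf t = 0 :=
  Set.projIcc_of_le_left zero_le_one (by linarith)

theorem secondHalf_one : secondHalf 1 = 1 :=
  Set.projIcc_of_right_le zero_le_one (by norm_num)

/-- The angle of the rotation: from `0` to `π / 2` on the first half of the interval. -/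
def rotationAngle (t : unitInterval) : ℝ := Real.pi / 2 * min (2 * (t : ℝ)) 1

theorem continuous_rotationAngle : Continuous rotationAngle := by
  unfold rotationAngle
  fun_prop

theorem rotationAngle_of_ge {t : unitInterval} (ht : 1 / 2 ≤ (t : ℝ)) :
    rotationAngle t = Real.pi / 2 := by
  rw [rotationAngle, min_eq_right (by linarith), mul_one]

theorem rotationAngle_zero : rotationAngle 0 = 0 := by
  simp [rotationAngle]

/-- A path of real scalars. -/
def scalarPath (D : Type*) [CStarAlgebra D] (f : unitInterval → ℝ) (hf : Continuous f) :
    C(unitInterval, D) :=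
  ⟨fun t => algebraMap ℂ D (f t), (continuous_algebraMap ℂ D).comp
    (Complex.continuous_ofReal.comp hf)⟩

theorem star_scalarPath {D : Type*} [CStarAlgebra D] {f : unitInterval → ℝ} (hf : Continuous f) :
    star (scalarPath D f hf) = scalarPath D f hf := by
  ext t
  change star (algebraMap ℂ D (f t)) = algebraMap ℂ D (f t)
  rw [← algebraMap_star_comm]
  simp

theorem commute_scalarPath {D : Type*} [CStarAlgebra D] {f : unitInterval → ℝ}
    (hf : Continuous f) (x : C(unitInterval, D)) : Commute (scalarPath D f hf) x := by
  ext t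
  exact Algebra.commutes (f t : ℂ) (x t)

/-- The path of matrices rotating `w ⊕ w*` to `1`. -/
def rotationPath {D : Type*} [CStarAlgebra D] (w : D) :
    Matrix (Fin 2) (Fin 2) C(unitInterval, D) :=
  rotation (constPath D w)
    (scalarPath D (fun t => Real.sin (rotationAngle t))
      (Real.continuous_sin.comp continuous_rotationAngle))
    (scalarPath D (fun t => Real.cos (rotationAngle t))
      (Real.continuous_cos.comp continuous_rotationAngle))

theorem rotationPath_unitary {D : Type*} [CStarAlgebra D] {w : D} (hw : w ∈ unitary D) :
    star (rotationPath w) * rotationPath w = 1 ∧ rotationPath w * star (rotationPath w) = 1 := by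
  refine star_mul_self_rotation (star_scalarPath _) (star_scalarPath _)
    (commute_scalarPath _ _).eq (commute_scalarPath _ _).symm.eq (commute_scalarPath _ _).symm.eq
    ?_ ?_ ?_
  · ext t
    change algebraMap ℂ D _ * algebraMap ℂ D _ + algebraMap ℂ D _ * algebraMap ℂ D _ = 1
    rw [← map_mul, ← map_mul, ← map_add, ← Complex.ofReal_mul, ← Complex.ofReal_mul,
      ← Complex.ofReal_add, ← sq, ← sq, Real.sin_sq_add_cos_sq, Complex.ofReal_one, map_one]
  · rw [← map_star, ← map_mul, Unitary.star_mul_self_of_mem hw, map_one, mul_one]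
  · rw [← map_star, ← map_mul, Unitary.mul_star_self_of_mem hw, map_one, mul_one]

theorem map_evalPath_zero_rotationPath {D : Type*} [CStarAlgebra D] (w : D) :
    (rotationPath w).map (evalPath D 0) = Matrix.diagonal ![w, star w] := by
  rw [rotationPath, map_rotation, ← rotation_zero_one]
  congr 1
  · change algebraMap ℂ D _ = 0
    simp [rotationAngle_zero]
  · change algebraMap ℂ D _ = 1
    simp [rotationAngle_zero]

theorem map_evalPath_one_rotationPath {D : Type*} [CStarAlgebra D] (w : D) :
    (rotationPath w).map (evalPath D 1) = 1 := by
  have h : rotationAngle 1 = Real.pi / 2 := rotationAngle_of_ge (by norm_num)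
  rw [rotationPath, map_rotation, ← rotation_one_zero (x := evalPath D 1 (constPath D w))]
  congr 1
  · change algebraMap ℂ D _ = 1
    simp [h]
  · change algebraMap ℂ D _ = 0
    simp [h]

/-- On the first half of the interval the delayed path is constantly `f 0`, which commutes with `w`.
On the second half the cosine vanishes and the rotation is already 1. -/
theorem commute_rotationPath {D : Type*} [CStarAlgebra D] {w : D} (f : C(unitInterval, D))
    (h : Commute w (f 0)) (h' : Commute (star w) (f 0)) (i j : Fin 2) :
    Commute (rotationPath w i j) (f.comp secondHalf) := by
  have key : ∀ z : D, Commute z (f 0) →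
      scalarPath D _ (Real.continuous_cos.comp continuous_rotationAngle)
        * (constPath D z * f.comp secondHalf)
      = scalarPath D _ (Real.continuous_cos.comp continuous_rotationAngle)
        * (f.comp secondHalf * constPath D z) := by
    intro z hz
    ext t
    change algebraMap ℂ D (Real.cos (rotationAngle t) : ℝ) * (z * f (secondHalf t))
      = algebraMap ℂ D (Real.cos (rotationAngle t) : ℝ) * (f (secondHalf t) * z)
    rcases le_total (t : ℝ) (1 / 2) with ht | ht
    · rw [secondHalf_of_le ht, hz.eq]
    · rw [rotationAngle_of_ge ht]
      simp
  exact commute_rotation (commute_scalarPath _ _) (commute_scalarPath _ _) (key w h)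
    (by rw [← map_star]; exact key _ h') i j

theorem commute_star_of_mem_unitary {D : Type*} [CStarAlgebra D] {w z : D} (hw : w ∈ unitary D)
    (h : Commute w z) : Commute (star w) z := by
  calc star w * z = star w * (z * w) * star w := by
        rw [mul_assoc, mul_assoc, Unitary.mul_star_self_of_mem hw, mul_one]
    _ = z * star w := by rw [← h.eq, ← mul_assoc, Unitary.star_mul_self_of_mem hw, one_mul]

variable (B) in
/-- The path of an element. -/
def pathFst : pathAlgebra B →⋆ₐ[ℂ] C(unitInterval, Corona B) where
  toFun x := x.1.1
  map_one' := rfl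
  map_mul' _ _ := rfl
  map_zero' := rfl
  map_add' _ _ := rfl
  commutes' _ := rfl
  map_star' _ := rfl

variable (B) in
/-- The reparametrization that makes paths constant on the first half of the interval. -/
def pathDelay : pathAlgebra B →⋆ₐ[ℂ] pathAlgebra B where
  toFun x := ⟨(x.1.1.comp secondHalf, x.1.2), by
    rw [mem_pathAlgebra]
    change x.1.1 (secondHalf 1) = _
    rw [secondHalf_one]
    exact x.2⟩
  map_one' := rfl
  map_mul' _ _ := rfl
  map_zero' := rfl
  map_add' _ _ := rfl
  commutes' _ := rfl
  map_star' _ := rfl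

variable (B) in
/-- Constant paths with a lift. -/
def pathConst : Multiplier B →⋆ₐ[ℂ] pathAlgebra B where
  toFun x := ⟨(constPath _ (coronaMk B x), x), rfl⟩
  map_one' := rfl
  map_mul' _ _ := rfl
  map_zero' := rfl
  map_add' _ _ := rfl
  commutes' _ := rfl
  map_star' _ := rfl

variable (B) in
/-- The lifting algebra of paths in `Q(B)` with a lift of the end point. -/
def pathLifting : LiftingAlgebra B where
  carrier := pathAlgebra B
  p := (evalPath (Corona B) 0).comp (pathFst B)
  c := pathConst B
  p_c _ := rfl
  lift_unitary V X _ w hw hX := by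
    have hS := V.isOrthoFamily.map ((constPath _).comp (coronaMk B))
    have hS1 : ∑ i, (constPath _).comp (coronaMk B) (V.fam i)
        * star ((constPath _).comp (coronaMk B) (V.fam i)) = 1 := by
      simp_rw [← map_star, ← map_mul]
      rw [← map_sum, V.sum_fam, map_one]
    set W := famMat (fun i => (constPath _).comp (coronaMk B) (V.fam i)) (rotationPath w)
    have hW : W ∈ unitary _ :=
      famMat_mem_unitary hS hS1 (rotationPath_unitary hw).1 (rotationPath_unitary hw).2
    have hW0 : W 0 = famSum (fun i => coronaMk B (V.fam i)) ![w, star w] := by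
      change evalPath _ 0 W = _
      rw [map_famMat, map_evalPath_zero_rotationPath, famMat_diagonal]
      rfl
    have hW1 : W 1 = 1 := by
      change evalPath _ 1 W = _
      rw [map_famMat, map_evalPath_one_rotationPath]
      refine famMat_one ?_
      rw [← map_one (evalPath (Corona B) 1), ← hS1, map_sum]
      simp_rw [map_mul, map_star]
    -- The rotation ends at 1, which has the lift 1 in `M(B)`.
    refine ⟨pathDelay B, ⟨(W, 1), by rw [mem_pathAlgebra, hW1, map_one]⟩, ?_, fun x => ?_, hW0,
      fun x hx => ?_⟩
    · rw [Unitary.mem_iff]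
      exact ⟨Subtype.ext (Prod.ext (Unitary.star_mul_self_of_mem hW) (by simp)),
        Subtype.ext (Prod.ext (Unitary.mul_star_self_of_mem hW) (by simp))⟩
    · change x.1.1 (secondHalf 0) = x.1.1 0
      rw [secondHalf_of_le (by norm_num)]
    · have hc : Commute w (x.1.1 0) := hX x hx
      have hc' : Commute (star w) (x.1.1 0) := commute_star_of_mem_unitary hw hc
      have h := commute_famMat hS (commute_rotationPath x.1.1 hc hc')
      refine Subtype.ext (Prod.ext ?_ ((Commute.one_left _).eq))
      have e := map_famSum (S := fun i => pathConst B (V.fam i)) (pathFst B)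
        fun _ => pathDelay B x
      have e' := h.eq
      change W * famSum (fun i => pathFst B (pathConst B (V.fam i)))
          (fun _ => pathFst B (pathDelay B x))
        = famSum (fun i => pathFst B (pathConst B (V.fam i)))
          (fun _ => pathFst B (pathDelay B x)) * W at e'
      rw [← e] at e'
      exact e'

/-- The path coordinate of a lift is a strong homotopy starting at `φ`, and the multiplier
coordinate splits its end. -/
theorem pathLifting_lifts_iff {A : Type*} [NonUnitalCStarAlgebra A] (φ : Extension A B) :
    (pathLifting B).Lifts φ ↔ ∃ σ : Extension A B, IsSplit σ ∧ StronglyHomotopic φ σ := by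
  constructor
  · rintro ⟨Φ, hΦ⟩
    let e : ∀ t : unitInterval, pathAlgebra B →⋆ₐ[ℂ] Corona B := fun t =>
      (evalPath (Corona B) t).comp (pathFst B)
    let Φ' : A →⋆ₙₐ[ℂ] pathAlgebra B := Φ
    refine ⟨((e 1 : pathAlgebra B →⋆ₙₐ[ℂ] Corona B)).comp Φ',
      ⟨(((StarAlgHom.snd ℂ C(unitInterval, Corona B) (Multiplier B)).comp
        (pathAlgebra B).subtype : pathAlgebra B →⋆ₐ[ℂ] Multiplier B) :
          pathAlgebra B →⋆ₙₐ[ℂ] Multiplier B).comp Φ', fun a => (Φ' a).2.symm⟩,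
      fun t => ((e t : pathAlgebra B →⋆ₙₐ[ℂ] Corona B)).comp Φ', fun a => (Φ' a).1.1.continuous,
      ?_, rfl⟩
    ext a
    exact hΦ a
  · rintro ⟨σ, ⟨π, hπ⟩, ψ, hψ, rfl, rfl⟩
    refine ⟨({ toFun := fun a => ⟨(⟨fun t => ψ t a, hψ a⟩, π a), (hπ a).symm⟩
               map_smul' := fun c a => ?_
               map_zero' := ?_
               map_add' := fun a b => ?_
               map_mul' := fun a b => ?_
               map_star' := fun a => ?_ } : A →⋆ₙₐ[ℂ] pathAlgebra B), fun a => rfl⟩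
    · exact Subtype.ext (Prod.ext (ContinuousMap.ext fun t => map_smul (ψ t) c a) (map_smul π c a))
    · exact Subtype.ext (Prod.ext (ContinuousMap.ext fun t => map_zero (ψ t)) (map_zero π))
    · exact Subtype.ext (Prod.ext (ContinuousMap.ext fun t => map_add (ψ t) a b) (map_add π a b))
    · exact Subtype.ext (Prod.ext (ContinuousMap.ext fun t => map_mul (ψ t) a b) (map_mul π a b))
    · exact Subtype.ext (Prod.ext (ContinuousMap.ext fun t => map_star (ψ t) a) (map_star π a))

theorem isStronglyHomotopyInvertible_iff {A : Type*} [NonUnitalCStarAlgebra A]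
    (φ : Extension A B) : IsStronglyHomotopyInvertible φ ↔ (pathLifting B).Invertible φ := by
  simp only [IsStronglyHomotopyInvertible, LiftingAlgebra.Invertible, pathLifting_lifts_iff]

end StrongHomotopy

/-! ### Continuous paths of quasicentral approximate units -/

section QuasicentralPath

attribute [local instance] CStarAlgebra.spectralOrder CStarAlgebra.spectralOrderedRing

open Filter Topology

variable {B : Type w} [NonUnitalCStarAlgebra B]

theorem finite_encode_le (α : Type*) [Encodable α] (r : ℝ) :
    {a : α | (Encodable.encode a : ℝ) ≤ r}.Finite :=
  ((Set.finite_le_nat ⌊r⌋₊).preimage Encodable.encode_injective.injOn).subset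
    fun _ ha => Nat.le_floor ha

/-- Quasicentral approximate units along continuous families. -/
theorem exists_quasicentral_path {T : Type*} [MetricSpace T] {ρ : T → ℝ} (hρ : Continuous ρ)
    {δ : T → ℝ} (hδ : Continuous δ) (hδ0 : ∀ t, 0 < δ t) {ι κ : Type*} [Encodable ι] [Encodable κ]
    {x : ι → T → Multiplier B} (hx : ∀ i, Continuous (x i))
    {y : κ → T → Multiplier B} (hy : ∀ j, Continuous (y j)) (hyB : ∀ j t, ∃ b, toMult B b = y j t) :
    ∃ e : C(T, B), ∀ t, IsSelfAdjoint (e t) ∧ ‖e t‖ ≤ 1 ∧ ‖1 - toMult B (e t)‖ ≤ 1 ∧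
      (∀ j, (Encodable.encode j : ℝ) ≤ ρ t → ‖toMult B (e t) * y j t - y j t‖ ≤ δ t) ∧
      ∀ i, (Encodable.encode i : ℝ) ≤ ρ t →
        ‖toMult B (e t) * x i t - x i t * toMult B (e t)‖ ≤ δ t := by
  -- All conditions on `e` are convex, so local constant solutions can be glued by a partition of
  -- unity.
  refine exists_continuous_forall_mem_convex_of_local_const (E := B)
    (t := fun t => {e | IsSelfAdjoint e ∧ ‖e‖ ≤ 1 ∧ ‖1 - toMult B e‖ ≤ 1 ∧
      (∀ j, (Encodable.encode j : ℝ) ≤ ρ t → ‖toMult B e * y j t - y j t‖ ≤ δ t) ∧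
      ∀ i, (Encodable.encode i : ℝ) ≤ ρ t →
        ‖toMult B e * x i t - x i t * toMult B e‖ ≤ δ t}) (fun t => ?_) fun t => ?_
  · have hsm : ∀ (r : ℝ) (b : B), toMult B (r • b) = r • toMult B b := fun r b => by
      rw [← Complex.coe_smul, map_smul, Complex.coe_smul]
    intro a ha b hb r s hr hs hrs
    refine ⟨((IsSelfAdjoint.all r).smul ha.1).add ((IsSelfAdjoint.all s).smul hb.1), ?_, ?_,
      fun j hj => ?_, fun i hi => ?_⟩
    · exact mem_closedBall_zero_iff.1 (convex_closedBall (0 : B) 1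
        (mem_closedBall_zero_iff.2 ha.2.1) (mem_closedBall_zero_iff.2 hb.2.1) hr hs hrs)
    · rw [map_add, hsm, hsm, norm_sub_rev]
      exact mem_closedBall_iff_norm.1 (convex_closedBall (1 : Multiplier B) 1
        (mem_closedBall_iff_norm'.2 ha.2.2.1) (mem_closedBall_iff_norm'.2 hb.2.2.1) hr hs hrs)
    · have h := convex_closedBall (y j t) (δ t) (x := toMult B a * y j t) (y := toMult B b * y j t)
        (mem_closedBall_iff_norm.2 (ha.2.2.2.1 j hj)) (mem_closedBall_iff_norm.2 (hb.2.2.2.1 j hj))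
        hr hs hrs
      rw [mem_closedBall_iff_norm] at h
      rw [map_add, hsm, hsm]
      simpa only [add_mul, smul_mul_assoc] using h
    · have h := convex_closedBall 0 (δ t) (x := toMult B a * x i t - x i t * toMult B a)
        (y := toMult B b * x i t - x i t * toMult B b)
        (mem_closedBall_zero_iff.2 (ha.2.2.2.2 i hi)) (mem_closedBall_zero_iff.2 (hb.2.2.2.2 i hi))
        hr hs hrs
      rw [mem_closedBall_zero_iff] at h
      have e1 : toMult B (r • a + s • b) * x i t - x i t * toMult B (r • a + s • b)
          = r • (toMult B a * x i t - x i t * toMult B a)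
            + s • (toMult B b * x i t - x i t * toMult B b) := by
        rw [map_add, hsm, hsm, add_mul, mul_add, smul_mul_assoc, smul_mul_assoc, mul_smul_comm, mul_smul_comm,
          smul_sub, smul_sub]
        abel
      rw [e1]
      exact h
  · choose b hb using fun j => hyB j t
    -- Near `t` the value of `ρ` stays below `ρ t + 1`, so finitely many indices cover all
    -- conditions active in a neighbourhood. The tolerance `δ t / 2` leaves room for them to persist
    -- there.
    have hι := finite_encode_le ι (ρ t + 1)
    have hκ := finite_encode_le κ (ρ t + 1)
    classical
    obtain ⟨e, h0, h1, hY, hX⟩ := exists_quasicentral (hι.toFinset.image fun i => x i t)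
      (hκ.toFinset.image b) (half_pos (hδ0 t))
    refine ⟨e, ?_⟩
    have hρt : ∀ᶠ s in 𝓝 t, ρ s < ρ t + 1 := hρ.continuousAt.eventually (gt_mem_nhds (by simp))
    have hYt : ∀ᶠ s in 𝓝 t, ∀ j ∈ hκ.toFinset, ‖toMult B e * y j s - y j s‖ < δ s := by
      rw [Filter.eventually_all_finset]
      intro j hj
      have hc : Continuous fun s => δ s - ‖toMult B e * y j s - y j s‖ := by
        have := hy j
        fun_prop
      have : 0 < δ t - ‖toMult B e * y j t - y j t‖ := by
        have h := hY _ (Finset.mem_image_of_mem b hj)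
        rw [← norm_toMult, map_sub, map_mul, hb] at h
        linarith [hδ0 t]
      filter_upwards [hc.continuousAt.eventually (lt_mem_nhds this)] with s hs
      linarith
    have hXt : ∀ᶠ s in 𝓝 t, ∀ i ∈ hι.toFinset,
        ‖toMult B e * x i s - x i s * toMult B e‖ < δ s := by
      rw [Filter.eventually_all_finset]
      intro i hi
      have hc : Continuous fun s => δ s - ‖toMult B e * x i s - x i s * toMult B e‖ := by
        have := hx i
        fun_prop
      have : 0 < δ t - ‖toMult B e * x i t - x i t * toMult B e‖ := by
        have h := hX _ (Finset.mem_image_of_mem (fun i => x i t) hi)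
        linarith [hδ0 t]
      filter_upwards [hc.continuousAt.eventually (lt_mem_nhds this)] with s hs
      linarith
    filter_upwards [hρt, hYt, hXt] with s hs hYs hXs
    have h2 : ‖1 - toMult B e‖ ≤ 1 := by
      rw [CStarAlgebra.norm_le_one_iff_of_nonneg _ (sub_nonneg.2 (toMult_le_one h0 h1))]
      exact sub_le_self _ (toMult_nonneg h0)
    exact ⟨IsSelfAdjoint.of_nonneg h0, h1, h2, fun j hj => (hYs j (hκ.mem_toFinset.2
      (hj.trans hs.le))).le, fun i hi => (hXs i (hι.mem_toFinset.2 (hi.trans hs.le))).le⟩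

end QuasicentralPath

/-! ### The algebra of asymptotic families -/

section AsymptoticAlgebra

open Filter Topology BoundedContinuousFunction

variable (B : Type w) [NonUnitalCStarAlgebra B]

/-- Bounded continuous families of multipliers with constant image in `Q(B)`. -/
def asympAlgebra : StarSubalgebra ℂ (Set.Ici (1 : ℝ) →ᵇ Multiplier B) where
  carrier := {f | ∀ t, coronaMk B (f t) = coronaMk B (f ⟨1, Set.self_mem_Ici⟩)}
  mul_mem' := by
    intro f g hf hg t
    rw [BoundedContinuousFunction.mul_apply, BoundedContinuousFunction.mul_apply, map_mul, map_mul, hf, hg]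
  add_mem' := by
    intro f g hf hg t
    rw [BoundedContinuousFunction.add_apply, BoundedContinuousFunction.add_apply, map_add, map_add, hf, hg]
  algebraMap_mem' := fun r t => rfl
  star_mem' := by
    intro f hf t
    rw [star_apply, star_apply, map_star, map_star, hf]

variable {B}

instance : IsClosed (asympAlgebra B : Set (Set.Ici (1 : ℝ) →ᵇ Multiplier B)) := by
  have : (asympAlgebra B : Set (Set.Ici (1 : ℝ) →ᵇ Multiplier B))
      = ⋂ t, {f | coronaMk B (f t) = coronaMk B (f ⟨1, Set.self_mem_Ici⟩)} := by
    ext f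
    simp [asympAlgebra]
  rw [this]
  have hq : Continuous (coronaMk B) :=
    continuous_starHom (coronaMk B : Multiplier B →⋆ₙₐ[ℂ] Corona B)
  exact isClosed_iInter fun t => isClosed_eq (hq.comp (continuous_eval_const t))
    (hq.comp (continuous_eval_const _))

variable (B) in
/-- The ideal of families vanishing at infinity. -/
def vanishingIdeal : Ideal (asympAlgebra B) where
  carrier := {f | Tendsto (fun t => ‖f.1 t‖) atTop (𝓝 0)}
  add_mem' := by
    intro f g hf hg
    refine squeeze_zero (fun t => norm_nonneg _) (fun t => norm_add_le (f.1 t) (g.1 t)) ?_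
    simpa using! Tendsto.add hf hg
  zero_mem' := by
    change Tendsto (fun _ => ‖(0 : Multiplier B)‖) atTop (𝓝 0)
    simp
  smul_mem' := by
    intro f g hg
    refine squeeze_zero (fun t => norm_nonneg _) (fun t => (norm_mul_le (f.1 t) (g.1 t)).trans
      (mul_le_mul_of_nonneg_right (f.1.norm_coe_le_norm t) (norm_nonneg _))) ?_
    simpa using! Tendsto.const_mul ‖f.1‖ hg

theorem mem_vanishingIdeal {f : asympAlgebra B} :
    f ∈ vanishingIdeal B ↔ Tendsto (fun t => ‖f.1 t‖) atTop (𝓝 0) := Iff.rfl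

instance : (vanishingIdeal B).IsTwoSided where
  mul_mem_of_left := by
    intro f g hf
    refine squeeze_zero (fun t => norm_nonneg _) (fun t => (norm_mul_le (f.1 t) (g.1 t)).trans
      (mul_le_mul_of_nonneg_left (g.1.norm_coe_le_norm t) (norm_nonneg _))) ?_
    simpa using! Tendsto.mul_const ‖g.1‖ hf

/-- The image in `Q(B)` does not depend on `t` and its norm is at most that of `f.1 t`, which tends
to 0. -/
theorem exists_toMult_of_mem_vanishingIdeal {f : asympAlgebra B} (hf : f ∈ vanishingIdeal B)
    (t : Set.Ici (1 : ℝ)) : ∃ b, toMult B b = f.1 t := by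
  rw [← coronaMk_eq_zero, ← norm_le_zero_iff]
  refine ge_of_tendsto hf (Eventually.of_forall fun s => ?_)
  rw [f.2 t, ← f.2 s]
  exact NonUnitalStarAlgHom.norm_apply_le (coronaMk B : Multiplier B →⋆ₙₐ[ℂ] Corona B) _

/-- Elements of the algebra given by continuous families in `B`. -/
def asympOfIdeal (e : C(Set.Ici (1 : ℝ), B)) {C : ℝ} (he : ∀ t, ‖e t‖ ≤ C) : asympAlgebra B :=
  ⟨BoundedContinuousFunction.ofNormedAddCommGroup (fun t => toMult B (e t))
    ((continuous_starHom (toMult B)).comp e.continuous) C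
    fun t => (norm_toMult B (e t)).le.trans (he t), fun t => by
      have h : ∀ b, coronaMk B (toMult B b) = 0 := fun b => (coronaMk_eq_zero B).2 ⟨b, rfl⟩
      exact (h _).trans (h _).symm⟩

theorem isCStarIdeal_vanishingIdeal : IsCStarIdeal (vanishingIdeal B) where
  closed := by
    refine isClosed_of_closure_subset fun f hf => ?_
    rw [SetLike.mem_coe, mem_vanishingIdeal, Metric.tendsto_nhds]
    intro ε hε
    obtain ⟨g, hg, hfg⟩ := Metric.mem_closure_iff.1 hf (ε / 2) (half_pos hε)
    filter_upwards [Metric.tendsto_nhds.1 (mem_vanishingIdeal.1 hg) _ (half_pos hε)] with t ht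
    rw [dist_zero_right, norm_norm] at ht ⊢
    have h1 : ‖f.1 t - g.1 t‖ ≤ dist f g := by
      rw [← dist_eq_norm]
      exact BoundedContinuousFunction.dist_coe_le_dist (f := f.1) (g := g.1) t
    have h2 := norm_add_le (f.1 t - g.1 t) (g.1 t)
    rw [sub_add_cancel] at h2
    linarith
  star_mem := by
    intro f hf
    rw [mem_vanishingIdeal] at hf ⊢
    simpa using hf
  exists_approx := by
    intro j hj ε hε
    -- Only an approximate unit is wanted, so there are no elements to commute with. The unit acts
    -- on the left, hence the adjoint of `j`.
    obtain ⟨e, he⟩ := exists_quasicentral_path (B := B) (T := Set.Ici (1 : ℝ)) (ι := Empty)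
      (κ := Unit) (ρ := fun _ => 0) continuous_const (δ := fun _ => ε) continuous_const
      (fun _ => hε) (x := fun i _ => i.elim) (fun i => i.elim) (y := fun _ t => star (j.1 t))
      (fun _ => j.1.continuous.star) (fun _ t => by
        obtain ⟨b, hb⟩ := exists_toMult_of_mem_vanishingIdeal hj t
        exact ⟨star b, by rw [map_star, hb]⟩)
    obtain ⟨R, hR⟩ := (Metric.tendsto_nhds.1 (mem_vanishingIdeal.1 hj) ε hε).exists_forall_of_atTop
    -- A cut-off equal to 1 up to `R` and 0 from `R + 1` on, so that `χ • e` vanishes at infinity.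
    -- Past `R` the family `j` is already smaller than `ε`.
    let χ : Set.Ici (1 : ℝ) → ℝ := fun t => Set.projIcc (0 : ℝ) 1 zero_le_one (R + 1 - t)
    have hχ : Continuous χ := by fun_prop
    have hχ0 : ∀ t, 0 ≤ χ t := fun t => (Set.projIcc (0 : ℝ) 1 zero_le_one _).2.1
    have hχ1 : ∀ t, χ t ≤ 1 := fun t => (Set.projIcc (0 : ℝ) 1 zero_le_one _).2.2
    let e' : C(Set.Ici (1 : ℝ), B) := ⟨fun t => (χ t : ℂ) • e t, by fun_prop⟩
    have he' : ∀ t, ‖e' t‖ ≤ 1 := fun t => by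
      change ‖(χ t : ℂ) • e t‖ ≤ 1
      rw [norm_smul, Complex.norm_real, Real.norm_of_nonneg (hχ0 t)]
      exact mul_le_one₀ (hχ1 t) (norm_nonneg _) (he t).2.1
    have hval : ∀ t, (1 - asympOfIdeal e' he').1 t
        = ((1 - χ t : ℝ) : ℂ) • 1 + (χ t : ℂ) • (1 - toMult B (e t)) := by
      intro t
      change 1 - toMult B ((χ t : ℂ) • e t) = _
      rw [map_smul, smul_sub, Complex.ofReal_sub, sub_smul, Complex.ofReal_one, one_smul]
      abel
    have hone : ‖(1 : Multiplier B)‖ ≤ 1 := by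
      nontriviality Multiplier B
      exact CStarRing.norm_one.le
    refine ⟨asympOfIdeal e' he', ?_, ?_, ?_⟩
    · rw [mem_vanishingIdeal]
      refine tendsto_const_nhds.congr' ?_
      have hR1 : (1 : ℝ) ≤ R := R.2
      filter_upwards [eventually_ge_atTop (⟨R + 1, by simp; linarith⟩ : Set.Ici (1 : ℝ))]
        with t ht
      have ht' : (R : ℝ) + 1 ≤ t := ht
      have h0 : χ t = 0 := by
        simp only [χ, Set.projIcc_of_le_left zero_le_one (show (R : ℝ) + 1 - t ≤ 0 by linarith)]
      change 0 = ‖toMult B ((χ t : ℂ) • e t)‖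
      rw [h0, Complex.ofReal_zero, zero_smul, map_zero, norm_zero]
    · refine (BoundedContinuousFunction.norm_le zero_le_one).2 fun t => ?_
      change ‖(1 - asympOfIdeal e' he').1 t‖ ≤ 1
      rw [hval]
      refine (norm_add_le _ _).trans ?_
      rw [norm_smul, norm_smul, Complex.norm_real, Complex.norm_real, Real.norm_of_nonneg (hχ0 t),
        Real.norm_of_nonneg (sub_nonneg.2 (hχ1 t))]
      calc (1 - χ t) * ‖(1 : Multiplier B)‖ + χ t * ‖1 - toMult B (e t)‖
          ≤ (1 - χ t) * 1 + χ t * 1 :=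
            add_le_add (mul_le_mul_of_nonneg_left hone (sub_nonneg.2 (hχ1 t)))
              (mul_le_mul_of_nonneg_left (he t).2.2.1 (hχ0 t))
        _ = 1 := by ring
    · refine (BoundedContinuousFunction.norm_le hε.le).2 fun t => ?_
      change ‖j.1 t * (1 - asympOfIdeal e' he').1 t‖ ≤ ε
      have h1 : (1 - χ t) * ‖j.1 t‖ ≤ (1 - χ t) * ε := by
        rcases le_total R t with ht | ht
        · have := hR t ht
          rw [dist_zero_right, norm_norm] at this
          exact mul_le_mul_of_nonneg_left this.le (sub_nonneg.2 (hχ1 t))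
        · have ht' : (t : ℝ) ≤ R := ht
          have : χ t = 1 := by
            simp only [χ, Set.projIcc_of_right_le zero_le_one
              (show 1 ≤ (R : ℝ) + 1 - t by linarith)]
          simp [this]
      have h2 : ‖j.1 t * (1 - toMult B (e t))‖ ≤ ε := by
        have h := (he t).2.2.2.1 () (by simp)
        rw [← norm_star, star_sub, star_mul, star_star, ← map_star, (he t).1.star_eq,
          norm_sub_rev] at h
        rwa [mul_sub, mul_one]
      rw [hval, mul_add, mul_smul_comm, mul_smul_comm, mul_one]
      refine (norm_add_le _ _).trans ?_
      rw [norm_smul, norm_smul, Complex.norm_real, Complex.norm_real, Real.norm_of_nonneg (hχ0 t),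
        Real.norm_of_nonneg (sub_nonneg.2 (hχ1 t))]
      linarith [mul_le_mul_of_nonneg_left h2 (hχ0 t)]

end AsymptoticAlgebra

/-! ### The cosine belonging to a given sine -/

section Complement

variable {D : Type*} [CStarAlgebra D]

/-- The element `√(1 - s²)`. -/
def sqrtComplement (s : D) : D := cfc (fun x : ℝ => √(1 - x ^ 2)) s

theorem star_sqrtComplement (s : D) : star (sqrtComplement s) = sqrtComplement s :=
  (cfc_predicate (p := IsSelfAdjoint) _ s : IsSelfAdjoint _).star_eq

theorem mul_self_add_sqrtComplement {s : D} (hs : IsSelfAdjoint s) (h1 : ‖s‖ ≤ 1) :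
    s * s + sqrtComplement s * sqrtComplement s = 1 := by
  have e : cfc (fun x : ℝ => x * x) s = s * s := by
    rw [cfc_mul (fun x : ℝ => x) (fun x => x) s, cfc_id' ℝ s]
  rw [← e, sqrtComplement, ← cfc_mul _ _ s,
    ← cfc_add s (fun x : ℝ => x * x) (fun x => √(1 - x ^ 2) * √(1 - x ^ 2)), ← cfc_one ℝ s]
  refine cfc_congr fun x hx => ?_
  have hx1 : |x| ≤ 1 := by
    have hle := norm_apply_le_norm_cfc (fun x : ℝ => x) s hx
    rw [cfc_id' ℝ s] at hle
    exact hle.trans h1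
  have : x ^ 2 ≤ 1 := by rw [← sq_abs]; exact pow_le_one₀ (abs_nonneg x) hx1
  change x * x + √(1 - x ^ 2) * √(1 - x ^ 2) = 1
  rw [Real.mul_self_sqrt (by linarith)]
  ring

theorem commute_sqrtComplement {s z : D} (hs : IsSelfAdjoint s) (hz : Commute s z) :
    Commute (sqrtComplement s) z := 
  (IsSelfAdjoint.commute_cfc hs hz _)

theorem map_sqrtComplement {D' : Type*} [CStarAlgebra D'] (f : D →⋆ₐ[ℂ] D') {s : D}
    (hs : IsSelfAdjoint s) (hf : f s = 0) : f (sqrtComplement s) = 1 := by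
  have h := StarAlgHomClass.map_cfc (f.restrictScalars ℝ) (fun x : ℝ => √(1 - x ^ 2)) s
    (hφ := continuous_starHom (f : D →⋆ₙₐ[ℂ] D'))
  change f (sqrtComplement s) = cfc _ (f s) at h
  rw [h, hf, cfc_apply_zero]
  simp

/-- With c = √(1 - s²) one has (c z)* (c z) = z* (1 - s²) z = 0. -/
theorem sqrtComplement_mul_eq_zero {s z : D} (hs : IsSelfAdjoint s) (h1 : ‖s‖ ≤ 1)
    (hz : s * z = z) : sqrtComplement s * z = 0 := by
  rw [← CStarRing.star_mul_self_eq_zero_iff, star_mul, star_sqrtComplement, mul_assoc,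
    ← mul_assoc (sqrtComplement s), eq_sub_of_add_eq' (mul_self_add_sqrtComplement hs h1), sub_mul,
    mul_assoc, hz, hz]
  simp

end Complement

/-! ### Boundedness of asymptotic homomorphisms -/

section Bounded

attribute [local instance] CStarAlgebra.spectralOrder CStarAlgebra.spectralOrderedRing

open Filter Topology

/-- `b` is 1 - √(1 - a*a). The equation says a*a + (1 - b)² = 1, rearranged so that it makes sense
without a unit and can be transported by an asymptotic homomorphism. -/
theorem exists_star_mul_self_add {A : Type*} [NonUnitalCStarAlgebra A] {a : A} (ha : ‖a‖ < 1) :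
    ∃ b : A, star b = b ∧ star a * a + b * b = b + b := by
  set h := star a * a with hh
  have hsa : IsSelfAdjoint h := IsSelfAdjoint.star_mul_self a
  have hn : ‖h‖ ≤ 1 := by
    rw [hh, CStarRing.norm_star_mul_self]
    exact mul_le_one₀ ha.le (norm_nonneg _) ha.le
  refine ⟨cfcₙ (fun x : ℝ => 1 - √(1 - x)) h,
    (cfcₙ_predicate (p := IsSelfAdjoint) _ h : IsSelfAdjoint _).star_eq, ?_⟩
  have hf0 : (fun x : ℝ => 1 - √(1 - x)) 0 = 0 := by simp
  have e : cfcₙ (fun x : ℝ => x) h = h := cfcₙ_id' ℝ h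
  rw [← cfcₙ_mul _ _ h, ← cfcₙ_add _ _ h]
  nth_rewrite 1 [← e]
  rw [← cfcₙ_add (fun x : ℝ => x) (fun x => (1 - √(1 - x)) * (1 - √(1 - x))) h]
  refine cfcₙ_congr fun x hx => ?_
  have hx1 : |x| ≤ 1 := by
    have hle := norm_apply_le_norm_cfcₙ (fun x : ℝ => x) h hx
    rw [e] at hle
    exact hle.trans hn
  have := (abs_le.1 hx1).2
  have h2 := Real.mul_self_sqrt (show 0 ≤ 1 - x by linarith)
  change x + (1 - √(1 - x)) * (1 - √(1 - x)) = 1 - √(1 - x) + (1 - √(1 - x))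
  linear_combination h2

/-- x*x + (1 - y)*(1 - y) equals 1 plus the displayed defect, and it dominates both of its positive
summands. -/
theorem norm_sq_le_of_star_mul_self {D : Type*} [CStarAlgebra D] (x y : D) :
    ‖x‖ ^ 2 ≤ 1 + ‖star x * x + star y * y - (y + star y)‖ ∧
      ‖1 - y‖ ^ 2 ≤ 1 + ‖star x * x + star y * y - (y + star y)‖ := by
  have e : star x * x + star (1 - y) * (1 - y)
      = 1 + (star x * x + star y * y - (y + star y)) := by
    rw [star_sub, star_one]
    noncomm_ring
  have hone : ‖(1 : D)‖ ≤ 1 := by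
    nontriviality D
    exact CStarRing.norm_one.le
  have key : ∀ z : D, star z * z ≤ star x * x + star (1 - y) * (1 - y) →
      ‖z‖ ^ 2 ≤ 1 + ‖star x * x + star y * y - (y + star y)‖ := fun z hz =>
    calc ‖z‖ ^ 2 = ‖star z * z‖ := by rw [CStarRing.norm_star_mul_self, sq]
      _ ≤ ‖star x * x + star (1 - y) * (1 - y)‖ :=
        CStarAlgebra.norm_le_norm_of_nonneg_of_le (star_mul_self_nonneg _) hz
      _ ≤ _ := by
        rw [e]
        exact (norm_add_le _ _).trans (by gcongr)
  exact ⟨key _ (le_add_of_nonneg_right (star_mul_self_nonneg _)),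
    key _ (le_add_of_nonneg_left (star_mul_self_nonneg _))⟩

/-- Asymptotic homomorphisms to unital algebras are pointwise bounded. -/
theorem exists_norm_le_of_isAsymptoticHom {A : Type*} [NonUnitalCStarAlgebra A] {D : Type w}
    [CStarAlgebra D] {π : Set.Ici (1 : ℝ) → A → D} (hπ : IsAsymptoticHom π) (a : A) :
    ∃ C, ∀ t, ‖π t a‖ ≤ C := by
  have hsmall : ∀ a : A, ‖a‖ < 1 → ∀ᶠ t in atTop, ‖π t a‖ ≤ 2 := by
    intro a ha
    obtain ⟨b, hb, hab⟩ := exists_star_mul_self_add ha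
    have small : ∀ {f : Set.Ici (1 : ℝ) → ℝ}, Tendsto f atTop (𝓝 0) →
        ∀ᶠ t in atTop, f t ≤ 1 / 16 := fun hf =>
      (hf.eventually (gt_mem_nhds (by norm_num : (0 : ℝ) < 1 / 16))).mono fun _ h => h.le
    filter_upwards [small (hπ.mul (star a) a), small (hπ.star a), small (hπ.mul b b),
      small (hπ.add (star a * a) (b * b)), small (hπ.add b b), small (hπ.star b)]
      with t h1 h2 h3 h4 h5 h6
    rw [hab] at h4
    rw [hb] at h6
    obtain ⟨hx, hy⟩ := norm_sq_le_of_star_mul_self (π t a) (π t b)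
    set x := π t a
    set y := π t b
    set d1 := π t (star a * a) - π t (star a) * x
    set d2 := π t (star a) - star x
    set d3 := π t (b * b) - y * y
    set d4 := π t (b + b) - (π t (star a * a) + π t (b * b))
    set d5 := π t (b + b) - (y + y)
    set d6 := y - star y
    have e : star x * x + star y * y - (y + star y)
        = d5 - d4 + d6 - d3 - d1 - d2 * x - d6 * y := by
      simp only [d1, d2, d3, d4, d5, d6]
      noncomm_ring
    -- Each defect `d1`, …, `d6` is eventually at most 1/16. Five enter alone, and two are
    -- multiplied by `x` or `y`; the resulting quadratic inequalities for `‖x‖` and `‖1 - y‖`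
    -- exclude `‖x‖ > 2`.
    have hr : ‖star x * x + star y * y - (y + star y)‖ ≤ (‖x‖ + ‖y‖ + 5) / 16 := by
      rw [e]
      have n1 := norm_sub_le (d5 - d4 + d6 - d3 - d1 - d2 * x) (d6 * y)
      have n2 := norm_sub_le (d5 - d4 + d6 - d3 - d1) (d2 * x)
      have n3 := norm_sub_le (d5 - d4 + d6 - d3) d1
      have n4 := norm_sub_le (d5 - d4 + d6) d3
      have n5 := norm_add_le (d5 - d4) d6
      have n6 := norm_sub_le d5 d4
      have n7 : ‖d6 * y‖ ≤ 1 / 16 * ‖y‖ := (norm_mul_le _ _).trans (by gcongr)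
      have n8 : ‖d2 * x‖ ≤ 1 / 16 * ‖x‖ := (norm_mul_le _ _).trans (by gcongr)
      linarith
    have hyv : ‖y‖ ≤ 1 + ‖1 - y‖ := by
      have h := norm_sub_le (1 : D) (1 - y)
      rw [sub_sub_cancel] at h
      refine h.trans (add_le_add_left ?_ _)
      nontriviality D
      exact CStarRing.norm_one.le
    by_contra! hlt
    nlinarith [sq_nonneg (‖1 - y‖ - 1 / 16), norm_nonneg (1 - y)]
  have hev : ∃ C, ∀ᶠ t in atTop, ‖π t a‖ ≤ C := by
    -- A general `a` is scaled into the open unit ball, at the cost of one asymptotic linearity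
    -- error.
    set c : ℂ := ((‖a‖ + 1 : ℝ) : ℂ)
    have hc : ‖c‖ = ‖a‖ + 1 := by
      rw [Complex.norm_real, Real.norm_of_nonneg (by positivity)]
    have hc0 : c ≠ 0 := by
      rw [← norm_pos_iff, hc]
      positivity
    have ha : ‖c⁻¹ • a‖ < 1 := by
      rw [norm_smul, norm_inv, hc, inv_mul_lt_iff₀ (by positivity)]
      linarith
    refine ⟨1 + ‖c‖ * 2, ?_⟩
    filter_upwards [hsmall _ ha, (hπ.smul c (c⁻¹ • a)).eventually (gt_mem_nhds one_pos)]
      with t h1 h2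
    rw [smul_smul, mul_inv_cancel₀ hc0, one_smul] at h2
    have h3 := norm_add_le (π t a - c • π t (c⁻¹ • a)) (c • π t (c⁻¹ • a))
    rw [sub_add_cancel] at h3
    refine h3.trans (add_le_add h2.le ?_)
    rw [norm_smul]
    gcongr
  obtain ⟨C, hC⟩ := hev
  obtain ⟨R, hR⟩ := hC.exists_forall_of_atTop
  -- Before `R` the bound comes from continuity on a compact interval.
  have hK : IsCompact (Set.Icc (⟨1, Set.self_mem_Ici⟩ : Set.Ici (1 : ℝ)) R) := by
    rw [Subtype.isCompact_iff]
    convert isCompact_Icc (a := (1 : ℝ)) (b := R)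
    ext t
    constructor
    · rintro ⟨s, hs, rfl⟩
      exact hs
    · exact fun ht => ⟨⟨t, ht.1⟩, ht, rfl⟩
  obtain ⟨C', hC'⟩ := hK.exists_bound_of_continuousOn (hπ.continuous a).continuousOn
  refine ⟨max C C', fun t => ?_⟩
  rcases le_total R t with ht | ht
  · exact (hR t ht).trans (le_max_left _ _)
  · exact (hC' t ⟨t.2, ht⟩).trans (le_max_right _ _)

end Bounded

/-! ### The lifting algebra of asymptotic families -/

section AsymptoticLifting

open Filter Topology BoundedContinuousFunction

variable (B : Type w) [NonUnitalCStarAlgebra B]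

/-- Bounded continuous families modulo families vanishing at infinity. -/
abbrev AsympQuotient : Type w := CStarQuotient (vanishingIdeal B) isCStarIdeal_vanishingIdeal

/-- The quotient map. -/
def asympQuot : asympAlgebra B →⋆ₐ[ℂ] AsympQuotient B :=
  (isCStarIdeal_vanishingIdeal (B := B)).quot

/-- The common image of a family in `Q(B)`. -/
def asympValue : asympAlgebra B →⋆ₐ[ℂ] Corona B where
  toFun f := coronaMk B (f.1 ⟨1, Set.self_mem_Ici⟩)
  map_one' := rfl
  map_mul' _ _ := map_mul (coronaMk B) _ _
  map_zero' := rfl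
  map_add' _ _ := rfl
  commutes' _ := rfl
  map_star' _ := rfl

/-- Constant families. -/
def asympConst : Multiplier B →⋆ₐ[ℂ] asympAlgebra B where
  toFun x := ⟨BoundedContinuousFunction.const _ x, fun _ => rfl⟩
  map_one' := rfl
  map_mul' _ _ := rfl
  map_zero' := rfl
  map_add' _ _ := rfl
  commutes' _ := rfl
  map_star' _ := rfl

/-- The map to `Q(B)` induced on the quotient. -/
def asympQuotientValue : AsympQuotient B →⋆ₐ[ℂ] Corona B :=
  (isCStarIdeal_vanishingIdeal (B := B)).lift (asympValue B) fun _ hf =>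
    (coronaMk_eq_zero B).2 (exists_toMult_of_mem_vanishingIdeal hf _)

variable {B}

theorem asympQuot_surjective : Function.Surjective (asympQuot B) :=
  IsCStarIdeal.quot_surjective

theorem asympQuot_eq {f g : asympAlgebra B} :
    asympQuot B f = asympQuot B g ↔ Tendsto (fun t => ‖f.1 t - g.1 t‖) atTop (𝓝 0) :=
  (isCStarIdeal_vanishingIdeal (B := B)).quot_eq_mk

theorem asympQuotientValue_asympQuot (f : asympAlgebra B) (t : Set.Ici (1 : ℝ)) :
    asympQuotientValue B (asympQuot B f) = coronaMk B (f.1 t) :=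
  (f.2 t).symm

/-- An element of `B`, asymptotically central for a given sequence and asymptotically a unit for
given families in `B`. -/
theorem exists_asymptotic_unit {ι κ : Type} [Encodable ι] [Encodable κ] (x : ι → asympAlgebra B)
    (y : κ → asympAlgebra B) (hy : ∀ j, asympValue B (y j) = 0) :
    ∃ s : AsympQuotient B, IsSelfAdjoint s ∧ ‖s‖ ≤ 1 ∧ asympQuotientValue B s = 0 ∧
      (∀ i, Commute s (asympQuot B (x i))) ∧ ∀ j, s * asympQuot B (y j) = asympQuot B (y j) := by
  have hpos : ∀ t : Set.Ici (1 : ℝ), 0 < (t : ℝ) := fun t => one_pos.trans_le t.2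
  have hδ : Continuous fun t : Set.Ici (1 : ℝ) => (t : ℝ)⁻¹ :=
    continuous_subtype_val.inv₀ fun t => (hpos t).ne'
  have hlim : Tendsto (fun t : Set.Ici (1 : ℝ) => (t : ℝ)) atTop atTop :=
    tendsto_atTop.2 fun b =>
      (eventually_ge_atTop (⟨max b 1, le_max_right b 1⟩ : Set.Ici (1 : ℝ))).mono
        fun _ ht => (le_max_left b 1).trans ht
  have hδlim : Tendsto (fun t : Set.Ici (1 : ℝ) => (t : ℝ)⁻¹) atTop (𝓝 0) :=
    tendsto_inv_atTop_zero.comp hlim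
  -- At time `t` the indices coded by numbers up to `t` are treated, to within 1/t; every index is
  -- eventually included.
  obtain ⟨e, he⟩ := exists_quasicentral_path (B := B) (ρ := fun t : Set.Ici (1 : ℝ) => (t : ℝ))
    continuous_subtype_val hδ (fun t => inv_pos.2 (hpos t)) (x := fun i t => (x i).1 t)
    (fun i => (x i).1.continuous) (y := fun j t => (y j).1 t) (fun j => (y j).1.continuous)
    fun j t => (coronaMk_eq_zero B).1 (((y j).2 t).trans (hy j))
  have hn : ∀ t, ‖e t‖ ≤ 1 := fun t => (he t).2.1
  refine ⟨asympQuot B (asympOfIdeal e hn), ?_, ?_, ?_, fun i => ?_, fun j => ?_⟩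
  · rw [IsSelfAdjoint, ← map_star]
    congr 1
    refine Subtype.ext (BoundedContinuousFunction.ext fun t => ?_)
    change star (toMult B (e t)) = toMult B (e t)
    rw [← map_star, (he t).1.star_eq]
  · refine (NonUnitalStarAlgHom.norm_apply_le
      (asympQuot B : asympAlgebra B →⋆ₙₐ[ℂ] AsympQuotient B) _).trans ?_
    exact (BoundedContinuousFunction.norm_le zero_le_one).2 fun t =>
      (norm_toMult B _).le.trans (hn t)
  · exact (coronaMk_eq_zero B).2 ⟨_, rfl⟩
  · rw [Commute, SemiconjBy, ← map_mul, ← map_mul, asympQuot_eq]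
    refine squeeze_zero' (Eventually.of_forall fun t => norm_nonneg _) ?_ hδlim
    filter_upwards [hlim.eventually_ge_atTop (Encodable.encode i : ℝ)] with t ht
    exact (he t).2.2.2.2 i ht
  · rw [← map_mul, asympQuot_eq]
    refine squeeze_zero' (Eventually.of_forall fun t => norm_nonneg _) ?_ hδlim
    filter_upwards [hlim.eventually_ge_atTop (Encodable.encode j : ℝ)] with t ht
    exact (he t).2.2.2.1 j ht

variable (B) in
/-- The lifting algebra of asymptotic families. -/
def asympLifting : LiftingAlgebra B where
  carrier := AsympQuotient B
  p := asympQuotientValue B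
  c := (asympQuot B).comp (asympConst B)
  p_c x := rfl
  lift_unitary V X hXc w hw hX := by
    obtain ⟨m, rfl⟩ := coronaMk_surjective B w
    -- Adjoining 0 makes the set nonempty, so that it can be enumerated by ℕ.
    obtain ⟨z, hz⟩ := (hXc.insert 0).exists_eq_range (Set.insert_nonempty 0 X)
    choose f hf using fun n => asympQuot_surjective (z n)
    have hcomm : ∀ n, Commute (coronaMk B m) (asympValue B (f n)) := by
      intro n
      have hmem : z n ∈ insert 0 X := hz ▸ ⟨n, rfl⟩
      have h : Commute (coronaMk B m) (asympQuotientValue B (z n)) := by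
        rcases hmem with h | h
        · rw [h, map_zero]
          exact Commute.zero_right _
        · exact hX _ h
      rw [← hf n] at h
      exact h
    have hcomm' := fun n => commute_star_of_mem_unitary hw (hcomm n)
    let M : asympAlgebra B := asympConst B m
    have hM : asympValue B M = coronaMk B m := rfl
    -- The defects of the lift `m`: how far it is from unitary and from commuting with the given
    -- elements. They vanish in `Q(B)`, so some `s` acts on them as a unit and `r = √(1 - s²)`
    -- annihilates them, as the rotation lemmas require.
    let y : Bool ⊕ (ℕ × Bool) → asympAlgebra B := fun j => match j with
      | .inl true => M * star M - 1
      | .inl false => star M * M - 1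
      | .inr (n, true) => M * f n - f n * M
      | .inr (n, false) => star M * f n - f n * star M
    have hy : ∀ j, asympValue B (y j) = 0 := by
      intro j
      match j with
      | .inl true =>
        change asympValue B (M * star M - 1) = 0
        rw [map_sub, map_mul, map_star, hM, Unitary.mul_star_self_of_mem hw, map_one, sub_self]
      | .inl false =>
        change asympValue B (star M * M - 1) = 0
        rw [map_sub, map_mul, map_star, hM, Unitary.star_mul_self_of_mem hw, map_one, sub_self]
      | .inr (n, true) =>
        change asympValue B (M * f n - f n * M) = 0
        rw [map_sub, map_mul, map_mul, hM, (hcomm n).eq, sub_self]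
      | .inr (n, false) =>
        change asympValue B (star M * f n - f n * star M) = 0
        rw [map_sub, map_mul, map_mul, map_star, hM, (hcomm' n).eq, sub_self]
    obtain ⟨s, hs, hs1, hs0, hsx, hsy⟩ := exists_asymptotic_unit (ι := Option ℕ)
      (fun i => i.elim M f) y hy
    set x := asympQuot B M
    have hsx' : Commute s x := hsx none
    have hsz : ∀ n, Commute s (z n) := fun n => hf n ▸ hsx (some n)
    set r := sqrtComplement s
    have hrx : Commute r x := commute_sqrtComplement hs hsx'
    have hr0 : ∀ {a : asympAlgebra B} (j), y j = a → r * asympQuot B a = 0 := fun j hj =>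
      hj ▸ sqrtComplement_mul_eq_zero hs hs1 (hsy j)
    have h1 : r * (x * star x) = r := by
      have h := hr0 (.inl true) rfl
      rw [map_sub, map_mul, map_star, map_one, mul_sub, mul_one, sub_eq_zero] at h
      exact h
    have h2 : r * (star x * x) = r := by
      have h := hr0 (.inl false) rfl
      rw [map_sub, map_mul, map_star, map_one, mul_sub, mul_one, sub_eq_zero] at h
      exact h
    have h3 : ∀ n, r * (x * z n) = r * (z n * x) := by
      intro n
      have h := hr0 (.inr (n, true)) rfl
      rw [map_sub, map_mul, map_mul, hf, mul_sub, sub_eq_zero] at h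
      exact h
    have h4 : ∀ n, r * (star x * z n) = r * (z n * star x) := by
      intro n
      have h := hr0 (.inr (n, false)) rfl
      rw [map_sub, map_mul, map_mul, map_star, hf, mul_sub, sub_eq_zero] at h
      exact h
    set c := (asympQuot B).comp (asympConst B)
    have hS := V.isOrthoFamily.map c
    have hS1 : ∑ i, c (V.fam i) * star (c (V.fam i)) = 1 := by
      simp_rw [← map_star, ← map_mul]
      rw [← map_sum, V.sum_fam, map_one]
    have hrs : Commute r s := commute_sqrtComplement hs (Commute.refl s)
    obtain ⟨hu, hu'⟩ := star_mul_self_rotation hs.star_eq (star_sqrtComplement s) hrs.eq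
      hsx'.symm.eq hrx.symm.eq (mul_self_add_sqrtComplement hs hs1) h2 h1
    refine ⟨StarAlgHom.id ℂ _, famMat (fun i => c (V.fam i)) (rotation x s r),
      famMat_mem_unitary hS hS1 hu hu', fun _ => rfl, ?_, fun a ha => ?_⟩
    -- Over `Q(B)` the sine `s` becomes 0 and the cosine 1, so the rotation is at its starting
    -- position.
    · rw [map_famMat, map_rotation, hs0, map_sqrtComplement _ hs hs0, rotation_zero_one,
        famMat_diagonal]
      rfl
    · have ha' : a ∈ Set.range z := hz ▸ Set.mem_insert_of_mem 0 ha
      obtain ⟨n, rfl⟩ := ha'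
      exact commute_famMat hS (commute_rotation (hsz n) (commute_sqrtComplement hs (hsz n))
        (h3 n) (h4 n))

/-- An asymptotic homomorphism defines a homomorphism to the quotient algebra. -/
theorem exists_hom_of_isAsymptoticallySplit {A : Type*} [NonUnitalCStarAlgebra A]
    {φ : Extension A B} (h : IsAsymptoticallySplit φ) :
    ∃ Φ : A →⋆ₙₐ[ℂ] AsympQuotient B, ∀ a, asympQuotientValue B (Φ a) = φ a := by
  obtain ⟨π, hπ, hφ⟩ := h
  choose C hC using fun a => exists_norm_le_of_isAsymptoticHom hπ a
  let F : A → asympAlgebra B := fun a =>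
    ⟨BoundedContinuousFunction.ofNormedAddCommGroup (fun t => π t a) (hπ.continuous a) (C a)
      (hC a), fun t => (hφ t a).trans (hφ _ a).symm⟩
  have hπ0 : Tendsto (fun t => ‖π t 0‖) atTop (𝓝 0) := by
    have h := hπ.smul 0 0
    simpa using h
  let Φ : A →⋆ₙₐ[ℂ] AsympQuotient B :=
    { toFun := fun a => asympQuot B (F a)
      map_smul' := fun c a => by
        rw [← map_smul]
        exact asympQuot_eq.2 (hπ.smul c a)
      map_zero' := by
        rw [← map_zero (asympQuot B)]
        exact asympQuot_eq.2 (by simpa using! hπ0)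
      map_add' := fun a b => by
        rw [← map_add]
        exact asympQuot_eq.2 (hπ.add a b)
      map_mul' := fun a b => by
        rw [← map_mul]
        exact asympQuot_eq.2 (hπ.mul a b)
      map_star' := fun a => by
        rw [← map_star]
        exact asympQuot_eq.2 (hπ.star a) }
  exact ⟨Φ, fun a => hφ _ a⟩

/-- Any choice of representatives works: equality modulo families vanishing at infinity is exactly
an asymptotic relation, and continuity in `a` is not part of the definition. -/
theorem isAsymptoticallySplit_of_hom {A : Type*} [NonUnitalCStarAlgebra A]
    {φ : Extension A B} (Φ : A →⋆ₙₐ[ℂ] AsympQuotient B)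
    (hΦ : ∀ a, asympQuotientValue B (Φ a) = φ a) : IsAsymptoticallySplit φ := by
  choose F hF using fun a => asympQuot_surjective (B := B) (Φ a)
  refine ⟨fun t a => (F a).1 t, ⟨fun a => (F a).1.continuous, fun a b => ?_, fun c a => ?_,
    fun a b => ?_, fun a => ?_⟩, fun t a => ?_⟩
  · refine (asympQuot_eq (f := F (a + b)) (g := F a + F b)).1 ?_
    rw [hF, map_add Φ a b, ← hF a, ← hF b, ← map_add (asympQuot B)]
  · refine (asympQuot_eq (f := F (c • a)) (g := c • F a)).1 ?_
    rw [hF, map_smul Φ c a, ← hF a, ← map_smul (asympQuot B)]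
  · refine (asympQuot_eq (f := F (a * b)) (g := F a * F b)).1 ?_
    rw [hF, map_mul Φ a b, ← hF a, ← hF b, ← map_mul (asympQuot B)]
  · refine (asympQuot_eq (f := F (star a)) (g := star (F a))).1 ?_
    rw [hF, map_star Φ a, ← hF a, ← map_star (asympQuot B)]
  · rw [← asympQuotientValue_asympQuot, hF]
    exact hΦ a

theorem asympLifting_lifts_iff {A : Type*} [NonUnitalCStarAlgebra A] (φ : Extension A B) :
    (asympLifting B).Lifts φ ↔ IsAsymptoticallySplit φ :=
  ⟨fun h => h.elim isAsymptoticallySplit_of_hom, exists_hom_of_isAsymptoticallySplit⟩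

theorem isSemiInvertible_iff {A : Type*} [NonUnitalCStarAlgebra A] (φ : Extension A B) :
    IsSemiInvertible φ ↔ (asympLifting B).Invertible φ := by
  simp only [IsSemiInvertible, LiftingAlgebra.Invertible, asympLifting_lifts_iff]

end AsymptoticLifting

/-! ### Adjoining the finite group and the copies of ℤ -/

section Iteration

variable {B : Type w} [NonUnitalCStarAlgebra B]

/-- `ℤ^{k+1} × G ≅ ℤ × (ℤ^k × G)`. -/
def intPowSuccEquiv (k : ℕ) (G : Type u) [Group G] :
    ULift.{u} (Multiplicative ℤ) × (Multiplicative (Fin k → ℤ) × G)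
      ≃* Multiplicative (Fin (k + 1) → ℤ) × G where
  toFun p := (.ofAdd (Fin.cons p.1.down.toAdd p.2.1.toAdd), p.2.2)
  invFun p := (.up (.ofAdd (p.1.toAdd 0)), .ofAdd (Fin.tail p.1.toAdd), p.2)
  left_inv p := by simp
  right_inv p := by simp
  map_mul' p q := by
    refine Prod.ext ?_ rfl
    change Multiplicative.ofAdd _ = Multiplicative.ofAdd _
    congr 1
    ext i
    refine Fin.cases ?_ (fun i => ?_) i <;> rfl

/-- `H × G ≅ ℤ^0 × H × G`. -/
def intPowZeroEquiv (G : Type u) [Group G] : G ≃* Multiplicative (Fin 0 → ℤ) × G where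
  toFun g := (1, g)
  invFun p := p.2
  left_inv _ := rfl
  right_inv _ := Prod.ext (Subsingleton.elim _ _) rfl
  map_mul' _ _ := rfl

theorem invertible_reduced {L : LiftingAlgebra B} {G H : Type u} [Group G] [Countable G] [Group H]
    [Finite H] (k : ℕ) (h : ∀ φ : Extension (ReducedGroupCStar G) B, L.Invertible φ) :
    ∀ φ : Extension (ReducedGroupCStar (Multiplicative (Fin k → ℤ) × H × G)) B,
      L.Invertible φ := by
  induction k with
  | zero =>
    have hmn := isProductModel_reduced (intPowZeroEquiv (H × G))
    exact (dilates_finite hmn).invertible hmn h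
  | succ k ih =>
    have : Countable (Multiplicative (Fin k → ℤ)) := inferInstanceAs (Countable (Fin k → ℤ))
    have hmn := isProductModel_reduced (intPowSuccEquiv k (H × G))
    exact (dilates_int hmn).invertible hmn ih

theorem invertible_full {L : LiftingAlgebra B} {G H : Type u} [Group G] [Countable G] [Group H]
    [Finite H] (k : ℕ) (h : ∀ φ : Extension (FullGroupCStar G) B, L.Invertible φ) :
    ∀ φ : Extension (FullGroupCStar (Multiplicative (Fin k → ℤ) × H × G)) B,
      L.Invertible φ := by
  induction k with
  | zero =>
    have hmn := isProductModel_full (intPowZeroEquiv (H × G))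
    exact (dilates_finite hmn).invertible hmn h
  | succ k ih =>
    have : Countable (Multiplicative (Fin k → ℤ)) := inferInstanceAs (Countable (Fin k → ℤ))
    have hmn := isProductModel_full (intPowSuccEquiv k (H × G))
    exact (dilates_int hmn).invertible hmn ih

end Iteration

end CStarExt

end

open CStarExt
theorem proposition4p8 {G H : Type u} [Group G] [Countable G] [Group H] [Finite H] (k : ℕ)
    {B : Type w} [NonUnitalCStarAlgebra B] [TopologicalSpace.SeparableSpace B]
    (hB : IsStable B) :
    (AllSemiInvertible (ReducedGroupCStar G) B →
      AllSemiInvertible (ReducedGroupCStar (Multiplicative (Fin k → ℤ) × H × G)) B) ∧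
    (AllStronglyHomotopyInvertible (ReducedGroupCStar G) B →
      AllStronglyHomotopyInvertible
        (ReducedGroupCStar (Multiplicative (Fin k → ℤ) × H × G)) B) ∧
    (AllSemiInvertible (FullGroupCStar G) B →
      AllSemiInvertible (FullGroupCStar (Multiplicative (Fin k → ℤ) × H × G)) B) ∧
    (AllStronglyHomotopyInvertible (FullGroupCStar G) B →
      AllStronglyHomotopyInvertible
        (FullGroupCStar (Multiplicative (Fin k → ℤ) × H × G)) B) := by
  -- All four claims become invertibility over one of the two lifting algebras.
  simp only [AllSemiInvertible, AllStronglyHomotopyInvertible, isSemiInvertible_iff,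
    isStronglyHomotopyInvertible_iff]
  exact ⟨invertible_reduced k, invertible_reduced k, invertible_full k, invertible_full k⟩
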